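/- **Setting.** Let $M$ be a compact connected smooth manifold without boundary, $m=\dim M$, let $g$ be a smooth Riemannian metric on $M$, and let $\boldsymbol V\subset C^\infty(M)$ be a finite dimensional subspace, equipped with the inner product $(\boldsymbol u,\boldsymbol v)=\int_M \boldsymbol u\boldsymbol v\,|dV_g|$, such that for every $x\in M$ the adjunction map $\mathcal A_x:\boldsymbol V\to T_x^*M$, $\boldsymbol v\mapsto d_x\boldsymbol v$, is onto (ampleness). Write $\boldsymbol K_x=\ker\mathcal A_x$; let $\mathcal A_x^\dagger:T_xM\to\boldsymbol V$ be the dual map, $(\mathcal A_x^\dagger X,\boldsymbol v)=d_x\boldsymbol v(X)$, and let $\mathrm{ev}_x\in\boldsymbol V$ be determined by $(\mathrm{ev}_x,\boldsymbol v)=\boldsymbol v(x)$. For a finite dimensional Euclidean space $W$, $S(W)$ is its unit sphere with area measure $|dS|$, and $|dV|$ is its Lebesgue measure. Set $$\mu(M,g,\boldsymbol V)=\frac{1}{\mathrm{area}\,S(\boldsymbol V)}\int_{S(\boldsymbol V)}\#\{x\in M:\ d_x\boldsymbol v=0\}\,|dS(\boldsymbol v)| .$$ The triple $(M,g,\boldsymbol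 V)$ is *homogeneous* if some compact Lie group acts smoothly and transitively on $M$ by isometries of $g$, and the induced action on functions by pullback preserves $\boldsymbol V$ and its inner product. A *core* of the triple is a quadruple $(p,\underline{\boldsymbol f},\boldsymbol L,\boldsymbol w)$ consisting of a point $p\in M$, an orthonormal frame $\underline{\boldsymbol f}=\{\boldsymbol f_1,\dots,\boldsymbol f_m\}$ of $T_pM$, a subspace $\boldsymbol L\subset\boldsymbol V$ and a function $\boldsymbol w\in\boldsymbol V$ such that (orthogonal complements are taken in $\boldsymbol V$): * $(P_1)$ the vectors $\mathcal A_p^\dagger\boldsymbol f_1,\dots,\mathcal A_p^\dagger\boldsymbol f_m$ are mutually orthogonal; * $(P_2)$ $\boldsymbol L\subset\boldsymbol K_p$, and $H(\boldsymbol v)=0$ for every $\boldsymbol v\in\boldsymbol L^\perp$, where $H(\boldsymbol v)$ denotes the matrix, in the frame $\underline{\boldsymbol f}$, of the Hessian of $\boldsymbol v$ at $p$ (with respect to the Levi-Civita connection of $g$); * $(P_3)$ $\boldsymbol w\in\boldsymbol K_p\cap\boldsymbol L^\perp$, $\boldsymbol w(p)\ne0$ and $|\boldsymbol w|=1$; put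 $\widehat{\boldsymbol L}=\boldsymbol L\oplus\mathrm{span}(\boldsymbol w)$; * $(P_4)$ $\boldsymbol v(p)=0$ for every $\boldsymbol v\in\widehat{\boldsymbol L}^\perp$. The triple is *special* if it is homogeneous and admits a core. For a linear map $S:U\to W$ of Euclidean spaces with $\dim U\le\dim W$, $J(S)=\sqrt{\det (S\boldsymbol e_i,S\boldsymbol e_j)_{i,j}}$, where $(\boldsymbol e_i)$ is an orthonormal basis of $U$. **Proposition 4.2.** (a) Suppose that $(M,g,\boldsymbol V)$ is a special triple and $(p,\underline{\boldsymbol f},\boldsymbol L,\boldsymbol w)$ is a core of it. Let $m=\dim M$ and $\ell=\dim\boldsymbol L$. Then $$\mu(M,g,\boldsymbol V)=\frac{\mathrm{vol}_g(M)}{\pi^{\frac{\ell+m}{2}}\prod_{r=1}^m|\mathcal A_p^\dagger\boldsymbol f_r|}\int_{\boldsymbol L}e^{-|\boldsymbol u|^2}|\det H(\boldsymbol u)|\,|dV(\boldsymbol u)| ,$$ and, if $m\ge1$, also $$\mu(M,g,\boldsymbol V)=\frac{\mathrm{vol}_g(M)\,\Gamma(\frac{\ell+m}{2})}{2\pi^{\frac{\ell+m}{2}}\prod_{r=1}^m|\mathcal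 A_p^\dagger\boldsymbol f_r|}\int_{S(\boldsymbol L)}|\det H(\boldsymbol v)|\,|dS(\boldsymbol v)| .$$ (b) Suppose that $(M_\alpha,g_\alpha,\boldsymbol V_\alpha)$, $\alpha=1,2$, are special triples with cores $(p_\alpha,\underline{\boldsymbol f}^\alpha,\boldsymbol L_\alpha,\boldsymbol w_\alpha)$ and $m_\alpha=\dim M_\alpha$. Let $\boldsymbol V_1\otimes\boldsymbol V_2\subset C^\infty(M_1\times M_2)$ be the span of the functions $(x_1,x_2)\mapsto\boldsymbol v_1(x_1)\boldsymbol v_2(x_2)$, $\boldsymbol v_\alpha\in\boldsymbol V_\alpha$. Then the triple $(M_1\times M_2,\,g_1\oplus g_2,\,\boldsymbol V_1\otimes\boldsymbol V_2)$ is special, and a core of it is $(p,\underline{\boldsymbol f},\boldsymbol L,\boldsymbol w)$, where $$p=(p_1,p_2),\qquad \underline{\boldsymbol f}=\underline{\boldsymbol f}^1\cup\underline{\boldsymbol f}^2,\qquad \boldsymbol w(x_1,x_2)=\boldsymbol w_1(x_1)\boldsymbol w_2(x_2),$$ $$\boldsymbol L=(\boldsymbol L_1*\boldsymbol L_2)\oplus(\boldsymbol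 K_{p_1}^\perp\otimes\boldsymbol K_{p_2}^\perp)\quad\text{(an orthogonal direct sum)},$$ and $\boldsymbol L_1*\boldsymbol L_2$ is the orthogonal complement of $\boldsymbol w$ in $\widehat{\boldsymbol L}_1\otimes\widehat{\boldsymbol L}_2$. Moreover $$|\mathrm{ev}_{(p_1,p_2)}|=|\mathrm{ev}_{p_1}|\cdot|\mathrm{ev}_{p_2}|,$$ $$J(\mathcal A^\dagger_{(p_1,p_2)})=J(\mathcal A^\dagger_{p_1})\,J(\mathcal A^\dagger_{p_2})\,\frac{(|\mathrm{ev}_{p_1}|\cdot|\mathrm{ev}_{p_2}|)^{m_1+m_2}}{|\mathrm{ev}_{p_1}|^{m_1}\,|\mathrm{ev}_{p_2}|^{m_2}} .$$ -/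

import Mathlib

open scoped Manifold ContDiff ENNReal
open MeasureTheory

noncomputable section

set_option linter.unusedSectionVars false
set_option maxSynthPendingDepth 3

namespace CritSet

/-! ### Riemannian metrics, pullbacks, products -/

section Metric

variable {E : Type*} [NormedAddCommGroup E] [NormedSpace ℝ E]
  {H : Type*} [TopologicalSpace H] {I : ModelWithCorners ℝ E H}
  {M : Type*} [TopologicalSpace M] [ChartedSpace H M] [IsManifold I ∞ M]
  {E₁ : Type*} [NormedAddCommGroup E₁] [NormedSpace ℝ E₁]
  {H₁ : Type*} [TopologicalSpace H₁] {I₁ : ModelWithCorners ℝ E₁ H₁}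
  {M₁ : Type*} [TopologicalSpace M₁] [ChartedSpace H₁ M₁] [IsManifold I₁ ∞ M₁]
  {E₂ : Type*} [NormedAddCommGroup E₂] [NormedSpace ℝ E₂]
  {H₂ : Type*} [TopologicalSpace H₂] {I₂ : ModelWithCorners ℝ E₂ H₂}
  {M₂ : Type*} [TopologicalSpace M₂] [ChartedSpace H₂ M₂] [IsManifold I₂ ∞ M₂]

/-- Smooth Riemannian metrics on the manifold `M`. -/
abbrev RMetric (I : ModelWithCorners ℝ E H) (M : Type*) [TopologicalSpace M] [ChartedSpace H M]
    [IsManifold I ∞ M] :=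
  Bundle.ContMDiffRiemannianMetric I ∞ E (fun x : M => TangentSpace I x)

/-- The pullback `f^* g` at `x`: the bilinear form `(u, w) ↦ g (df u) (df w)` on `T_x M`. -/
def pullbackForm (g : RMetric I₁ M₁) (f : M → M₁) (x : M) :
    TangentSpace I x →L[ℝ] TangentSpace I x →L[ℝ] ℝ :=
  (ContinuousLinearMap.precomp ℝ (mfderiv I I₁ f x)).comp
    ((g.inner (f x)).comp (mfderiv I I₁ f x))

theorem pullbackForm_apply (g : RMetric I₁ M₁) (f : M → M₁) (x : M) (u w : TangentSpace I x) :
    pullbackForm g f x u w = g.inner (f x) (mfderiv I I₁ f x u) (mfderiv I I₁ f x w) := rfl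

open ContinuousLinearMap in
theorem contMDiffAt_pullbackForm (g : RMetric I₁ M₁) {f : M → M₁} {x₀ : M}
    (hf : ContMDiffAt I I₁ ∞ f x₀) :
    ContMDiffAt I (I.prod 𝓘(ℝ, E →L[ℝ] E →L[ℝ] ℝ)) ∞
      (fun b => Bundle.TotalSpace.mk' (E →L[ℝ] E →L[ℝ] ℝ)
        (E := fun b : M => TangentSpace I b →L[ℝ] TangentSpace I b →L[ℝ] ℝ) b
        (pullbackForm g f b)) x₀ := by
  rw [contMDiffAt_hom_bundle]
  refine ⟨contMDiffAt_id, ?_⟩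
  have hA := hf.mfderiv_const (m := ∞) (by simp)
  have hB := ((contMDiffAt_hom_bundle _).1 (g.contMDiff (f x₀))).2
  have hB' := hB.comp x₀ hf
  set A : M → E →L[ℝ] E₁ := inTangentCoordinates I I₁ id f (mfderiv I I₁ f) x₀ with hAdef
  have hC : ContMDiffAt I 𝓘(ℝ, (E₁ →L[ℝ] ℝ) →L[ℝ] (E →L[ℝ] ℝ)) ∞
      (fun x => (ContinuousLinearMap.compL ℝ E E₁ ℝ).flip (A x)) x₀ := by
    have hA' : ContMDiffAt I 𝓘(ℝ, E →L[ℝ] E₁) ∞ A x₀ := hA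
    exact (contMDiffAt_const (c := ((ContinuousLinearMap.compL ℝ E E₁ ℝ).flip :
        (E →L[ℝ] E₁) →L[ℝ] ((E₁ →L[ℝ] ℝ) →L[ℝ] (E →L[ℝ] ℝ))))).clm_apply hA'
  refine (hC.clm_comp (hB'.clm_comp hA)).congr_of_eventuallyEq ?_
  have h1 : ∀ᶠ x in nhds x₀, x ∈ (trivializationAt E (TangentSpace I) x₀).baseSet :=
    (trivializationAt E (TangentSpace I) x₀).open_baseSet.mem_nhds
      (FiberBundle.mem_baseSet_trivializationAt' x₀)
  have h2 : ∀ᶠ x in nhds x₀, f x ∈ (trivializationAt E₁ (TangentSpace I₁) (f x₀)).baseSet :=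
    hf.continuousAt ((trivializationAt E₁ (TangentSpace I₁) (f x₀)).open_baseSet.mem_nhds
      (FiberBundle.mem_baseSet_trivializationAt' (f x₀)))
  filter_upwards [h1, h2] with x hx hx'
  ext u w
  have hAx : ∀ u, (trivializationAt E₁ (TangentSpace I₁) (f x₀)).symm (f x) (A x u) =
      mfderiv I I₁ f x ((trivializationAt E (TangentSpace I) x₀).symm x u) := by
    intro u
    have hAx' : A x = inCoordinates E (TangentSpace I) E₁ (TangentSpace I₁) x₀ x (f x₀) (f x)
      (mfderiv I I₁ f x) := rfl
    rw [hAx', inCoordinates_eq hx hx']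
    simp [Bundle.Trivialization.symm_apply_apply_mk _ hx']
  rw [inCoordinates_apply_eq₂ hx hx (Set.mem_univ _)]
  simp only [ContinuousLinearMap.coe_comp, Function.comp_apply, flip_apply, compL_apply]
  rw [inCoordinates_apply_eq₂ hx' hx' (Set.mem_univ _), hAx, hAx]
  rfl

/-- The bilinear form `g₁ ⊕ g₂ = π₁^* g₁ + π₂^* g₂` on the tangent spaces of `M₁ × M₂`. -/
def prodInner (g₁ : RMetric I₁ M₁) (g₂ : RMetric I₂ M₂) (p : M₁ × M₂) :
    TangentSpace (I₁.prod I₂) p →L[ℝ] TangentSpace (I₁.prod I₂) p →L[ℝ] ℝ :=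
  pullbackForm g₁ Prod.fst p + pullbackForm g₂ Prod.snd p

theorem prodInner_apply (g₁ : RMetric I₁ M₁) (g₂ : RMetric I₂ M₂) (p : M₁ × M₂)
    (u w : TangentSpace (I₁.prod I₂) p) :
    prodInner g₁ g₂ p u w = g₁.inner p.1 u.1 w.1 + g₂.inner p.2 u.2 w.2 := by
  have h1 := mfderiv_fst (I := I₁) (I' := I₂) (x := p)
  have h2 := mfderiv_snd (I := I₁) (I' := I₂) (x := p)
  change pullbackForm g₁ Prod.fst p u w + pullbackForm g₂ Prod.snd p u w = _
  rw [pullbackForm_apply, pullbackForm_apply, h1, h2]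
  rfl

theorem inner_self_nonneg (g : RMetric I M) (x : M) (u : TangentSpace I x) :
    0 ≤ g.inner x u u := by
  by_cases h : u = 0
  · simp [h]
  · exact (g.pos x u h).le

/-- The product metric `g₁ ⊕ g₂` on `M₁ × M₂`. -/
def prodMetric (g₁ : RMetric I₁ M₁) (g₂ : RMetric I₂ M₂) :
    RMetric (I₁.prod I₂) (M₁ × M₂) where
  inner := prodInner g₁ g₂
  symm p u w := by
    exact (prodInner_apply g₁ g₂ p u w).trans ((congrArg₂ (· + ·) (g₁.symm p.1 _ _)
      (g₂.symm p.2 _ _)).trans (prodInner_apply g₁ g₂ p w u).symm)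
  pos p u hu := by
    rw [prodInner_apply]
    by_cases h1 : u.1 = 0
    · have h2 : u.2 ≠ 0 := fun h2 => hu (Prod.ext h1 h2)
      have := g₂.pos p.2 u.2 h2
      have := inner_self_nonneg g₁ p.1 u.1
      linarith
    · have := g₁.pos p.1 u.1 h1
      have := inner_self_nonneg g₂ p.2 u.2
      linarith
  isVonNBounded p := by
    have hb₁ : Bornology.IsBounded {v : E₁ | g₁.inner p.1 v v < 1} :=
      NormedSpace.isVonNBounded_iff ℝ |>.1 (g₁.isVonNBounded p.1)
    have hb₂ : Bornology.IsBounded {v : E₂ | g₂.inner p.2 v v < 1} :=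
      NormedSpace.isVonNBounded_iff ℝ |>.1 (g₂.isVonNBounded p.2)
    have hb : Bornology.IsBounded {v : E₁ × E₂ | prodInner g₁ g₂ p v v < 1} := by
      refine (hb₁.prod hb₂).subset fun v hv => ?_
      have hv' : g₁.inner p.1 v.1 v.1 + g₂.inner p.2 v.2 v.2 < 1 :=
        (prodInner_apply g₁ g₂ p v v).symm.trans_lt hv
      have h1 := inner_self_nonneg g₁ p.1 v.1
      have h2 := inner_self_nonneg g₂ p.2 v.2
      refine ⟨?_, ?_⟩
      · change g₁.inner p.1 v.1 v.1 < 1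
        linarith
      · change g₂.inner p.2 v.2 v.2 < 1
        linarith
    exact NormedSpace.isVonNBounded_iff ℝ |>.2 hb
  contMDiff := fun p =>
    (contMDiffAt_pullbackForm g₁ (contMDiff_fst p)).add_section
      (contMDiffAt_pullbackForm g₂ (contMDiff_snd p))

end Metric

/-! ### Riemannian volume -/

section Volume

variable {E : Type*} [NormedAddCommGroup E] [NormedSpace ℝ E]
  [FiniteDimensional ℝ E]
  {H : Type*} [TopologicalSpace H] {I : ModelWithCorners ℝ E H}
  {M : Type*} [TopologicalSpace M] [ChartedSpace H M] [IsManifold I ∞ M]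

/-- The metric read in the chart at `p`: for `y` in the chart domain in `E`, the bilinear form
`(u, w) ↦ g (dψ u) (dψ w)` on `E`, where `ψ` is the inverse of the chart. -/
def coordMetric (g : RMetric I M) (p : M) (y : E) : E →L[ℝ] E →L[ℝ] ℝ :=
  pullbackForm (I := 𝓘(ℝ, E)) g (extChartAt I p).symm y

/-- The Gram matrix `g_{ij}` of the coordinate vector fields of the chart at `p`. -/
def coordGram (g : RMetric I M) (p : M) (y : E) :
    Matrix (Fin (Module.finrank ℝ E)) (Fin (Module.finrank ℝ E)) ℝ :=
  Matrix.of fun i j => coordMetric g p y (Module.finBasis ℝ E i) (Module.finBasis ℝ E j)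

variable [MeasurableSpace E] [BorelSpace E] [MeasurableSpace M]

/-- The volume `√(det g_{ij}) dy` of the chart at `p`, as a measure on `M` living on the chart
domain. -/
def chartVolume (g : RMetric I M) (p : M) : Measure M :=
  (((Module.finBasis ℝ E).addHaar.restrict (extChartAt I p).target).withDensity
    (fun y => ENNReal.ofReal (Real.sqrt (coordGram g p y).det))).map (extChartAt I p).symm

variable (I M) in
/-- A smooth partition of unity subordinate to the charts of `M`. -/
def chartPartition [T2Space M] [SigmaCompactSpace M] : SmoothPartitionOfUnity M I M Set.univ :=
  (SmoothPartitionOfUnity.exists_isSubordinate_chartAt_source I M).choose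

/-- The Riemannian volume measure `|dV_g|`, glued from the chart volumes by a smooth partition
of unity. -/
def riemVolume [T2Space M] [SigmaCompactSpace M] (g : RMetric I M) : Measure M :=
  Measure.sum fun p =>
    (chartVolume g p).withDensity fun x => ENNReal.ofReal (chartPartition I M p x)

variable [I.Boundaryless]

theorem continuousOn_coordMetric (g : RMetric I M) (p : M) (u w : E) :
    ContinuousOn (fun y => coordMetric g p y u w) (extChartAt I p).target := by
  intro y hy
  have hψ : ContMDiffAt 𝓘(ℝ, E) I ∞ (extChartAt I p).symm y :=
    (contMDiffOn_extChartAt_symm p).contMDiffAt ((isOpen_extChartAt_target p).mem_nhds hy)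
  have h := contMDiffAt_pullbackForm g hψ
  have hu : ∀ u : E, ContMDiffAt 𝓘(ℝ, E) (𝓘(ℝ, E).prod 𝓘(ℝ, E)) ∞
      (fun y : E => (Bundle.TotalSpace.mk' E y u : TangentBundle 𝓘(ℝ, E) E)) y := by
    intro u
    exact contMDiffAt_vectorSpace_iff_contDiffAt.2 contDiffAt_const
  have h2 := ContMDiffAt.clm_bundle_apply₂ (F₁ := E) (F₂ := E) (F₃ := ℝ)
    (E₃ := Bundle.Trivial E ℝ) h (hu u) (hu w)
  have h3 := (Bundle.contMDiffAt_totalSpace.1 h2).2.continuousAt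
  exact h3.continuousWithinAt

theorem continuousOn_density (g : RMetric I M) (p : M) :
    ContinuousOn (fun y => Real.sqrt (coordGram g p y).det) (extChartAt I p).target := by
  refine Real.continuous_sqrt.comp_continuousOn ?_
  simp only [Matrix.det_apply]
  refine continuousOn_finsetSum _ fun σ _ => ContinuousOn.const_smul ?_ _
  exact continuousOn_finsetProd _ fun i _ => continuousOn_coordMetric g p _ _

theorem density_pos (g : RMetric I M) (p : M) {y : E} (hy : y ∈ (extChartAt I p).target) :
    0 < Real.sqrt (coordGram g p y).det := by
  refine Real.sqrt_pos.2 (Matrix.PosDef.det_pos ?_)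
  have hinj : Function.Injective (mfderiv 𝓘(ℝ, E) I (extChartAt I p).symm y) := by
    have h := isInvertible_mfderivWithin_extChartAt_symm (I := I) hy
    rw [I.range_eq_univ, mfderivWithin_univ] at h
    obtain ⟨e, he⟩ := h
    rw [← he]
    exact e.injective
  have hpos : ∀ u : E, u ≠ 0 → 0 < coordMetric g p y u u := fun u hu =>
    g.pos _ _ fun h0 => hu (hinj (h0.trans (map_zero _).symm))
  have hsymm : ∀ u w : E, coordMetric g p y u w = coordMetric g p y w u := fun u w =>
    g.symm _ _ _
  refine Matrix.PosDef.of_dotProduct_mulVec_pos ?_ ?_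
  · ext i j
    exact hsymm _ _
  · intro c hc
    set b := Module.finBasis ℝ E
    have hne : ∑ i, c i • b i ≠ 0 := fun h0 =>
      hc (funext (Fintype.linearIndependent_iff.1 b.linearIndependent c h0))
    have := hpos _ hne
    simp only [map_sum, map_smul, sum_apply, smul_apply,
      smul_eq_mul] at this
    simp only [dotProduct, Matrix.mulVec, coordGram, Matrix.of_apply, Finset.mul_sum, star_trivial]
    refine this.trans_eq ?_
    rw [Finset.sum_comm]
    simp only [Finset.mul_sum]
    rw [Finset.sum_comm]
    refine Finset.sum_congr rfl fun i _ => Finset.sum_congr rfl fun j _ => ?_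
    change c j * (c i * coordMetric g p y (b i) (b j)) =
      c j * (coordMetric g p y (b j) (b i) * c i)
    rw [hsymm (b i) (b j), mul_comm (c i)]

variable [BorelSpace M]

theorem aemeasurable_symm (g : RMetric I M) (p : M) :
    AEMeasurable (extChartAt I p).symm
      (((Module.finBasis ℝ E).addHaar.restrict (extChartAt I p).target).withDensity
        (fun y => ENNReal.ofReal (Real.sqrt (coordGram g p y).det))) :=
  ((continuousOn_extChartAt_symm p).aemeasurable
    (isOpen_extChartAt_target p).measurableSet).mono_ac (withDensity_absolutelyContinuous _ _)

theorem chartVolume_lt_top (g : RMetric I M) (p : M) {K : Set M} (hK : IsCompact K)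
    (hKm : MeasurableSet K) (hKs : K ⊆ (chartAt H p).source) : chartVolume g p K < ⊤ := by
  have hKs' : K ⊆ (extChartAt I p).source := by rwa [extChartAt_source]
  set L : Set E := extChartAt I p '' K with hL
  have hLc : IsCompact L := hK.image_of_continuousOn ((continuousOn_extChartAt p).mono hKs')
  have hLt : L ⊆ (extChartAt I p).target := by
    rintro _ ⟨x, hx, rfl⟩
    exact (extChartAt I p).map_source (hKs' hx)
  obtain ⟨C, hC⟩ := hLc.exists_bound_of_continuousOn ((continuousOn_density g p).mono hLt)
  have hsub : (extChartAt I p).symm ⁻¹' K ∩ (extChartAt I p).target ⊆ L := by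
    rintro y ⟨hy, hyt⟩
    exact ⟨_, hy, (extChartAt I p).right_inv hyt⟩
  rw [chartVolume, Measure.map_apply_of_aemeasurable (aemeasurable_symm g p) hKm]
  set ν := (Module.finBasis ℝ E).addHaar
  set T := (extChartAt I p).target
  set S := (extChartAt I p).symm ⁻¹' K
  set δ : E → ℝ≥0∞ := fun y => ENNReal.ofReal (Real.sqrt (coordGram g p y).det)
  have hTm : MeasurableSet T := (isOpen_extChartAt_target p).measurableSet
  have hae : ∀ᵐ y ∂((ν.restrict T).withDensity δ), y ∈ S → y ∈ L := by
    have h1 : ∀ᵐ y ∂((ν.restrict T).withDensity δ), y ∈ T :=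
      (withDensity_absolutelyContinuous _ _).ae_le (ae_restrict_mem hTm)
    filter_upwards [h1] with y hy hyS
    exact hsub ⟨hyS, hy⟩
  have h2 : (ν.restrict T).withDensity δ S ≤ (ν.restrict T).withDensity δ L :=
    measure_mono_ae hae
  refine h2.trans_lt ?_
  rw [withDensity_apply _ hLc.measurableSet, Measure.restrict_restrict hLc.measurableSet,
    Set.inter_eq_left.2 hLt]
  calc ∫⁻ y in L, δ y ∂ν ≤ ∫⁻ _ in L, ENNReal.ofReal C ∂ν :=
        setLIntegral_mono measurable_const fun y hy =>
          ENNReal.ofReal_le_ofReal ((le_abs_self _).trans (hC y hy))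
    _ = ENNReal.ofReal C * ν L := by simp
    _ < ⊤ := ENNReal.mul_lt_top ENNReal.ofReal_lt_top hLc.measure_lt_top

theorem chartVolume_pos (g : RMetric I M) (p : M) {U : Set M} (hU : IsOpen U)
    (hne : (U ∩ (chartAt H p).source).Nonempty) : chartVolume g p U ≠ 0 := by
  rw [chartVolume, Measure.map_apply_of_aemeasurable (aemeasurable_symm g p) hU.measurableSet]
  set ν := (Module.finBasis ℝ E).addHaar
  set T := (extChartAt I p).target with hT
  set S := (extChartAt I p).symm ⁻¹' U
  set δ : E → ℝ≥0∞ := fun y => ENNReal.ofReal (Real.sqrt (coordGram g p y).det)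
  have hTo : IsOpen T := isOpen_extChartAt_target p
  have hW : IsOpen (T ∩ S) := (continuousOn_extChartAt_symm p).isOpen_inter_preimage hTo hU
  have hWne : (T ∩ S).Nonempty := by
    obtain ⟨x, hxU, hxs⟩ := hne
    have hxs' : x ∈ (extChartAt I p).source := by rwa [extChartAt_source]
    refine ⟨extChartAt I p x, (extChartAt I p).map_source hxs', ?_⟩
    change (extChartAt I p).symm (extChartAt I p x) ∈ U
    rwa [(extChartAt I p).left_inv hxs']
  have hνW : ν (T ∩ S) ≠ 0 := (hW.measure_pos ν hWne).ne'
  intro h0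
  have h1 : (ν.restrict T).withDensity δ (T ∩ S) = 0 :=
    measure_mono_null Set.inter_subset_right h0
  rw [withDensity_apply _ hW.measurableSet, Measure.restrict_restrict hW.measurableSet,
    Set.inter_eq_left.2 (Set.inter_subset_left : T ∩ S ⊆ T)] at h1
  have hδ : AEMeasurable δ (ν.restrict (T ∩ S)) :=
    (((continuousOn_density g p).mono Set.inter_subset_left).aemeasurable
      hW.measurableSet).ennreal_ofReal
  rw [lintegral_eq_zero_iff' hδ] at h1
  have h2 : ∀ᵐ y ∂(ν.restrict (T ∩ S)), False := by
    filter_upwards [h1, ae_restrict_mem hW.measurableSet] with y hy hyW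
    have hp := density_pos g p hyW.1
    have hy0 : ENNReal.ofReal (Real.sqrt (coordGram g p y).det) = 0 := hy
    exact absurd (ENNReal.ofReal_eq_zero.1 hy0) (not_le.2 hp)
  rw [Filter.eventually_false_iff_eq_bot, ae_eq_bot, Measure.restrict_eq_zero] at h2
  exact hνW h2

theorem chartPartition_subordinate [T2Space M] [SigmaCompactSpace M] :
    (chartPartition I M).IsSubordinate fun x => (chartAt H x).source :=
  (SmoothPartitionOfUnity.exists_isSubordinate_chartAt_source I M).choose_spec

/-- The volume of a compact manifold is finite. -/
instance isFiniteMeasure_riemVolume [T2Space M] [CompactSpace M] (g : RMetric I M) :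
    IsFiniteMeasure (riemVolume g) := by
  constructor
  rw [riemVolume, Measure.sum_apply _ MeasurableSet.univ]
  set ρ := chartPartition I M
  have hfin : (Function.support fun p => (ρ p : M → ℝ)).Finite := by
    refine (ρ.locallyFinite.finite_nonempty_of_compact).subset fun p hp => ?_
    exact Function.support_nonempty_iff.2 hp
  have hle : ∀ p, ((chartVolume g p).withDensity fun x => ENNReal.ofReal (ρ p x)) Set.univ < ⊤ := by
    intro p
    have hKc : IsCompact (tsupport (ρ p)) := (isClosed_tsupport _).isCompact
    have hKm : MeasurableSet (tsupport (ρ p)) := (isClosed_tsupport _).measurableSet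
    rw [withDensity_apply _ MeasurableSet.univ, Measure.restrict_univ]
    calc ∫⁻ x, ENNReal.ofReal (ρ p x) ∂(chartVolume g p)
        ≤ ∫⁻ x, (tsupport (ρ p)).indicator 1 x ∂(chartVolume g p) := by
          refine lintegral_mono fun x => ?_
          by_cases hx : x ∈ tsupport (ρ p)
          · rw [Set.indicator_of_mem hx]
            exact ENNReal.ofReal_le_one.2 (ρ.le_one p x)
          · rw [image_eq_zero_of_notMem_tsupport hx]
            simp
      _ = chartVolume g p (tsupport (ρ p)) := lintegral_indicator_one hKm
      _ < ⊤ := chartVolume_lt_top g p hKc hKm (chartPartition_subordinate p)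
  rw [tsum_eq_sum (s := hfin.toFinset)]
  · exact ENNReal.sum_lt_top.2 fun p _ => hle p
  · intro p hp
    have h0 : (ρ p : M → ℝ) = 0 := by
      by_contra h
      exact hp (hfin.mem_toFinset.2 h)
    rw [h0]
    simp

/-- Nonempty open sets have positive volume. -/
instance isOpenPosMeasure_riemVolume [T2Space M] [SigmaCompactSpace M] (g : RMetric I M) :
    (riemVolume g).IsOpenPosMeasure := by
  constructor
  rintro U hU ⟨x, hx⟩ h0
  set ρ := chartPartition I M
  obtain ⟨p, hp⟩ : ∃ p, 0 < ρ p x := ρ.exists_pos_of_mem (Set.mem_univ x)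
  rw [riemVolume, Measure.sum_apply _ hU.measurableSet, ENNReal.tsum_eq_zero] at h0
  have h1 := h0 p
  have hcont : Continuous (ρ p) := (ρ p).contMDiff.continuous
  rw [withDensity_apply_eq_zero hcont.measurable.ennreal_ofReal] at h1
  refine chartVolume_pos g p (U := {x | 0 < ρ p x} ∩ U)
    ((isOpen_lt continuous_const hcont).inter hU) ⟨x, ⟨hp, hx⟩, ?_⟩ (measure_mono_null ?_ h1)
  · exact chartPartition_subordinate p (subset_tsupport _ hp.ne')
  · rintro z ⟨hz, hzU⟩
    have hz' : 0 < ρ p z := hz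
    exact ⟨(ENNReal.ofReal_pos.2 hz').ne', hzU⟩

end Volume

/-! ### Smooth functions with the `L²` inner product -/

section L2

variable {E : Type*} [NormedAddCommGroup E] [NormedSpace ℝ E]
  {H : Type*} [TopologicalSpace H] {I : ModelWithCorners ℝ E H}
  {M : Type*} [TopologicalSpace M] [ChartedSpace H M] [IsManifold I ∞ M]

/-- The space `C^∞(M)`. -/
def SmoothFun (_g : RMetric I M) : Type _ := C^∞⟮I, M; 𝓘(ℝ, ℝ), ℝ⟯

instance (g : RMetric I M) : FunLike (SmoothFun g) M ℝ :=
  inferInstanceAs (FunLike C^∞⟮I, M; 𝓘(ℝ, ℝ), ℝ⟯ M ℝ)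

theorem SmoothFun.contMDiff {g : RMetric I M} (v : SmoothFun g) : ContMDiff I 𝓘(ℝ, ℝ) ∞ v :=
  ContMDiffMap.contMDiff (I := I) (I' := 𝓘(ℝ, ℝ)) v

@[ext] theorem SmoothFun.ext {g : RMetric I M} {u v : SmoothFun g} (h : ∀ x, u x = v x) : u = v :=
  DFunLike.ext _ _ h

section Core

/-- Addition of smooth functions is pointwise. -/
@[reducible] def smoothAddCommGroup (g : RMetric I M) : AddCommGroup (SmoothFun g) :=
  inferInstanceAs (AddCommGroup C^∞⟮I, M; 𝓘(ℝ, ℝ), ℝ⟯)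

attribute [local instance] smoothAddCommGroup

/-- Scalar multiplication of smooth functions is pointwise. -/
@[reducible] def smoothModule (g : RMetric I M) : Module ℝ (SmoothFun g) :=
  inferInstanceAs (Module ℝ C^∞⟮I, M; 𝓘(ℝ, ℝ), ℝ⟯)

attribute [local instance] smoothModule

variable [FiniteDimensional ℝ E] [MeasurableSpace E] [BorelSpace E] [I.Boundaryless]
  [T2Space M] [CompactSpace M] [MeasurableSpace M] [BorelSpace M]

theorem SmoothFun.integrable_mul {g : RMetric I M} (u v : SmoothFun g) :
    Integrable (fun x => u x * v x) (riemVolume g) :=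
  (u.contMDiff.continuous.mul v.contMDiff.continuous).integrable_of_hasCompactSupport
    (HasCompactSupport.of_compactSpace _)

/-- The `L²(M, |dV_g|)` inner product on `C^∞(M)`. -/
@[reducible] def l2Core (g : RMetric I M) : InnerProductSpace.Core ℝ (SmoothFun g) where
  inner u v := ∫ x, u x * v x ∂(riemVolume g)
  conj_inner_symm u v := by
    change ∫ x, v x * u x ∂(riemVolume g) = ∫ x, u x * v x ∂(riemVolume g)
    simp only [mul_comm]
  re_inner_nonneg u := by
    change 0 ≤ ∫ x, u x * u x ∂(riemVolume g)
    exact integral_nonneg fun x => mul_self_nonneg _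
  add_left u v w := by
    change ∫ x, (u + v) x * w x ∂(riemVolume g) =
      ∫ x, u x * w x ∂(riemVolume g) + ∫ x, v x * w x ∂(riemVolume g)
    rw [← integral_add (u.integrable_mul w) (v.integrable_mul w)]
    simp only [← add_mul]
    rfl
  smul_left u v c := by
    change ∫ x, (c • u) x * v x ∂(riemVolume g) = c * ∫ x, u x * v x ∂(riemVolume g)
    rw [← integral_const_mul]
    simp only [← mul_assoc]
    rfl
  definite u hu := by
    have hc : Continuous fun x => u x * u x := u.contMDiff.continuous.mul u.contMDiff.continuous
    have h0 : (fun x => u x * u x) = 0 :=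
      hc.ae_eq_iff_eq (riemVolume g) continuous_zero |>.1
        ((integral_eq_zero_iff_of_nonneg (fun x => mul_self_nonneg _) (u.integrable_mul u)).1 hu)
    ext x
    exact mul_self_eq_zero.1 (congrFun h0 x)

instance (g : RMetric I M) : NormedAddCommGroup (SmoothFun g) :=
  (l2Core g).toNormedAddCommGroup

instance (g : RMetric I M) : InnerProductSpace ℝ (SmoothFun g) :=
  InnerProductSpace.ofCore (l2Core g).toCore

end Core

variable [FiniteDimensional ℝ E] [MeasurableSpace E] [BorelSpace E] [I.Boundaryless]
  [T2Space M] [CompactSpace M] [MeasurableSpace M] [BorelSpace M]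

instance (g : RMetric I M) : MeasurableSpace (SmoothFun g) := borel _

instance (g : RMetric I M) : BorelSpace (SmoothFun g) := ⟨rfl⟩

@[simp] theorem SmoothFun.add_apply {g : RMetric I M} (u v : SmoothFun g) (x : M) :
    (u + v) x = u x + v x := rfl

@[simp] theorem SmoothFun.smul_apply {g : RMetric I M} (c : ℝ) (v : SmoothFun g) (x : M) :
    (c • v) x = c * v x := rfl

@[simp] theorem SmoothFun.zero_apply {g : RMetric I M} (x : M) : (0 : SmoothFun g) x = 0 := rfl

theorem SmoothFun.inner_def {g : RMetric I M} (u v : SmoothFun g) :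
    inner ℝ u v = ∫ x, u x * v x ∂(riemVolume g) := rfl

end L2

/-! ### Evaluation and differential -/

section Differential

variable {E : Type*} [NormedAddCommGroup E] [NormedSpace ℝ E] [FiniteDimensional ℝ E]
  [MeasurableSpace E] [BorelSpace E]
  {H : Type*} [TopologicalSpace H] {I : ModelWithCorners ℝ E H} [I.Boundaryless]
  {M : Type*} [TopologicalSpace M] [ChartedSpace H M] [IsManifold I ∞ M]
  [T2Space M] [CompactSpace M] [MeasurableSpace M] [BorelSpace M]
  {g : RMetric I M}

/-- The vector in a finite dimensional Euclidean space `V` which represents a linear functional,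
`(riesz φ, v) = φ v`. -/
def riesz {V : Type*} [NormedAddCommGroup V] [InnerProductSpace ℝ V] [FiniteDimensional ℝ V]
    (φ : V →ₗ[ℝ] ℝ) : V :=
  haveI : CompleteSpace V := FiniteDimensional.complete ℝ V
  (InnerProductSpace.toDual ℝ V).symm (LinearMap.toContinuousLinearMap φ)

theorem inner_riesz {V : Type*} [NormedAddCommGroup V] [InnerProductSpace ℝ V]
    [FiniteDimensional ℝ V] (φ : V →ₗ[ℝ] ℝ) (v : V) : inner ℝ (riesz φ) v = φ v := by
  have : CompleteSpace V := FiniteDimensional.complete ℝ V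
  simp [riesz]

theorem riesz_unique {V : Type*} [NormedAddCommGroup V] [InnerProductSpace ℝ V]
    [FiniteDimensional ℝ V] {φ : V →ₗ[ℝ] ℝ} {u : V} (h : ∀ v, inner ℝ u v = φ v) :
    riesz φ = u :=
  ext_inner_right ℝ fun v => (inner_riesz φ v).trans (h v).symm

variable (V : Submodule ℝ (SmoothFun g))

/-- The evaluation functional `ev_x : V → ℝ`, `v ↦ v(x)`. -/
def evalAt (x : M) : V →ₗ[ℝ] ℝ where
  toFun v := (v : SmoothFun g) x
  map_add' _ _ := rfl
  map_smul' _ _ := rfl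

/-- The adjunction map `A_x : V → T_x^* M`, `v ↦ d_x v`. -/
def adjunction (x : M) : V →ₗ[ℝ] (TangentSpace I x →L[ℝ] ℝ) where
  toFun v := mvfderiv I (v : SmoothFun g) x
  map_add' u v := mvfderiv_add
    (u.1.contMDiff.mdifferentiable (by simp) x) (v.1.contMDiff.mdifferentiable (by simp) x)
  map_smul' c v := by
    have h := mvfderiv_smul (I := I) (a := fun _ : M => c) (mdifferentiableAt_const (x := x))
      (v.1.contMDiff.mdifferentiable (by simp) x)
    rw [mvfderiv_const] at h
    refine h.trans ?_
    ext X
    simp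

/-- `K_x = ker A_x`, the functions in `V` that have `x` as a critical point. -/
def critSpace (x : M) : Submodule ℝ V := LinearMap.ker (adjunction V x)

variable [FiniteDimensional ℝ V]

/-- `ev_x` regarded as an element of `V`. -/
def evVec (x : M) : V := riesz (evalAt V x)

/-- The functional `v ↦ d_x v (X)` on `V`. -/
def diffAt (x : M) (X : TangentSpace I x) : V →ₗ[ℝ] ℝ where
  toFun v := adjunction V x v X
  map_add' u v := by rw [map_add]; rfl
  map_smul' c v := by rw [map_smul]; rfl

/-- The dual adjunction map `A_x^† : T_x M → V`, `(A_x^† X, v) = d_x v (X)`. -/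
def adjunctionDual (x : M) : TangentSpace I x →ₗ[ℝ] V where
  toFun X := riesz (diffAt V x X)
  map_add' X Y := riesz_unique fun v => by
    rw [inner_add_left, inner_riesz, inner_riesz]
    exact ((adjunction V x v).map_add X Y).symm
  map_smul' c X := riesz_unique fun v => by
    rw [inner_smul_left, inner_riesz]
    exact ((adjunction V x v).map_smul c X).symm

/-- The Jacobian `(det (T e_i, T e_j))^{1/2}` of a linear map `T : U → W` of Euclidean spaces,
where `e` is an orthonormal basis of `U` and `dim U ≤ dim W`. -/
def jacobian {U W : Type*} [NormedAddCommGroup U] [InnerProductSpace ℝ U] [FiniteDimensional ℝ U]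
    [NormedAddCommGroup W] [InnerProductSpace ℝ W] (T : U →ₗ[ℝ] W) : ℝ :=
  Real.sqrt (Matrix.of fun i j =>
    inner ℝ (T (stdOrthonormalBasis ℝ U i)) (T (stdOrthonormalBasis ℝ U j))).det

open Bundle in
/-- The Jacobian of `A_x^† : (T_x M, g) → V`. -/
def jacobianDual (x : M) : ℝ :=
  letI : RiemannianBundle (fun y : M => TangentSpace I y) := ⟨g.toRiemannianMetric⟩
  haveI : FiniteDimensional ℝ (TangentSpace I x) := inferInstanceAs (FiniteDimensional ℝ E)
  jacobian (adjunctionDual V x)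

end Differential

/-! ### Critical points, homogeneous triples, cores -/

section Critical

variable {E : Type*} [NormedAddCommGroup E] [NormedSpace ℝ E] [FiniteDimensional ℝ E]
  [MeasurableSpace E] [BorelSpace E]
  {H : Type*} [TopologicalSpace H] {I : ModelWithCorners ℝ E H} [I.Boundaryless]
  {M : Type*} [TopologicalSpace M] [ChartedSpace H M] [IsManifold I ∞ M]
  [T2Space M] [CompactSpace M] [MeasurableSpace M] [BorelSpace M]
  {g : RMetric I M}

/-- The Euclidean (Lebesgue) measure `|dV|` of a finite dimensional Euclidean space. -/
def euclVolume (W : Type*) [NormedAddCommGroup W] [InnerProductSpace ℝ W] [FiniteDimensional ℝ W]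
    [MeasurableSpace W] [BorelSpace W] : Measure W := volume

/-- The area measure `|dS|` of the unit sphere `S(W)` of a finite dimensional Euclidean space. -/
def sphereArea (W : Type*) [NormedAddCommGroup W] [InnerProductSpace ℝ W] [FiniteDimensional ℝ W]
    [MeasurableSpace W] [BorelSpace W] : Measure (Metric.sphere (0 : W) 1) :=
  (euclVolume W).toSphere

/-- The critical set of a smooth function. -/
def critSet (v : SmoothFun g) : Set M := {x | mvfderiv I v x = 0}

/-- `μ(M, g, V)`: the expected number of critical points of a random function on the unit
sphere `S(V)`, i.e. the average over `S(V)` of the number of critical points. -/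
def expectedCrit (g : RMetric I M) (V : Submodule ℝ (SmoothFun g)) [FiniteDimensional ℝ V] :
    ℝ≥0∞ :=
  (∫⁻ v : Metric.sphere (0 : V) 1, ((critSet (v : V).1).encard : ℝ≥0∞) ∂(sphereArea V)) /
    sphereArea V Set.univ

/-- The finite family `f` is a `g`-orthonormal basis of `T_p M`. -/
def IsOrthonormalFrame {ι : Type*} [DecidableEq ι] (g : RMetric I M) (p : M)
    (f : ι → TangentSpace I p) : Prop :=
  (∀ r s, g.inner p (f r) (f s) = if r = s then 1 else 0) ∧ Submodule.span ℝ (Set.range f) = ⊤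

/-- The Hessian matrix `(∇² v)(f_r, f_s)` at `p` of a smooth function `v` with respect to the
Levi-Civita connection of `g`, in the orthonormal frame `f` of `T_p M`. In the chart at `p`, with
`F_r` the constant vector field that represents `f_r`, it is
`∂_r ∂_s v - ∑_t Γ_{rs}^t ∂_t v`, where, as the `F_t` are orthonormal at `p`,
`Γ_{rs}^t = (∂_r g_{st} + ∂_s g_{rt} - ∂_t g_{rs}) / 2`. -/
def hessian {ι : Type*} [Fintype ι] (p : M) (f : ι → TangentSpace I p) (v : SmoothFun g) :
    Matrix ι ι ℝ :=
  let y₀ : E := extChartAt I p p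
  let F : ι → E := fun r => mfderiv I 𝓘(ℝ, E) (extChartAt I p) p (f r)
  let u : E → ℝ := fun y => v ((extChartAt I p).symm y)
  let dg : ι → ι → ι → ℝ := fun r s t => fderiv ℝ (fun y => coordMetric g p y (F s) (F t)) y₀ (F r)
  Matrix.of fun r s =>
    fderiv ℝ (fderiv ℝ u) y₀ (F r) (F s) -
      ∑ t, (dg r s t + dg s r t - dg t r s) / 2 * mvfderiv I v p (f t)

/-- The Lie group `G` acts smoothly, transitively and by isometries on `(M, g)`, and the pullback
action `(a, v) ↦ v(a · )` of `G` on `C^∞(M)` preserves `V` and its inner product. -/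
structure IsHomogeneousUnder {EG : Type*} [NormedAddCommGroup EG] [NormedSpace ℝ EG]
    {HG : Type*} [TopologicalSpace HG] (IG : ModelWithCorners ℝ EG HG)
    (G : Type*) [Group G] [TopologicalSpace G] [ChartedSpace HG G] [MulAction G M]
    (g : RMetric I M) (V : Submodule ℝ (SmoothFun g)) : Prop where
  smooth : ContMDiff (IG.prod I) I ∞ fun q : G × M => q.1 • q.2
  transitive : ∀ x y : M, ∃ a : G, a • x = y
  isometric : ∀ (a : G) (x : M) (X Y : TangentSpace I x),
    pullbackForm g (fun y : M => a • y) x X Y = g.inner x X Y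
  pullback_mem : ∀ (a : G), ∀ v ∈ V, ∃ u ∈ V, ∀ x, u x = v (a • x)
  pullback_inner : ∀ (a : G), ∀ v ∈ V, ∀ v' ∈ V, ∀ u ∈ V, ∀ u' ∈ V,
    (∀ x, u x = v (a • x)) → (∀ x, u' x = v' (a • x)) → inner ℝ u u' = inner ℝ v v'

/-- `(M, g, V)` is a homogeneous triple: `V` is ample, i.e. `A_x : V → T_x^* M` is onto for every
`x`, and `(M, g, V)` is homogeneous under some compact Lie group. -/
def IsHomogeneousTriple (g : RMetric I M) (V : Submodule ℝ (SmoothFun g)) : Prop :=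
  (∀ x : M, Function.Surjective (adjunction V x)) ∧
  ∃ (EG : Type) (_ : NormedAddCommGroup EG) (_ : NormedSpace ℝ EG) (_ : FiniteDimensional ℝ EG)
    (HG : Type) (_ : TopologicalSpace HG) (IG : ModelWithCorners ℝ EG HG) (_ : IG.Boundaryless)
    (G : Type) (_ : Group G) (_ : TopologicalSpace G) (_ : ChartedSpace HG G)
    (_ : LieGroup IG ∞ G) (_ : CompactSpace G) (_ : T2Space G) (_ : MulAction G M),
    IsHomogeneousUnder IG G g V

/-- `L̂ = L ⊕ span(w)`. -/
def hatSpace {V : Submodule ℝ (SmoothFun g)} (L : Submodule ℝ V) (w : V) : Submodule ℝ V :=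
  L ⊔ Submodule.span ℝ {w}

/-- `(p, f, L, w)` is a core of `(M, g, V)`. Orthogonal complements are taken in `V`. -/
structure IsCore {ι : Type*} [Fintype ι] [DecidableEq ι] (g : RMetric I M)
    (V : Submodule ℝ (SmoothFun g)) [FiniteDimensional ℝ V]
    (p : M) (f : ι → TangentSpace I p) (L : Submodule ℝ V) (w : V) : Prop where
  frame : IsOrthonormalFrame g p f
  orthogonal : ∀ r s, r ≠ s → inner ℝ (adjunctionDual V p (f r)) (adjunctionDual V p (f s)) = 0
  le_critSpace : L ≤ critSpace V p
  hessian_eq_zero : ∀ v ∈ Lᗮ, hessian p f v.1 = 0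
  mem_critSpace : w ∈ critSpace V p
  mem_orthogonal : w ∈ Lᗮ
  eval_ne_zero : w.1 p ≠ 0
  norm_eq_one : ‖w‖ = 1
  eval_eq_zero : ∀ v ∈ (hatSpace L w)ᗮ, v.1 p = 0

/-- `(M, g, V)` is a special triple: it is homogeneous and admits a core. -/
def IsSpecial (g : RMetric I M) (V : Submodule ℝ (SmoothFun g)) [FiniteDimensional ℝ V] : Prop :=
  IsHomogeneousTriple g V ∧
  ∃ (p : M) (f : Fin (Module.finrank ℝ E) → TangentSpace I p) (L : Submodule ℝ V) (w : V),
    IsCore g V p f L w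

end Critical

/-! ### Products -/

section Product

variable {E₁ : Type*} [NormedAddCommGroup E₁] [NormedSpace ℝ E₁] [FiniteDimensional ℝ E₁]
  [MeasurableSpace E₁] [BorelSpace E₁]
  {H₁ : Type*} [TopologicalSpace H₁] {I₁ : ModelWithCorners ℝ E₁ H₁} [I₁.Boundaryless]
  {M₁ : Type*} [TopologicalSpace M₁] [ChartedSpace H₁ M₁] [IsManifold I₁ ∞ M₁]
  [T2Space M₁] [SecondCountableTopology M₁] [CompactSpace M₁] [MeasurableSpace M₁] [BorelSpace M₁]
  {E₂ : Type*} [NormedAddCommGroup E₂] [NormedSpace ℝ E₂] [FiniteDimensional ℝ E₂]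
  [MeasurableSpace E₂] [BorelSpace E₂]
  {H₂ : Type*} [TopologicalSpace H₂] {I₂ : ModelWithCorners ℝ E₂ H₂} [I₂.Boundaryless]
  {M₂ : Type*} [TopologicalSpace M₂] [ChartedSpace H₂ M₂] [IsManifold I₂ ∞ M₂]
  [T2Space M₂] [SecondCountableTopology M₂] [CompactSpace M₂] [MeasurableSpace M₂] [BorelSpace M₂]
  {g₁ : RMetric I₁ M₁} {g₂ : RMetric I₂ M₂}

/-- The function `(u ⊗ v)(x₁, x₂) = u(x₁) v(x₂)` on `M₁ × M₂`. -/
def tmulFun (u : SmoothFun g₁) (v : SmoothFun g₂) : SmoothFun (prodMetric g₁ g₂) :=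
  (⟨fun x => u x.1 * v x.2, (u.contMDiff.comp contMDiff_fst).mul (v.contMDiff.comp contMDiff_snd)⟩ :
    C^∞⟮I₁.prod I₂, M₁ × M₂; 𝓘(ℝ, ℝ), ℝ⟯)

theorem tmulFun_apply (u : SmoothFun g₁) (v : SmoothFun g₂) (x : M₁ × M₂) :
    tmulFun u v x = u x.1 * v x.2 := rfl

variable (g₁ g₂) in
/-- The bilinear map `(u, v) ↦ u ⊗ v`. -/
def tmul : SmoothFun g₁ →ₗ[ℝ] SmoothFun g₂ →ₗ[ℝ] SmoothFun (prodMetric g₁ g₂) :=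
  LinearMap.mk₂ ℝ tmulFun
    (fun u u' v => SmoothFun.ext fun x => by simp [tmulFun_apply, add_mul])
    (fun c u v => SmoothFun.ext fun x => by simp [tmulFun_apply, mul_assoc])
    (fun u v v' => SmoothFun.ext fun x => by simp [tmulFun_apply, mul_add])
    (fun c u v => SmoothFun.ext fun x => by simp [tmulFun_apply, mul_left_comm])

/-- `V₁ ⊗ V₂`: the space of functions on `M₁ × M₂` spanned by the `v₁ ⊗ v₂`. -/
def tensorSpace (V₁ : Submodule ℝ (SmoothFun g₁)) (V₂ : Submodule ℝ (SmoothFun g₂)) :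
    Submodule ℝ (SmoothFun (prodMetric g₁ g₂)) :=
  Submodule.map₂ (tmul g₁ g₂) V₁ V₂

instance (V₁ : Submodule ℝ (SmoothFun g₁)) (V₂ : Submodule ℝ (SmoothFun g₂))
    [h₁ : FiniteDimensional ℝ V₁] [h₂ : FiniteDimensional ℝ V₂] :
    FiniteDimensional ℝ (tensorSpace V₁ V₂) :=
  Module.Finite.iff_fg.2
    (Submodule.FG.map₂ _ (Module.Finite.iff_fg.1 h₁) (Module.Finite.iff_fg.1 h₂))

/-- The bilinear map `V₁ × V₂ → V₁ ⊗ V₂`, `(u, v) ↦ u ⊗ v`. -/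
def tmulV (V₁ : Submodule ℝ (SmoothFun g₁)) (V₂ : Submodule ℝ (SmoothFun g₂)) :
    V₁ →ₗ[ℝ] V₂ →ₗ[ℝ] tensorSpace V₁ V₂ :=
  LinearMap.mk₂ ℝ
    (fun u v => ⟨tmul g₁ g₂ u.1 v.1, Submodule.apply_mem_map₂ _ u.2 v.2⟩)
    (fun u u' v => Subtype.ext (by simp))
    (fun c u v => Subtype.ext (by simp))
    (fun u v v' => Subtype.ext (by simp))
    (fun c u v => Subtype.ext (by simp))

variable {V₁ : Submodule ℝ (SmoothFun g₁)} {V₂ : Submodule ℝ (SmoothFun g₂)}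

/-- `W₁ ⊗ W₂ ⊂ V₁ ⊗ V₂` for subspaces `W₁ ⊂ V₁`, `W₂ ⊂ V₂`. -/
def tensorSub (W₁ : Submodule ℝ V₁) (W₂ : Submodule ℝ V₂) : Submodule ℝ (tensorSpace V₁ V₂) :=
  Submodule.map₂ (tmulV V₁ V₂) W₁ W₂

/-- `L₁ * L₂`: the orthogonal complement of `w = w₁ ⊗ w₂` in `L̂₁ ⊗ L̂₂`. -/
def starSpace (L₁ : Submodule ℝ V₁) (w₁ : V₁) (L₂ : Submodule ℝ V₂) (w₂ : V₂) :
    Submodule ℝ (tensorSpace V₁ V₂) :=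
  tensorSub (hatSpace L₁ w₁) (hatSpace L₂ w₂) ⊓ (Submodule.span ℝ {tmulV V₁ V₂ w₁ w₂})ᗮ

/-- The union of frames of `T_{p₁} M₁` and `T_{p₂} M₂`, as a frame of `T_{(p₁, p₂)} (M₁ × M₂)`. -/
def prodFrame {ι₁ ι₂ : Type*} {p₁ : M₁} {p₂ : M₂} (f₁ : ι₁ → TangentSpace I₁ p₁)
    (f₂ : ι₂ → TangentSpace I₂ p₂) : ι₁ ⊕ ι₂ → TangentSpace (I₁.prod I₂) (p₁, p₂) :=
  Sum.elim (fun r => ((f₁ r, 0) : E₁ × E₂)) (fun s => ((0, f₂ s) : E₁ × E₂))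

end Product

end CritSet

end

open CritSet

noncomputable section

set_option linter.unusedSectionVars false
set_option maxSynthPendingDepth 3

namespace CritSet

/-! ### The area formula with multiplicity -/

section Area

/-! Part (a) is a Kac–Rice argument. Rescaling a function does not change its critical points, so by
polar coordinates the average over `S(V)` equals `π^(-dim V / 2)` times the integral over `V` of
`exp (-|v|²)` against the number of critical points (`expectedCrit_eq_critMass_div`).

To compute that Gaussian integral near `p`, split `V = K_p ⊕ K_pᗮ`. Ampleness identifies `K_pᗮ` with
the tangent space: by (P₁) the normalized vectors `A_p^† f_r` form an orthonormal basis of it, which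
is sent to the frame. Points near `p` thus become vectors `t` of `K_pᗮ`, with Lebesgue measure there
agreeing with the Riemannian volume to zeroth order at `p`. Solving `d(k + c) = 0` at the point `t`
for `c` gives `c = σ t k` with a `C¹` family `σ` of linear maps and `σ 0 = 0` (`critFamily_eq_iff`).
Hence the critical points of `k + c` are the fibre of `(t, k) ↦ (σ t k, k)` over `(c, k)`, and the
area formula with multiplicity (`lintegral_mul_encard_fiber`) turns their expected number into the
integral of a continuous density (`lintegral_encard_family`). At `t = 0` the Jacobian of this map
is, up to sign, `det H(k) / ∏ |A_p^† f_r|` (`fderiv_critFamily_zero`), so the density at `p` is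
`critDensity`.

By continuity the expected number of critical points in a small set near `p` is `critDensity` times
its volume, up to `ε` times its volume (`exists_critMass_estimate`). Symmetries preserve both the
volume and the Gaussian count, so the same estimate, with the same constant, holds near every point.
Summing over a countable partition of `M` and letting `ε → 0` gives the exact formula
`critMass_univ`. By (P₂) the Hessian on `K_p` depends only on the component in `L`; the remaining
directions contribute a pure Gaussian integral, which accounts for the power of `π`. The spherical
formula follows from polar coordinates in `L`, because `|det H|` is homogeneous of degree `m`.

Part (b) rests on two facts. First, the Riemannian volume of a product is the product volume, so `(u
⊗ v, u' ⊗ v') = (u, u')(v, v')` (`inner_tmulV`). Second, (P₄) puts `ev_p` in `L̂ ⊂ K_p`: it is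
orthogonal to every `A_p^† X`, and every function in `K_pᗮ` vanishes at `p`. Since `A^†` at a pair
`(p₁, p₂)` sends `(X₁, X₂)` to `A^† X₁ ⊗ ev + ev ⊗ A^† X₂`, the images of the product frame are
orthogonal and the Jacobian is the product of their lengths. The Hessian of `u ⊗ v` has diagonal
blocks `v(p₂) H(u)` and `u(p₁) H(v)` and off-diagonal entries `d u (f_r) d v (f_s)`. Each entry is
an inner product with an element of the proposed `L`, which gives (P₂) for the product
(`IsCore.prod`). -/

theorem coe_encard_iUnion {X : Type*} {B : ℕ → Set X} (hB : Pairwise (Function.onFun Disjoint B)) :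
    (((⋃ n, B n).encard : ℕ∞) : ℝ≥0∞) = ∑' n, ((B n).encard : ℝ≥0∞) := by
  -- With every set measurable, cardinality is counting measure and the claim is its countable
  -- additivity.
  let _ : MeasurableSpace X := ⊤
  have hc : ∀ s : Set X, (s.encard : ℝ≥0∞) = Measure.count s := fun s =>
    (Measure.count_apply (s := s) trivial).symm
  simp only [hc]
  exact measure_iUnion hB fun n => trivial

theorem coe_encard_inter_fiber {X Y : Type*} {f : X → Y} {B : Set X} (hf : Set.InjOn f B) (y : Y) :
    ((B ∩ f ⁻¹' {y}).encard : ℝ≥0∞) = (f '' B).indicator 1 y := by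
  by_cases hy : y ∈ f '' B
  · obtain ⟨x, hx, rfl⟩ := hy
    have : B ∩ f ⁻¹' {f x} = {x} := by
      ext z
      constructor
      · rintro ⟨hz, hz'⟩
        exact hf hz hx hz'
      · rintro rfl
        exact ⟨hx, rfl⟩
    rw [this, Set.indicator_of_mem (Set.mem_image_of_mem f hx)]
    simp
  · have : B ∩ f ⁻¹' {y} = ∅ := by
      ext z
      simp only [Set.mem_inter_iff, Set.mem_preimage, Set.mem_singleton_iff,
        Set.mem_empty_iff_false, iff_false, not_and]
      rintro hz rfl
      exact hy ⟨z, hz, rfl⟩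
    rw [this, Set.indicator_of_notMem hy]
    simp

variable {X : Type*} [NormedAddCommGroup X] [NormedSpace ℝ X] [FiniteDimensional ℝ X]
  [MeasurableSpace X] [BorelSpace X] (μ : Measure X) [μ.IsAddHaarMeasure]
  {f : X → X} {f' : X → X →L[ℝ] X} {U s : Set X}

/-- The inverse function theorem: an invertible strict derivative makes `f` a local homeomorphism.
-/
theorem exists_isOpen_injOn {x : X} (hf : HasStrictFDerivAt f (f' x) x) (hx : (f' x).det ≠ 0) :
    ∃ W : Set X, IsOpen W ∧ x ∈ W ∧ Set.InjOn f W := by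
  have h : HasStrictFDerivAt f
      (((f' x).toContinuousLinearEquivOfDetNeZero hx : X ≃L[ℝ] X) : X →L[ℝ] X) x := hf
  refine ⟨(h.toOpenPartialHomeomorph f).source, (h.toOpenPartialHomeomorph f).open_source,
    h.mem_toOpenPartialHomeomorph_source, ?_⟩
  exact (h.toOpenPartialHomeomorph f).injOn

/-- A measurable set on which a `C¹` map has nonzero Jacobian is a countable disjoint union of
measurable pieces on which the map is injective. -/
theorem exists_partition_injOn (hf : ∀ x ∈ s, HasStrictFDerivAt f (f' x) x)
    (hs : MeasurableSet s) (hdet : ∀ x ∈ s, (f' x).det ≠ 0) :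
    ∃ B : ℕ → Set X, (∀ n, MeasurableSet (B n)) ∧ Pairwise (Function.onFun Disjoint B) ∧
      (⋃ n, B n) = s ∧ ∀ n, Set.InjOn f (B n) := by
  choose! W hWo hxW hWi using fun x hx => exists_isOpen_injOn (hf x hx) (hdet x hx)
  obtain ⟨t, hts, htc, hcov⟩ := TopologicalSpace.countable_cover_nhdsWithin
    (f := W) (s := s) fun x hx => mem_nhdsWithin_of_mem_nhds ((hWo x hx).mem_nhds (hxW x hx))
  rcases t.eq_empty_or_nonempty with rfl | hne
  · have : s = ∅ := by simpa using hcov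
    subst this
    exact ⟨fun _ => ∅, by simp, fun _ _ _ => by simp [Function.onFun], by simp, by simp⟩
  obtain ⟨e, rfl⟩ := htc.exists_eq_range hne
  have hes : ∀ n, e n ∈ s := fun n => hts ⟨n, rfl⟩
  refine ⟨fun n => s ∩ disjointed (fun n => W (e n)) n, fun n => hs.inter ?_, ?_, ?_, fun n => ?_⟩
  · exact MeasurableSet.disjointed (fun n => (hWo _ (hes n)).measurableSet) n
  · intro i j hij
    exact ((disjoint_disjointed _ hij).mono Set.inter_subset_right Set.inter_subset_right)
  · rw [← Set.inter_iUnion, iUnion_disjointed, Set.inter_eq_left]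
    simpa using hcov
  · exact (hWi _ (hes n)).mono (Set.inter_subset_right.trans (disjointed_subset _ _))

/-- The image of the points with zero Jacobian is null (the easy case of Sard's theorem), so almost
every fibre avoids them. The rest of `s` is cut into injective pieces, and each piece meets a fibre
once or not at all, according to its image. Both the measurability of the fibre count and the area
formula are read off this decomposition. -/
theorem area_formula_aux (hf : ∀ x ∈ s, HasStrictFDerivAt f (f' x) x)
    (hf' : ContinuousOn f' s) (hs : MeasurableSet s) :
    ∃ B : ℕ → Set X, (∀ n, MeasurableSet (B n)) ∧ Pairwise (Function.onFun Disjoint B) ∧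
      (∀ n, B n ⊆ s) ∧ (∀ n, Set.InjOn f (B n)) ∧ (∀ x ∈ s \ ⋃ n, B n, (f' x).det = 0) ∧
      ∀ᵐ y ∂μ, ((s ∩ f ⁻¹' {y}).encard : ℝ≥0∞) = ∑' n, (f '' B n).indicator 1 y := by
  set Z : Set X := s ∩ {x | (f' x).det = 0} with hZ
  have hdc : ContinuousOn (fun x => (f' x).det) s :=
    (ContinuousLinearMap.continuous_det).comp_continuousOn hf'
  have hZm : MeasurableSet Z := by
    obtain ⟨u, hu, hu'⟩ := (continuousOn_iff_isClosed.1 hdc) {0} isClosed_singleton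
    have : Z = u ∩ s := by
      rw [← hu', Set.inter_comm]; rfl
    rw [this]
    exact hu.measurableSet.inter hs
  obtain ⟨B, hBm, hBd, hBU, hBi⟩ := exists_partition_injOn (f := f) (f' := f') (s := s \ Z)
    (fun x hx => hf x hx.1) (hs.diff hZm) (fun x hx h0 => hx.2 ⟨hx.1, h0⟩)
  have hBs : ∀ n, B n ⊆ s := fun n x hx =>
    ((hBU ▸ Set.subset_iUnion B n : B n ⊆ s \ Z) hx).1
  refine ⟨B, hBm, hBd, hBs, hBi, ?_, ?_⟩
  · rw [hBU]
    rintro x ⟨hxs, hx⟩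
    by_contra h
    exact hx ⟨hxs, fun hxZ => h hxZ.2⟩
  have hnull : μ (f '' Z) = 0 :=
    addHaar_image_eq_zero_of_det_fderivWithin_eq_zero μ
      (fun x hx => (hf x hx.1).hasFDerivAt.hasFDerivWithinAt) (fun x hx => hx.2)
  filter_upwards [measure_eq_zero_iff_ae_notMem.1 hnull] with y hy
  have : s ∩ f ⁻¹' {y} = ⋃ n, (B n ∩ f ⁻¹' {y}) := by
    rw [← Set.iUnion_inter, hBU]
    ext x
    constructor
    · rintro ⟨hx, hxy⟩
      exact ⟨⟨hx, fun hxZ => hy ⟨x, hxZ, hxy⟩⟩, hxy⟩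
    · rintro ⟨hx, hxy⟩
      exact ⟨hx.1, hxy⟩
  rw [this, coe_encard_iUnion]
  · simp only [coe_encard_inter_fiber (hBi _)]
  · exact fun i j hij => (hBd hij).mono Set.inter_subset_left Set.inter_subset_left

theorem measurableSet_image_of_strict {B : Set X} (hf : ∀ x ∈ s, HasStrictFDerivAt f (f' x) x)
    (hB : MeasurableSet B) (hBs : B ⊆ s) (hi : Set.InjOn f B) : MeasurableSet (f '' B) :=
  measurable_image_of_fderivWithin hB
    (fun x hx => (hf x (hBs hx)).hasFDerivAt.hasFDerivWithinAt) hi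

theorem aemeasurable_encard_fiber (hf : ∀ x ∈ s, HasStrictFDerivAt f (f' x) x)
    (hf' : ContinuousOn f' s) (hs : MeasurableSet s) :
    AEMeasurable (fun y => ((s ∩ f ⁻¹' {y}).encard : ℝ≥0∞)) μ := by
  obtain ⟨B, hBm, -, hBs, hBi, -, h⟩ := area_formula_aux μ hf hf' hs
  refine ⟨fun y => ∑' n, (f '' B n).indicator 1 y, ?_, h⟩
  exact Measurable.tsum fun n =>
    measurable_one.indicator (measurableSet_image_of_strict hf (hBm n) (hBs n) (hBi n))

/-- **Area formula**: the integral of the number of preimages in `s`. -/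
theorem lintegral_mul_encard_fiber (hf : ∀ x ∈ s, HasStrictFDerivAt f (f' x) x)
    (hf' : ContinuousOn f' s) (hs : MeasurableSet s) {G : X → ℝ≥0∞} (hG : Measurable G) :
    ∫⁻ y, G y * ((s ∩ f ⁻¹' {y}).encard : ℝ≥0∞) ∂μ =
      ∫⁻ x in s, ENNReal.ofReal |(f' x).det| * G (f x) ∂μ := by
  obtain ⟨B, hBm, hBd, hBs, hBi, hdet, h⟩ := area_formula_aux μ hf hf' hs
  have hBI : ∀ n, MeasurableSet (f '' B n) := fun n =>
    measurableSet_image_of_strict hf (hBm n) (hBs n) (hBi n)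
  calc ∫⁻ y, G y * ((s ∩ f ⁻¹' {y}).encard : ℝ≥0∞) ∂μ
      = ∫⁻ y, ∑' n, (f '' B n).indicator G y ∂μ := by
        refine lintegral_congr_ae ?_
        filter_upwards [h] with y hy
        rw [hy, ← ENNReal.tsum_mul_left]
        refine tsum_congr fun n => ?_
        by_cases hy : y ∈ f '' B n
        · simp [Set.indicator_of_mem hy]
        · simp [Set.indicator_of_notMem hy]
    _ = ∑' n, ∫⁻ y in f '' B n, G y ∂μ := by
        rw [lintegral_tsum fun n => (hG.indicator (hBI n)).aemeasurable]
        exact tsum_congr fun n => lintegral_indicator (hBI n) _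
    _ = ∑' n, ∫⁻ x in B n, ENNReal.ofReal |(f' x).det| * G (f x) ∂μ := by
        refine tsum_congr fun n => ?_
        exact lintegral_image_eq_lintegral_abs_det_fderiv_mul μ (hBm n)
          (fun x hx => (hf x (hBs n hx)).hasFDerivAt.hasFDerivWithinAt) (hBi n) G
    _ = ∫⁻ x in ⋃ n, B n, ENNReal.ofReal |(f' x).det| * G (f x) ∂μ :=
        (lintegral_iUnion hBm hBd _).symm
    _ = ∫⁻ x in s, ENNReal.ofReal |(f' x).det| * G (f x) ∂μ := by
        have hsub : (⋃ n, B n) ⊆ s := Set.iUnion_subset hBs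
        have hm : MeasurableSet (⋃ n, B n) := MeasurableSet.iUnion hBm
        -- Outside the injective pieces the Jacobian vanishes, so enlarging the domain to `s` adds
        -- nothing.
        rw [← lintegral_inter_add_sdiff (μ := μ) _ s hm, Set.inter_eq_right.2 hsub]
        rw [setLIntegral_congr_fun (s := s \ ⋃ n, B n) (g := 0) (hs.diff hm)]
        · simp
        · intro x hx
          simp [hdet x hx]

end Area

/-! ### Gaussian integrals in Euclidean spaces -/

section Gaussian

variable {W : Type*} [NormedAddCommGroup W] [InnerProductSpace ℝ W] [FiniteDimensional ℝ W]
  [MeasurableSpace W] [BorelSpace W]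

/-- The sum map `K × Kᗮ ≃ W`, as an equivalence of measurable spaces. -/
def orthogonalSum (K : Submodule ℝ W) : K × Kᗮ ≃ᵐ W :=
  (MeasurableEquiv.toLp 2 (K × Kᗮ)).trans K.orthogonalDecomposition.symm.toMeasurableEquiv

theorem measurePreserving_orthogonalSum (K : Submodule ℝ W) :
    MeasurePreserving (orthogonalSum K) :=
  (WithLp.volume_preserving_toLp K Kᗮ).trans K.orthogonalDecomposition.symm.measurePreserving

theorem norm_sq_orthogonal_add (K : Submodule ℝ W) (z : K × Kᗮ) :
    ‖(z.1 : W) + z.2‖ ^ 2 = ‖z.1‖ ^ 2 + ‖z.2‖ ^ 2 := by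
  have h := norm_add_sq_eq_norm_sq_add_norm_sq_of_inner_eq_zero (z.1 : W) (z.2 : W)
    (K.inner_right_of_mem_orthogonal z.1.2 z.2.2)
  simpa only [pow_two, Submodule.coe_norm] using h

theorem lintegral_orthogonalSum (K : Submodule ℝ W) (F : W → ℝ≥0∞) :
    ∫⁻ v, F v = ∫⁻ z : K × Kᗮ, F ((z.1 : W) + z.2) := by
  rw [← (measurePreserving_orthogonalSum K).lintegral_comp_emb
    (orthogonalSum K).measurableEmbedding]
  rfl

theorem integral_orthogonalSum (K : Submodule ℝ W) (F : W → ℝ) :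
    ∫ v, F v = ∫ z : K × Kᗮ, F ((z.1 : W) + z.2) := by
  rw [← (measurePreserving_orthogonalSum K).integral_comp
    (orthogonalSum K).measurableEmbedding]
  rfl

/-- A non-integrable function would have integral `0` by convention, whereas the Gaussian integral
has a known positive value. -/
theorem integrable_gaussian {b : ℝ} (hb : 0 < b) :
    Integrable (fun v : W => Real.exp (-b * ‖v‖ ^ 2)) := by
  by_contra h
  have h1 := GaussianFourier.integral_rexp_neg_mul_sq_norm (V := W) hb
  rw [integral_undef h] at h1
  have : 0 < (Real.pi / b) ^ (Module.finrank ℝ W / 2 : ℝ) := by positivity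
  exact this.ne h1

/-- From `1 + r ≤ exp r` and `n r ≤ n² / 2 + r² / 2`: half of the Gaussian decay absorbs any
polynomial. -/
theorem pow_mul_gaussian_le (n : ℕ) {r : ℝ} (hr : 0 ≤ r) :
    (1 + r) ^ n * Real.exp (-r ^ 2) ≤ Real.exp (n ^ 2 / 2) * Real.exp (-(1 / 2) * r ^ 2) := by
  have h1 : (1 + r) ^ n ≤ Real.exp (n * r) := by
    rw [Real.exp_nat_mul]
    exact pow_le_pow_left₀ (by positivity) (by linarith [Real.add_one_le_exp r]) n
  calc (1 + r) ^ n * Real.exp (-r ^ 2) ≤ Real.exp (n * r) * Real.exp (-r ^ 2) := by gcongr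
    _ ≤ _ := by
      rw [← Real.exp_add, ← Real.exp_add, Real.exp_le_exp]
      nlinarith [sq_nonneg ((n : ℝ) - r)]

theorem integrable_pow_mul_gaussian (n : ℕ) :
    Integrable (fun v : W => (1 + ‖v‖) ^ n * Real.exp (-‖v‖ ^ 2)) := by
  refine ((integrable_gaussian (W := W) (b := 1 / 2) (by norm_num)).const_mul
    (Real.exp ((n : ℝ) ^ 2 / 2))).mono' (by fun_prop) (Filter.Eventually.of_forall fun v => ?_)
  rw [Real.norm_of_nonneg (by positivity)]
  exact pow_mul_gaussian_le n (norm_nonneg v)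

theorem lintegral_gaussian_radial (q : ℕ) :
    ∫⁻ r : Set.Ioi (0 : ℝ), ENNReal.ofReal (Real.exp (-r.1 ^ 2)) * ENNReal.ofReal (r.1 ^ q)
      ∂(Measure.comap Subtype.val volume) =
      ENNReal.ofReal (Real.Gamma (((q : ℝ) + 1) / 2) / 2) := by
  rw [lintegral_subtype_comap measurableSet_Ioi
    (fun r : ℝ => ENNReal.ofReal (Real.exp (-r ^ 2)) * ENNReal.ofReal (r ^ q))]
  have h := integral_rpow_mul_exp_neg_rpow (p := 2) (q := q) (by norm_num)
    (by linarith [q.cast_nonneg (α := ℝ)])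
  have hpos : 0 < Real.Gamma (((q : ℝ) + 1) / 2) := Real.Gamma_pos_of_pos (by positivity)
  have h2 : ∫ r in Set.Ioi (0 : ℝ), r ^ q * Real.exp (-r ^ 2) =
      Real.Gamma (((q : ℝ) + 1) / 2) / 2 := by
    rw [div_eq_mul_one_div _ (2 : ℝ), mul_comm, ← h]
    refine setIntegral_congr_fun measurableSet_Ioi fun r _ => ?_
    simp
  have hi : IntegrableOn (fun r : ℝ => r ^ q * Real.exp (-r ^ 2)) (Set.Ioi 0) := by
    by_contra hc
    rw [integral_undef hc] at h2
    linarith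
  rw [← h2, ofReal_integral_eq_lintegral_ofReal hi]
  · refine setLIntegral_congr_fun measurableSet_Ioi fun r hr => ?_
    have : (0 : ℝ) < r := hr
    rw [mul_comm, ENNReal.ofReal_mul (by positivity)]
  · filter_upwards [ae_restrict_mem measurableSet_Ioi] with r hr
    have : (0 : ℝ) < r := hr
    simp only [Pi.zero_apply]
    positivity

/-- In polar coordinates `v = r u` homogeneity gives `F v = r ^ n F u`, so the integral factors and
the radial factor is a Gamma value. Only almost everywhere measurability on `W` is available for a
count of critical points, and it does not restrict to the null set `S(W)` automatically. Dividing `F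
(r u)` by `r ^ n` shows that `(u, r) ↦ F u` is almost everywhere measurable on the product, and this
descends to the sphere because the radial measure is nonzero. -/
theorem ae_sphere_of_homogeneous [Nontrivial W] {F : W → ℝ≥0∞} (n : ℕ)
    (hF : AEMeasurable F volume)
    (hom : ∀ (r : ℝ) (v : W), 0 < r → F (r • v) = ENNReal.ofReal (r ^ n) * F v) :
    AEMeasurable (fun u : Metric.sphere (0 : W) 1 => F u) (volume : Measure W).toSphere ∧
    ∫⁻ v, ENNReal.ofReal (Real.exp (-‖v‖ ^ 2)) * F v =
      ENNReal.ofReal (Real.Gamma (((Module.finrank ℝ W : ℝ) + n) / 2) / 2) *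
        ∫⁻ u : Metric.sphere (0 : W) 1, F u ∂(volume : Measure W).toSphere := by
  set S := Metric.sphere (0 : W) 1
  set N := Module.finrank ℝ W with hN
  have hNpos : 0 < N := Module.finrank_pos
  set ν := Measure.volumeIoiPow (N - 1)
  have hmp := (volume : Measure W).measurePreserving_homeomorphUnitSphereProd
  have hmps := hmp.symm (homeomorphUnitSphereProd W).toMeasurableEquiv
  have hrec : ∀ z : S × Set.Ioi (0 : ℝ),
      (((homeomorphUnitSphereProd W).symm z : ({0}ᶜ : Set W)) : W) = z.2.1 • (z.1 : W) := by
    intro z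
    simp
  have hFc : AEMeasurable (fun x : ({0}ᶜ : Set W) => F x) (Measure.comap Subtype.val volume) :=
    hF.comp_quasiMeasurePreserving
      (⟨measurable_subtype_coe, by
        rw [map_comap_subtype_coe (measurableSet_singleton _).compl]
        exact Measure.absolutelyContinuous_of_le Measure.restrict_le_self⟩ :
        Measure.QuasiMeasurePreserving (Subtype.val : ({0}ᶜ : Set W) → W)
          (Measure.comap Subtype.val volume) volume)
  have hFp : AEMeasurable (fun z : S × Set.Ioi (0 : ℝ) => F (z.2.1 • (z.1 : W)))
      ((volume : Measure W).toSphere.prod ν) := by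
    have := hFc.comp_quasiMeasurePreserving hmps.quasiMeasurePreserving
    refine this.congr (Filter.Eventually.of_forall fun z => ?_)
    exact congrArg F (hrec z)
  have hF1 : AEMeasurable (fun z : S × Set.Ioi (0 : ℝ) => F z.1)
      ((volume : Measure W).toSphere.prod ν) := by
    have hm : Measurable fun z : S × Set.Ioi (0 : ℝ) => (ENNReal.ofReal (z.2.1 ^ n))⁻¹ := by
      fun_prop
    refine (hm.aemeasurable.mul hFp).congr (Filter.Eventually.of_forall fun z => ?_)
    have hz : (0 : ℝ) < z.2.1 := z.2.2
    simp only [Pi.mul_apply]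
    rw [hom _ _ hz, ← mul_assoc, ENNReal.inv_mul_cancel, one_mul]
    · exact (ENNReal.ofReal_pos.2 (by positivity)).ne'
    · exact ENNReal.ofReal_ne_top
  have hFS : AEMeasurable (fun u : S => F u) (volume : Measure W).toSphere := by
    -- The interval `(0, 1)` has radial mass `1 / N`, which is not zero.
    have hν : NeZero ν := by
      refine ⟨fun h0 => ?_⟩
      have h1 := Measure.volumeIoiPow_apply_Iio (N - 1) ⟨1, Set.mem_Ioi.2 one_pos⟩
      change ν _ = _ at h1
      rw [h0] at h1
      simp only [Measure.coe_zero, Pi.zero_apply, one_pow] at h1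
      have : (0 : ℝ) < 1 / (((N - 1 : ℕ) : ℝ) + 1) := by positivity
      exact (ENNReal.ofReal_pos.2 this).ne h1
    exact (AEStronglyMeasurable.of_comp_fst (f := fun u : S => F u) hF1.aestronglyMeasurable
      hν.out).aemeasurable
  refine ⟨hFS, ?_⟩
  have h1 : ∫⁻ v, ENNReal.ofReal (Real.exp (-‖v‖ ^ 2)) * F v =
      ∫⁻ x : ({0}ᶜ : Set W), ENNReal.ofReal (Real.exp (-‖(x : W)‖ ^ 2)) * F x
        ∂(Measure.comap Subtype.val volume) := by
    rw [lintegral_subtype_comap (measurableSet_singleton _).compl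
      (fun v : W => ENNReal.ofReal (Real.exp (-‖v‖ ^ 2)) * F v), restrict_compl_singleton]
  rw [h1, ← hmps.lintegral_comp_emb
    (homeomorphUnitSphereProd W).toMeasurableEquiv.symm.measurableEmbedding]
  have h2 : ∀ z : S × Set.Ioi (0 : ℝ),
      ENNReal.ofReal (Real.exp (-‖(((homeomorphUnitSphereProd W).toMeasurableEquiv.symm z :
        ({0}ᶜ : Set W)) : W)‖ ^ 2)) *
        F ((homeomorphUnitSphereProd W).toMeasurableEquiv.symm z : ({0}ᶜ : Set W)) =
      F z.1 * (ENNReal.ofReal (Real.exp (-z.2.1 ^ 2)) * ENNReal.ofReal (z.2.1 ^ n)) := by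
    intro z
    have hz : (0 : ℝ) < z.2.1 := z.2.2
    have hn : ‖(z.1 : W)‖ = 1 := by simp
    have hr : ((((homeomorphUnitSphereProd W).toMeasurableEquiv.symm z :
        ({0}ᶜ : Set W)) : W)) = z.2.1 • (z.1 : W) := hrec z
    rw [hr, hom _ _ hz, norm_smul, hn, Real.norm_of_nonneg hz.le, mul_one]
    ring
  simp only [h2]
  rw [lintegral_prod_mul (f := fun u : S => F u) (g := fun r : Set.Ioi (0 : ℝ) =>
    ENNReal.ofReal (Real.exp (-r.1 ^ 2)) * ENNReal.ofReal (r.1 ^ n)) hFS (by fun_prop), mul_comm]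
  congr 1
  have hw : Measurable fun r : Set.Ioi (0 : ℝ) => ENNReal.ofReal (r.1 ^ (N - 1)) := by fun_prop
  have hw2 : Measurable fun r : Set.Ioi (0 : ℝ) =>
    ENNReal.ofReal (Real.exp (-r.1 ^ 2)) * ENNReal.ofReal (r.1 ^ n) := by fun_prop
  have hν' : ν = (Measure.comap Subtype.val volume).withDensity
    fun r : Set.Ioi (0 : ℝ) => ENNReal.ofReal (r.1 ^ (N - 1)) := rfl
  change ∫⁻ _, _ ∂ν = _
  rw [hν', lintegral_withDensity_eq_lintegral_mul _ hw hw2]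
  -- The exponent collects `N - 1` from the polar volume element and `n` from the homogeneity of
  -- `F`; natural subtraction is harmless since `N > 0`.
  have h3 := lintegral_gaussian_radial (N - 1 + n)
  have h4 : (((N - 1 + n : ℕ) : ℝ) + 1) = (N : ℝ) + n := by
    push_cast [Nat.cast_sub (Nat.one_le_iff_ne_zero.2 hNpos.ne')]
    ring
  rw [h4] at h3
  rw [← h3]
  refine lintegral_congr fun r => ?_
  have hr : (0 : ℝ) < r.1 := r.2
  simp only [Pi.mul_apply]
  rw [pow_add, ENNReal.ofReal_mul (by positivity)]
  ring

end Gaussian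

/-! ### Counting zeros of a linear family -/

section Family

variable {C K : Type*} [NormedAddCommGroup C] [InnerProductSpace ℝ C] [FiniteDimensional ℝ C]
  [MeasurableSpace C] [BorelSpace C]
  [NormedAddCommGroup K] [InnerProductSpace ℝ K] [FiniteDimensional ℝ K]
  [MeasurableSpace K] [BorelSpace K]

theorem det_triangular (A : C →L[ℝ] C) (B : K →L[ℝ] C) :
    (((A.comp (ContinuousLinearMap.fst ℝ C K) + B.comp (ContinuousLinearMap.snd ℝ C K)).prod
      (ContinuousLinearMap.snd ℝ C K) : C × K →L[ℝ] C × K)).det = A.det := by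
  let b := Module.finBasis ℝ C
  let b' := Module.finBasis ℝ K
  rw [ContinuousLinearMap.det, ContinuousLinearMap.det, ← LinearMap.det_toMatrix (b.prod b'),
    ← LinearMap.det_toMatrix b]
  have : LinearMap.toMatrix (b.prod b') (b.prod b')
      (((A.comp (ContinuousLinearMap.fst ℝ C K) + B.comp (ContinuousLinearMap.snd ℝ C K)).prod
      (ContinuousLinearMap.snd ℝ C K) : C × K →L[ℝ] C × K) : C × K →ₗ[ℝ] C × K) =
      Matrix.fromBlocks (LinearMap.toMatrix b b (A : C →ₗ[ℝ] C))
        (LinearMap.toMatrix b' b (B : K →ₗ[ℝ] C)) 0 1 := by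
    ext i j
    rcases i with i | i <;> rcases j with j | j <;>
      simp [LinearMap.toMatrix_apply, Matrix.one_apply, Finsupp.single_apply, eq_comm]
  rw [this, Matrix.det_fromBlocks_zero₂₁, Matrix.det_one, mul_one]

/-- The Gaussian density of the number of zeros of the family `t ↦ σ t k`. -/
def familyDensity (σ : C → K →L[ℝ] C) (t : C) : ℝ :=
  ∫ k : K, Real.exp (-(‖σ t k‖ ^ 2 + ‖k‖ ^ 2)) * |((fderiv ℝ σ t).flip k).det|

variable {σ : C → K →L[ℝ] C} {U B : Set C}

/-- The map `(t, k) ↦ (σ t k, k)`. -/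
def familyMap (σ : C → K →L[ℝ] C) (z : C × K) : C × K := (σ z.1 z.2, z.2)

/-- The derivative of `familyMap`. -/
def familyDeriv (σ : C → K →L[ℝ] C) (z : C × K) : C × K →L[ℝ] C × K :=
  ((((fderiv ℝ σ z.1).flip z.2).comp (ContinuousLinearMap.fst ℝ C K) +
    (σ z.1).comp (ContinuousLinearMap.snd ℝ C K)).prod (ContinuousLinearMap.snd ℝ C K))

theorem hasStrictFDerivAt_familyMap (hU : IsOpen U) (hσ : ContDiffOn ℝ 1 σ U) {z : C × K}
    (hz : z.1 ∈ U) : HasStrictFDerivAt (familyMap σ) (familyDeriv σ z) z := by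
  have h1 : HasStrictFDerivAt σ (fderiv ℝ σ z.1) z.1 :=
    (hσ.contDiffAt (hU.mem_nhds hz)).hasStrictFDerivAt (by simp)
  have h2 : HasStrictFDerivAt (fun z : C × K => σ z.1)
      ((fderiv ℝ σ z.1).comp (ContinuousLinearMap.fst ℝ C K)) z :=
    h1.comp z hasStrictFDerivAt_fst
  have h3 := (h2.clm_apply (hasStrictFDerivAt_snd (p := z))).prodMk
    (hasStrictFDerivAt_snd (𝕜 := ℝ) (p := z))
  refine h3.congr_fderiv ?_
  ext v <;> simp [familyDeriv]

theorem continuousOn_familyDeriv (hU : IsOpen U) (hσ : ContDiffOn ℝ 1 σ U) :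
    ContinuousOn (familyDeriv σ) (U ×ˢ (Set.univ : Set K)) := by
  have h1 : ContinuousOn (fderiv ℝ σ) U := hσ.continuousOn_fderiv_of_isOpen hU le_rfl
  have h1' : ContinuousOn (fun z : C × K => fderiv ℝ σ z.1) (U ×ˢ (Set.univ : Set K)) :=
    h1.comp continuousOn_fst fun z hz => hz.1
  have h2 : ContinuousOn (fun z : C × K => σ z.1) (U ×ˢ (Set.univ : Set K)) :=
    hσ.continuousOn.comp continuousOn_fst fun z hz => hz.1
  have h3 : ContinuousOn (fun z : C × K => (fderiv ℝ σ z.1).flip z.2)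
      (U ×ˢ (Set.univ : Set K)) :=
    ((ContinuousLinearMap.flipₗᵢ ℝ C K C).continuous.comp_continuousOn h1').clm_apply
      continuousOn_snd
  have h4 := ((h3.clm_comp (continuousOn_const (c := ContinuousLinearMap.fst ℝ C K))).add
    (h2.clm_comp (continuousOn_const (c := ContinuousLinearMap.snd ℝ C K)))).prodMk
    (continuousOn_const (c := ContinuousLinearMap.snd ℝ C K))
  exact (ContinuousLinearMap.prodₗᵢ (𝕜 := ℝ) (E := C × K) (F := C) (G := K) ℝ).continuous.comp_continuousOn h4

theorem continuousOn_family_integrand (hU : IsOpen U) (hσ : ContDiffOn ℝ 1 σ U) :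
    ContinuousOn (fun z : C × K => Real.exp (-(‖σ z.1 z.2‖ ^ 2 + ‖z.2‖ ^ 2)) *
      |((fderiv ℝ σ z.1).flip z.2).det|) (U ×ˢ (Set.univ : Set K)) := by
  have h1 : ContinuousOn (fderiv ℝ σ) U := hσ.continuousOn_fderiv_of_isOpen hU le_rfl
  have h1' : ContinuousOn (fun z : C × K => fderiv ℝ σ z.1) (U ×ˢ (Set.univ : Set K)) :=
    h1.comp continuousOn_fst fun z hz => hz.1
  have h2 : ContinuousOn (fun z : C × K => σ z.1) (U ×ˢ (Set.univ : Set K)) :=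
    hσ.continuousOn.comp continuousOn_fst fun z hz => hz.1
  have h3 : ContinuousOn (fun z : C × K => (fderiv ℝ σ z.1).flip z.2)
      (U ×ˢ (Set.univ : Set K)) :=
    ((ContinuousLinearMap.flipₗᵢ ℝ C K C).continuous.comp_continuousOn h1').clm_apply
      continuousOn_snd
  have h4 := h2.clm_apply (continuousOn_snd (s := U ×ˢ (Set.univ : Set K)))
  have h5 : ContinuousOn (fun z : C × K => ((fderiv ℝ σ z.1).flip z.2).det)
    (U ×ˢ (Set.univ : Set K)) := ContinuousLinearMap.continuous_det.comp_continuousOn h3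
  exact ((((h4.norm.pow 2).add (continuousOn_snd.norm.pow 2)).neg).rexp).mul h5.abs

/-- The determinant is homogeneous of degree `dim C` in `k`, so a bound on a compact neighbourhood
of `t₀` times the unit ball suffices. Scaling by `1 + ‖k‖` instead of `‖k‖` spares the case `k = 0`.
-/
theorem exists_bound_family (hU : IsOpen U) (hσ : ContDiffOn ℝ 1 σ U) {t₀ : C} (ht₀ : t₀ ∈ U) :
    ∃ Q : ℝ, ∀ᶠ t in nhds t₀, ∀ k : K,
      |((fderiv ℝ σ t).flip k).det| ≤ Q * (1 + ‖k‖) ^ Module.finrank ℝ C := by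
  obtain ⟨ρ, hρ, hsub⟩ := Metric.nhds_basis_closedBall.mem_iff.1 (hU.mem_nhds ht₀)
  have h1 : ContinuousOn (fderiv ℝ σ) U := hσ.continuousOn_fderiv_of_isOpen hU le_rfl
  have h1' : ContinuousOn (fun z : C × K => fderiv ℝ σ z.1)
      (Metric.closedBall t₀ ρ ×ˢ Metric.closedBall (0 : K) 1) :=
    h1.comp continuousOn_fst fun z hz => hsub hz.1
  have h3 : ContinuousOn (fun z : C × K => (fderiv ℝ σ z.1).flip z.2)
      (Metric.closedBall t₀ ρ ×ˢ Metric.closedBall (0 : K) 1) :=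
    ((ContinuousLinearMap.flipₗᵢ ℝ C K C).continuous.comp_continuousOn h1').clm_apply
      continuousOn_snd
  have h5 : ContinuousOn (fun z : C × K => ((fderiv ℝ σ z.1).flip z.2).det)
    (Metric.closedBall t₀ ρ ×ˢ Metric.closedBall (0 : K) 1) :=
    ContinuousLinearMap.continuous_det.comp_continuousOn h3
  obtain ⟨Q, hQ⟩ := ((isCompact_closedBall t₀ ρ).prod
    (isCompact_closedBall (0 : K) 1)).exists_bound_of_continuousOn h5
  refine ⟨Q, Filter.eventually_of_mem (Metric.closedBall_mem_nhds t₀ hρ) fun t ht k => ?_⟩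
  have hk : (0 : ℝ) < 1 + ‖k‖ := by positivity
  have hk' : (1 + ‖k‖)⁻¹ • k ∈ Metric.closedBall (0 : K) 1 := by
    rw [mem_closedBall_zero_iff, norm_smul, norm_inv, Real.norm_of_nonneg hk.le, inv_mul_le_iff₀ hk]
    linarith
  have h6 := hQ (t, (1 + ‖k‖)⁻¹ • k) ⟨ht, hk'⟩
  have h7 : ((fderiv ℝ σ t).flip k) = (1 + ‖k‖) • ((fderiv ℝ σ t).flip ((1 + ‖k‖)⁻¹ • k)) := by
    rw [map_smul, smul_smul, mul_inv_cancel₀ hk.ne', one_smul]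
  rw [h7, ContinuousLinearMap.det, ContinuousLinearMap.toLinearMap_smul, LinearMap.det_smul, abs_mul, abs_pow, abs_of_pos hk,
    mul_comm]
  exact mul_le_mul_of_nonneg_right h6 (by positivity)

theorem family_integrand_le {t : C} {k : K} {Q : ℝ} {n : ℕ}
    (h : |((fderiv ℝ σ t).flip k).det| ≤ Q * (1 + ‖k‖) ^ n) :
    ‖Real.exp (-(‖σ t k‖ ^ 2 + ‖k‖ ^ 2)) * |((fderiv ℝ σ t).flip k).det|‖ ≤
      Q * ((1 + ‖k‖) ^ n * Real.exp (-‖k‖ ^ 2)) := by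
  rw [Real.norm_of_nonneg (by positivity)]
  have h0 : 0 ≤ Q * (1 + ‖k‖) ^ n := (abs_nonneg _).trans h
  calc _ ≤ Real.exp (-‖k‖ ^ 2) * (Q * (1 + ‖k‖) ^ n) := by
        gcongr
        nlinarith [sq_nonneg ‖σ t k‖]
    _ = _ := by ring

theorem aestronglyMeasurable_family (hU : IsOpen U) (hσ : ContDiffOn ℝ 1 σ U) {t : C}
    (ht : t ∈ U) : AEStronglyMeasurable (fun k : K =>
      Real.exp (-(‖σ t k‖ ^ 2 + ‖k‖ ^ 2)) * |((fderiv ℝ σ t).flip k).det|) volume := by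
  have h := (continuousOn_family_integrand hU hσ).comp_continuous
    (f := fun k : K => (t, k)) (by fun_prop) (fun k => ⟨ht, Set.mem_univ _⟩)
  exact h.aestronglyMeasurable

theorem integrable_family (hU : IsOpen U) (hσ : ContDiffOn ℝ 1 σ U) {t : C} (ht : t ∈ U) :
    Integrable (fun k : K =>
      Real.exp (-(‖σ t k‖ ^ 2 + ‖k‖ ^ 2)) * |((fderiv ℝ σ t).flip k).det|) := by
  obtain ⟨Q, hQ⟩ := exists_bound_family hU hσ ht
  exact ((integrable_pow_mul_gaussian _).const_mul Q).mono' (aestronglyMeasurable_family hU hσ ht)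
    (Filter.Eventually.of_forall fun k => family_integrand_le (hQ.self_of_nhds k))

/-- Dominated convergence: locally in `t` the integrand is bounded by one polynomial times a
Gaussian. Continuity is what allows the density to be frozen at its value at the base point. -/
theorem continuousOn_familyDensity (hU : IsOpen U) (hσ : ContDiffOn ℝ 1 σ U) :
    ContinuousOn (familyDensity σ) U := by
  intro t₀ ht₀
  obtain ⟨Q, hQ⟩ := exists_bound_family hU hσ ht₀
  refine (continuousAt_of_dominated
    (bound := fun k => Q * ((1 + ‖k‖) ^ Module.finrank ℝ C * Real.exp (-‖k‖ ^ 2))) ?_ ?_ ?_ ?_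
    ).continuousWithinAt
  · filter_upwards [hU.mem_nhds ht₀] with t ht using aestronglyMeasurable_family hU hσ ht
  · filter_upwards [hQ] with t ht
    exact Filter.Eventually.of_forall fun k => family_integrand_le (ht k)
  · exact (integrable_pow_mul_gaussian _).const_mul Q
  · refine Filter.Eventually.of_forall fun k => ?_
    have h := (continuousOn_family_integrand hU hσ).continuousAt (x := (t₀, k))
      ((hU.prod isOpen_univ).mem_nhds ⟨ht₀, Set.mem_univ _⟩)
    exact h.comp (f := fun t : C => (t, k)) (by fun_prop)

instance isAddHaarMeasure_volume_prod : (volume : Measure (C × K)).IsAddHaarMeasure :=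
  inferInstanceAs ((volume : Measure C).prod (volume : Measure K)).IsAddHaarMeasure

/-- Keeping `k` as a second output makes the zeros of the equation with data `(c, k)` the fibre of a
map between spaces of equal dimension, to which the area formula applies. -/
theorem encard_family (z : C × K) :
    ({t ∈ B | σ t z.2 = z.1}).encard =
      ((B ×ˢ (Set.univ : Set K)) ∩ familyMap σ ⁻¹' {z}).encard := by
  have : (B ×ˢ (Set.univ : Set K)) ∩ familyMap σ ⁻¹' {z} =
      (fun t : C => (t, z.2)) '' {t ∈ B | σ t z.2 = z.1} := by
    ext ⟨t, k⟩
    simp only [Set.mem_inter_iff, Set.mem_prod, Set.mem_univ, and_true, Set.mem_preimage,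
      Set.mem_singleton_iff, familyMap, Prod.ext_iff, Set.mem_image, Set.mem_ofPred_eq]
    constructor
    · rintro ⟨ht, h1, rfl⟩
      exact ⟨t, ⟨ht, h1⟩, rfl, rfl⟩
    · rintro ⟨t', ⟨ht, h1⟩, rfl, rfl⟩
      exact ⟨ht, h1, rfl⟩
  rw [this, Set.InjOn.encard_image]
  intro a _ b _ h
  exact congrArg Prod.fst h

theorem aemeasurable_encard_family (hU : IsOpen U) (hσ : ContDiffOn ℝ 1 σ U)
    (hB : MeasurableSet B) (hBU : B ⊆ U) :
    AEMeasurable (fun z : C × K => (({t ∈ B | σ t z.2 = z.1}).encard : ℝ≥0∞)) := by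
  simp only [encard_family]
  exact aemeasurable_encard_fiber _ (f' := familyDeriv σ)
    (fun z hz => hasStrictFDerivAt_familyMap hU hσ (hBU hz.1))
    ((continuousOn_familyDeriv hU hσ).mono (Set.prod_mono hBU subset_rfl))
    (hB.prod MeasurableSet.univ)

/-- The derivative of `(t, k) ↦ (σ t k, k)` is block triangular, so its Jacobian is the determinant
of `τ ↦ (∂_τ σ) k`. The area formula and Tonelli's theorem, with `k` integrated first, leave
`familyDensity`. -/
theorem lintegral_encard_family (hU : IsOpen U) (hσ : ContDiffOn ℝ 1 σ U)
    (hB : MeasurableSet B) (hBU : B ⊆ U) :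
    ∫⁻ z : C × K, ENNReal.ofReal (Real.exp (-(‖z.1‖ ^ 2 + ‖z.2‖ ^ 2))) *
      (({t ∈ B | σ t z.2 = z.1}).encard : ℝ≥0∞) =
    ∫⁻ t in B, ENNReal.ofReal (familyDensity σ t) := by
  simp only [encard_family]
  have hsub : B ×ˢ (Set.univ : Set K) ⊆ U ×ˢ Set.univ := Set.prod_mono hBU subset_rfl
  rw [lintegral_mul_encard_fiber volume (f' := familyDeriv σ)
    (fun z hz => hasStrictFDerivAt_familyMap hU hσ (hBU hz.1))
    ((continuousOn_familyDeriv hU hσ).mono hsub) (hB.prod MeasurableSet.univ) (by fun_prop)]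
  have hrw : ∀ z : C × K, ENNReal.ofReal |(familyDeriv σ z).det| *
      ENNReal.ofReal (Real.exp (-(‖(familyMap σ z).1‖ ^ 2 + ‖(familyMap σ z).2‖ ^ 2))) =
      ENNReal.ofReal (Real.exp (-(‖σ z.1 z.2‖ ^ 2 + ‖z.2‖ ^ 2)) *
      |((fderiv ℝ σ z.1).flip z.2).det|) := by
    intro z
    rw [familyDeriv, det_triangular, ENNReal.ofReal_mul (by positivity), mul_comm]
    rfl
  simp only [hrw]
  have hm : AEMeasurable (fun z : C × K =>
      ENNReal.ofReal (Real.exp (-(‖σ z.1 z.2‖ ^ 2 + ‖z.2‖ ^ 2)) *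
      |((fderiv ℝ σ z.1).flip z.2).det|))
      ((volume.restrict B).prod (volume.restrict Set.univ)) := by
    rw [Measure.prod_restrict]
    exact (((continuousOn_family_integrand hU hσ).mono hsub).aemeasurable
      (hB.prod MeasurableSet.univ)).ennreal_ofReal
  rw [Measure.volume_eq_prod, ← Measure.prod_restrict, lintegral_prod _ hm, Measure.restrict_univ]
  refine setLIntegral_congr_fun hB fun t ht => ?_
  exact (ofReal_integral_eq_lintegral_ofReal (integrable_family hU hσ (hBU ht))
    (Filter.Eventually.of_forall fun k => by simp only [Pi.zero_apply]; positivity)).symm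

end Family

/-! ### Gram determinants and the volume of a bilinear form -/

section Gram

variable {E : Type*} [NormedAddCommGroup E] [NormedSpace ℝ E]
  {ι ι' : Type*} [Fintype ι] [DecidableEq ι] [Fintype ι'] [DecidableEq ι']

/-- The Gram matrix of a family of vectors with respect to a bilinear form. -/
def gramMatrix (β : E →L[ℝ] E →L[ℝ] ℝ) (v : ι → E) : Matrix ι ι ℝ :=
  Matrix.of fun i j => β (v i) (v j)

theorem det_gramMatrix (β : E →L[ℝ] E →L[ℝ] ℝ) (b : Module.Basis ι ℝ E) (v : ι → E) :
    (gramMatrix β v).det = b.det v ^ 2 * (gramMatrix β b).det := by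
  have h : gramMatrix β v = (b.toMatrix v).transpose * gramMatrix β b * b.toMatrix v := by
    ext i j
    have hv : ∀ i, v i = ∑ k, b.toMatrix v k i • b k := fun i => (b.sum_toMatrix_smul_self v i).symm
    change β (v i) (v j) = _
    rw [hv i, hv j]
    simp only [map_sum, map_smul, sum_apply, smul_apply,
      smul_eq_mul, Matrix.mul_apply, gramMatrix, Matrix.of_apply, Matrix.transpose_apply,
      Finset.sum_mul, Finset.mul_sum]
    refine Finset.sum_congr rfl fun k _ => Finset.sum_congr rfl fun l _ => ?_
    ring
  rw [h, Matrix.det_mul, Matrix.det_mul, Matrix.det_transpose, Module.Basis.det_apply]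
  ring

theorem sqrt_det_gramMatrix (β : E →L[ℝ] E →L[ℝ] ℝ) (b : Module.Basis ι ℝ E) (v : ι → E) :
    Real.sqrt (gramMatrix β v).det = |b.det v| * Real.sqrt (gramMatrix β b).det := by
  rw [det_gramMatrix β b, Real.sqrt_mul (sq_nonneg _), Real.sqrt_sq_eq_abs]

theorem det_gramMatrix_comp (β : E →L[ℝ] E →L[ℝ] ℝ) (e : ι ≃ ι') (v : ι' → E) :
    (gramMatrix β (v ∘ e)).det = (gramMatrix β v).det := by
  rw [← Matrix.det_submatrix_equiv_self e (gramMatrix β v)]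
  rfl

variable [MeasurableSpace E] [BorelSpace E] [FiniteDimensional ℝ E]

/-- Haar measures are determined by the mass of one parallelepiped: that of `b` has mass `1` for
`b.addHaar` and `|b'.det b|` for `b'.addHaar`. -/
theorem addHaar_eq_smul (b b' : Module.Basis ι ℝ E) :
    b'.addHaar = ENNReal.ofReal |b'.det b| • b.addHaar := by
  have h := Measure.addHaarMeasure_unique b'.addHaar b.parallelepiped
  rw [← Measure.addHaar_parallelepiped b' b, Module.Basis.addHaar_def b]
  exact h

/-- The volume of a bilinear form does not depend on the basis used to compute it. -/
theorem lintegral_sqrt_gram (b : Module.Basis ι ℝ E) (b' : Module.Basis ι' ℝ E)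
    (β : E → E →L[ℝ] E →L[ℝ] ℝ) (s : Set E) (F : E → ℝ≥0∞) :
    ∫⁻ y in s, ENNReal.ofReal (Real.sqrt (gramMatrix (β y) b').det) * F y ∂b'.addHaar =
      ∫⁻ y in s, ENNReal.ofReal (Real.sqrt (gramMatrix (β y) b).det) * F y ∂b.addHaar := by
  let e : ι ≃ ι' := b.indexEquiv b'
  set c := b.reindex e with hc
  have h1 : b.addHaar = c.addHaar := (b.addHaar_reindex e).symm
  have h2 : ∀ y, (gramMatrix (β y) b).det = (gramMatrix (β y) c).det := fun y => by
    rw [← det_gramMatrix_comp (β y) e c]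
    congr 2
    ext i
    simp [hc]
  rw [h1, addHaar_eq_smul c b', Measure.restrict_smul, lintegral_smul_measure, smul_eq_mul,
    ← lintegral_const_mul' _ _ ENNReal.ofReal_ne_top]
  refine lintegral_congr fun y => ?_
  -- The factor by which the Gram density changes is the same determinant that compares the two Haar
  -- measures.
  rw [h2, sqrt_det_gramMatrix (β y) b' c, ENNReal.ofReal_mul (abs_nonneg _), mul_assoc]

theorem gramMatrix_comp_linear (β : E →L[ℝ] E →L[ℝ] ℝ) (b : Module.Basis ι ℝ E) (A : E →L[ℝ] E) :
    Real.sqrt (gramMatrix β (A ∘ b)).det = |A.det| * Real.sqrt (gramMatrix β b).det := by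
  rw [sqrt_det_gramMatrix β b]
  congr 2
  have := b.det_comp (A : E →ₗ[ℝ] E) b
  rw [b.det_self, mul_one] at this
  exact this

end Gram

/-! ### Partitions into small sets -/

/-- A second countable space is a countable disjoint union of measurable sets, each contained in
one of a given family of neighbourhoods. -/
theorem exists_partition_subset {X : Type*} [TopologicalSpace X] [SecondCountableTopology X]
    [MeasurableSpace X] [OpensMeasurableSpace X] {U : X → Set X} (hU : ∀ x, IsOpen (U x))
    (hx : ∀ x, x ∈ U x) :
    ∃ B : ℕ → Set X, (∀ n, MeasurableSet (B n)) ∧ Pairwise (Function.onFun Disjoint B) ∧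
      (⋃ n, B n) = Set.univ ∧ ∀ n, B n = ∅ ∨ ∃ x, B n ⊆ U x := by
  obtain ⟨t, htc, hcov⟩ := TopologicalSpace.countable_cover_nhds
    (f := U) fun x => (hU x).mem_nhds (hx x)
  rcases t.eq_empty_or_nonempty with rfl | hne
  · refine ⟨fun _ => ∅, by simp, fun _ _ _ => by simp [Function.onFun], ?_, by simp⟩
    simpa using hcov
  obtain ⟨e, rfl⟩ := htc.exists_eq_range hne
  refine ⟨disjointed (fun n => U (e n)), fun n => ?_, disjoint_disjointed _, ?_, fun n => ?_⟩
  · exact MeasurableSet.disjointed (fun n => (hU _).measurableSet) n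
  · rw [iUnion_disjointed]
    simpa using hcov
  · exact Or.inr ⟨e n, disjointed_subset _ _⟩

/-- Measures that agree on small measurable sets are equal. -/
theorem measure_ext_of_local {X : Type*} [TopologicalSpace X] [SecondCountableTopology X]
    [MeasurableSpace X] [OpensMeasurableSpace X] {μ ν : Measure X} {U : X → Set X}
    (hU : ∀ x, IsOpen (U x)) (hx : ∀ x, x ∈ U x)
    (h : ∀ x, ∀ s ⊆ U x, MeasurableSet s → μ s = ν s) : μ = ν := by
  obtain ⟨B, hBm, hBd, hBU, hB⟩ := exists_partition_subset hU hx
  refine Measure.ext_of_iUnion_eq_univ hBU fun n => Measure.ext fun s hs => ?_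
  rw [Measure.restrict_apply hs, Measure.restrict_apply hs]
  rcases hB n with h0 | ⟨x, hxn⟩
  · simp [h0]
  · exact h x _ (Set.inter_subset_right.trans hxn) (hs.inter (hBm n))

theorem measurableSet_inter_preimage_of_continuousOn {X Y : Type*} [TopologicalSpace X]
    [MeasurableSpace X] [BorelSpace X] [TopologicalSpace Y] [MeasurableSpace Y] [BorelSpace Y]
    {f : X → Y} {T : Set X} (hf : ContinuousOn f T) (hT : MeasurableSet T) {B : Set Y}
    (hB : MeasurableSet B) : MeasurableSet (T ∩ f ⁻¹' B) := by
  have h := (continuousOn_iff_continuous_domRestrict.1 hf).measurable hB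
  have := hT.subtype_image h
  convert this using 1
  ext x
  constructor
  · rintro ⟨hx, hx'⟩
    exact ⟨⟨x, hx⟩, hx', rfl⟩
  · rintro ⟨⟨x, hx⟩, hx', rfl⟩
    exact ⟨hx, hx'⟩

/-! ### Naturality of the Riemannian volume -/

section Naturality

variable {E : Type*} [NormedAddCommGroup E] [NormedSpace ℝ E] [FiniteDimensional ℝ E]
  {H : Type*} [TopologicalSpace H] {I : ModelWithCorners ℝ E H} [I.Boundaryless]
  {M : Type*} [TopologicalSpace M] [ChartedSpace H M] [IsManifold I ∞ M]

theorem contMDiffAt_extChartAt_symm_of_mem (p : M) {y : E} (hy : y ∈ (extChartAt I p).target) :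
    ContMDiffAt 𝓘(ℝ, E) I ∞ (extChartAt I p).symm y :=
  (contMDiffOn_extChartAt_symm p).contMDiffAt ((isOpen_extChartAt_target p).mem_nhds hy)

theorem mdifferentiableAt_extChartAt_symm_of_mem (p : M) {y : E}
    (hy : y ∈ (extChartAt I p).target) :
    MDifferentiableAt 𝓘(ℝ, E) I (extChartAt I p).symm y :=
  (contMDiffAt_extChartAt_symm_of_mem p hy).mdifferentiableAt (by simp)

theorem contMDiffAt_extChartAt_of_mem (p : M) {x : M} (hx : x ∈ (extChartAt I p).source) :
    ContMDiffAt I 𝓘(ℝ, E) ∞ (extChartAt I p) x :=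
  contMDiffAt_extChartAt' (by rwa [extChartAt_source] at hx)

/-- A diffeomorphism that preserves the metric. -/
def IsIsometric (g : RMetric I M) (φ : M ≃ₘ⟮I, I⟯ M) : Prop :=
  ∀ (x : M) (X Y : TangentSpace I x), pullbackForm g φ x X Y = g.inner x X Y

variable {g : RMetric I M} {φ : M ≃ₘ⟮I, I⟯ M}

/-- The coordinate representation of a diffeomorphism. -/
def coordMap (φ : M ≃ₘ⟮I, I⟯ M) (p q : M) (y : E) : E :=
  extChartAt I q (φ ((extChartAt I p).symm y))

theorem contDiffAt_coordMap {p q : M} {y : E} (hy : y ∈ (extChartAt I p).target)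
    (hq : φ ((extChartAt I p).symm y) ∈ (extChartAt I q).source) :
    ContDiffAt ℝ ∞ (coordMap φ p q) y := by
  rw [← contMDiffAt_iff_contDiffAt]
  have h1 := contMDiffAt_extChartAt_symm_of_mem (I := I) p hy
  have h2 : ContMDiffAt I I ∞ φ ((extChartAt I p).symm y) := φ.contMDiff _
  exact (contMDiffAt_extChartAt_of_mem q hq).comp y (h2.comp y h1)

theorem coordMetric_apply (g : RMetric I M) (p : M) (y u w : E) :
    coordMetric g p y u w = g.inner ((extChartAt I p).symm y)
      (mfderiv 𝓘(ℝ, E) I (extChartAt I p).symm y u)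
      (mfderiv 𝓘(ℝ, E) I (extChartAt I p).symm y w) := rfl

theorem inner_congr (g : RMetric I M) {x x' : M} (h : x = x') (u w : E) :
    g.inner x u w = g.inner x' u w := by rw [h]

/-- The coordinate expressions of the metric are related by the coordinate expression of an
isometry. -/
theorem coordMetric_coordMap (hφ : IsIsometric g φ) {p q : M} {y : E}
    (hy : y ∈ (extChartAt I p).target)
    (hq : φ ((extChartAt I p).symm y) ∈ (extChartAt I q).source) (u w : E) :
    coordMetric g p y u w = coordMetric g q (coordMap φ p q y)
      (fderiv ℝ (coordMap φ p q) y u) (fderiv ℝ (coordMap φ p q) y w) := by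
  set x := (extChartAt I p).symm y with hx
  have h1 := mdifferentiableAt_extChartAt_symm_of_mem (I := I) p hy
  have h2 : MDifferentiableAt I I φ x := (φ.contMDiff x).mdifferentiableAt (by simp)
  have hτ : MDifferentiableAt 𝓘(ℝ, E) 𝓘(ℝ, E) (coordMap φ p q) y :=
    ((contDiffAt_coordMap hy hq).differentiableAt (by simp)).mdifferentiableAt
  have hτq : coordMap φ p q y ∈ (extChartAt I q).target := (extChartAt I q).map_source hq
  have h3 := mdifferentiableAt_extChartAt_symm_of_mem (I := I) q hτq
  -- Near `y`, the coordinate map followed by the inverse chart at `q` is `φ` after the inverse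
  -- chart at `p`. Differentiating this identity and using that `φ` is isometric gives the claim.
  have hev : (extChartAt I q).symm ∘ coordMap φ p q =ᶠ[nhds y] φ ∘ (extChartAt I p).symm := by
    have hc : ContinuousAt (fun y => φ ((extChartAt I p).symm y)) y :=
      ContinuousAt.comp (f := (extChartAt I p).symm) (g := φ) φ.continuous.continuousAt
        h1.continuousAt
    filter_upwards [hc.preimage_mem_nhds ((isOpen_extChartAt_source q).mem_nhds hq)] with z hz
    exact (extChartAt I q).left_inv hz
  have hm := hev.mfderiv_eq (I := 𝓘(ℝ, E)) (I' := I)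
  have hp : (extChartAt I q).symm (coordMap φ p q y) = φ x := hev.self_of_nhds
  have hvec : ∀ u : E, mfderiv 𝓘(ℝ, E) I (extChartAt I q).symm (coordMap φ p q y)
      (fderiv ℝ (coordMap φ p q) y u) =
      mfderiv I I φ x (mfderiv 𝓘(ℝ, E) I (extChartAt I p).symm y u) := by
    intro u
    rw [mfderiv_comp y h3 hτ, mfderiv_comp y h2 h1, mfderiv_eq_fderiv] at hm
    exact DFunLike.congr_fun hm u
  rw [coordMetric_apply, coordMetric_apply, hvec u, hvec w]
  exact (hφ x _ _).symm.trans (inner_congr g hp.symm _ _)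

variable [MeasurableSpace E] [BorelSpace E] [MeasurableSpace M] [BorelSpace M]

theorem coordGram_eq_gramMatrix (g : RMetric I M) (p : M) (y : E) :
    coordGram g p y = gramMatrix (coordMetric g p y) (Module.finBasis ℝ E) := rfl

theorem measurableSet_coord (p : M) {B : Set M} (hB : MeasurableSet B) :
    MeasurableSet ((extChartAt I p).target ∩ (extChartAt I p).symm ⁻¹' B) :=
  measurableSet_inter_preimage_of_continuousOn (continuousOn_extChartAt_symm p)
    (isOpen_extChartAt_target p).measurableSet hB

theorem chartVolume_apply (g : RMetric I M) (p : M) {B : Set M} (hB : MeasurableSet B) :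
    chartVolume g p B = ∫⁻ y in (extChartAt I p).target ∩ (extChartAt I p).symm ⁻¹' B,
      ENNReal.ofReal (Real.sqrt (coordGram g p y).det) ∂(Module.finBasis ℝ E).addHaar := by
  set T := (extChartAt I p).target with hT
  have hTm : MeasurableSet T := (isOpen_extChartAt_target p).measurableSet
  have hS := measurableSet_coord (I := I) p hB
  set S := T ∩ (extChartAt I p).symm ⁻¹' B with hSdef
  rw [chartVolume, Measure.map_apply_of_aemeasurable (aemeasurable_symm g p) hB]
  have hae : ((extChartAt I p).symm ⁻¹' B : Set E) =ᵐ[((Module.finBasis ℝ E).addHaar.restrict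
      T).withDensity fun y => ENNReal.ofReal (Real.sqrt (coordGram g p y).det)] S := by
    have h1 := (withDensity_absolutelyContinuous ((Module.finBasis ℝ E).addHaar.restrict T)
      fun y => ENNReal.ofReal (Real.sqrt (coordGram g p y).det)).ae_le (ae_restrict_mem hTm)
    filter_upwards [h1] with y hy
    exact propext ⟨fun h => ⟨hy, h⟩, fun h => h.2⟩
  rw [measure_congr hae, withDensity_apply _ hS, Measure.restrict_restrict hS,
    Set.inter_eq_left.2 Set.inter_subset_left]

/-- Isometries preserve the volume computed in charts. -/
theorem chartVolume_isometric (hφ : IsIsometric g φ) {p q : M} {B : Set M}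
    (hB : MeasurableSet B) (hq : B ⊆ (extChartAt I q).source)
    (hp : φ ⁻¹' B ⊆ (extChartAt I p).source) :
    chartVolume g q B = chartVolume g p (φ ⁻¹' B) := by
  have hB' : MeasurableSet (φ ⁻¹' B) := φ.continuous.measurable hB
  rw [chartVolume_apply g q hB, chartVolume_apply g p hB']
  have hS := measurableSet_coord (I := I) p hB'
  set S := (extChartAt I p).target ∩ (extChartAt I p).symm ⁻¹' (φ ⁻¹' B) with hSdef
  have himg : (extChartAt I q).target ∩ (extChartAt I q).symm ⁻¹' B = coordMap φ p q '' S := by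
    ext z
    constructor
    · rintro ⟨hz, hzB⟩
      have hzB' : (extChartAt I q).symm z ∈ B := hzB
      have h1 : φ.symm ((extChartAt I q).symm z) ∈ φ ⁻¹' B := by
        simpa using hzB'
      refine ⟨extChartAt I p (φ.symm ((extChartAt I q).symm z)),
        ⟨(extChartAt I p).map_source (hp h1), ?_⟩, ?_⟩
      · rw [Set.mem_preimage, (extChartAt I p).left_inv (hp h1)]
        exact h1
      · rw [coordMap, (extChartAt I p).left_inv (hp h1), φ.apply_symm_apply,
          (extChartAt I q).right_inv hz]
    · rintro ⟨y, ⟨hy, hyB⟩, rfl⟩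
      have hyB' : φ ((extChartAt I p).symm y) ∈ B := hyB
      refine ⟨(extChartAt I q).map_source (hq hyB'), ?_⟩
      rw [Set.mem_preimage, coordMap, (extChartAt I q).left_inv (hq hyB')]
      exact hyB'
  have hinj : Set.InjOn (coordMap φ p q) S := by
    rintro y ⟨hy, hyB⟩ z ⟨hz, hzB⟩ h
    have h1 := (extChartAt I q).injOn (hq hyB) (hq hzB) h
    exact (extChartAt I p).symm.injOn hy hz (φ.injective h1)
  have hd : ∀ y ∈ S, HasFDerivWithinAt (coordMap φ p q) (fderiv ℝ (coordMap φ p q) y) S y :=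
    fun y hy => ((contDiffAt_coordMap hy.1 (hq hy.2)).differentiableAt
      (by simp)).hasFDerivAt.hasFDerivWithinAt
  rw [himg, lintegral_image_eq_lintegral_abs_det_fderiv_mul _ hS hd hinj]
  refine setLIntegral_congr_fun hS fun y hy => ?_
  -- The metric in the chart at `p` is the pullback of the one in the chart at `q`, so the Jacobian
  -- of the coordinate map is absorbed into the Gram density.
  rw [← ENNReal.ofReal_mul (abs_nonneg _), coordGram_eq_gramMatrix, coordGram_eq_gramMatrix,
    ← gramMatrix_comp_linear]
  refine congrArg (fun m : Matrix _ _ ℝ => ENNReal.ofReal (Real.sqrt m.det)) ?_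
  ext i j
  exact (coordMetric_coordMap hφ hy.1 (hq hy.2) _ _).symm

/-- Applied to the identity, `chartVolume_isometric` says that two charts assign the same volume to
a set in both domains. -/
theorem isIsometric_refl (g : RMetric I M) : IsIsometric g (Diffeomorph.refl I M ∞) := by
  intro x X Y
  rw [pullbackForm_apply]
  have : mfderiv I I (Diffeomorph.refl I M ∞) x = ContinuousLinearMap.id ℝ (TangentSpace I x) :=
    mfderiv_id
  rw [this]
  rfl

variable [T2Space M]

/-- The Riemannian volume agrees with the volume of a chart on its domain. -/
theorem riemVolume_eq_chartVolume [SigmaCompactSpace M] [CompactSpace M] (g : RMetric I M) (q : M)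
    {B : Set M} (hB : MeasurableSet B) (hq : B ⊆ (extChartAt I q).source) :
    riemVolume g B = chartVolume g q B := by
  set ρ := chartPartition I M
  have hfin : (Function.support fun p => (ρ p : M → ℝ)).Finite :=
    (ρ.locallyFinite.finite_nonempty_of_compact).subset fun p hp =>
      Function.support_nonempty_iff.2 hp
  have hcont : ∀ p, Continuous (ρ p) := fun p => (ρ p).contMDiff.continuous
  have hterm : ∀ p, ((chartVolume g p).withDensity fun x => ENNReal.ofReal (ρ p x)) B =
      ∫⁻ x in B, ENNReal.ofReal (ρ p x) ∂chartVolume g q := by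
    intro p
    have hsm : MeasurableSet (extChartAt I p).source := (isOpen_extChartAt_source p).measurableSet
    have hzero : ∀ x, x ∉ (extChartAt I p).source → ENNReal.ofReal (ρ p x) = 0 := by
      intro x hx
      have : ρ p x = 0 := by
        by_contra h
        refine hx ?_
        rw [extChartAt_source]
        exact chartPartition_subordinate p (subset_tsupport _ h)
      rw [this, ENNReal.ofReal_zero]
    have hcut : ∀ μ : Measure M, ∫⁻ x in B, ENNReal.ofReal (ρ p x) ∂μ =
        ∫⁻ x in B ∩ (extChartAt I p).source, ENNReal.ofReal (ρ p x) ∂μ := by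
      intro μ
      rw [← lintegral_inter_add_sdiff (μ := μ) _ B hsm]
      rw [setLIntegral_congr_fun (s := B \ (extChartAt I p).source) (g := 0) (hB.diff hsm)
        fun x hx => hzero x hx.2]
      simp
    -- The weight `ρ p` vanishes outside the chart at `p`, so only the overlap of the two chart
    -- domains counts, and there the chart volumes agree.
    rw [withDensity_apply _ hB, hcut, hcut]
    congr 1
    refine Measure.ext fun s hs => ?_
    rw [Measure.restrict_apply hs, Measure.restrict_apply hs]
    exact (chartVolume_isometric (isIsometric_refl g) (p := q) (q := p)
      (hs.inter (hB.inter hsm)) (fun x hx => hx.2.2) fun x hx => hq hx.2.1)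
  rw [riemVolume, Measure.sum_apply _ hB]
  rw [tsum_congr hterm]
  have hz : ∀ p ∉ hfin.toFinset, (ρ p : M → ℝ) = 0 := fun p hp => by
    by_contra h
    exact hp (hfin.mem_toFinset.2 h)
  rw [tsum_eq_sum (s := hfin.toFinset) fun p hp => by rw [hz p hp]; simp,
    ← lintegral_finsetSum _ fun p _ => (hcont p).measurable.ennreal_ofReal]
  have hone : ∀ x, ∑ p ∈ hfin.toFinset, ENNReal.ofReal (ρ p x) = 1 := by
    intro x
    rw [← ENNReal.ofReal_sum_of_nonneg fun p _ => ρ.nonneg p x,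
      ← finsum_eq_sum_of_support_subset, ρ.sum_eq_one (Set.mem_univ x), ENNReal.ofReal_one]
    intro p hp
    rw [hfin.coe_toFinset]
    exact fun h => hp (by simp [h])
  simp [hone]

/-- Isometries preserve the Riemannian volume. -/
theorem measurePreserving_isometric [SecondCountableTopology M] [CompactSpace M]
    (hφ : IsIsometric g φ) : MeasurePreserving φ (riemVolume g) (riemVolume g) := by
  have hm : Measurable φ := φ.continuous.measurable
  refine ⟨hm, ?_⟩
  refine measure_ext_of_local (U := fun x => (extChartAt I x).source ∩
    φ.symm ⁻¹' (extChartAt I (φ.symm x)).source) (fun x => ?_) (fun x => ?_) fun x s hs hsm => ?_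
  · exact (isOpen_extChartAt_source x).inter
      ((isOpen_extChartAt_source _).preimage φ.symm.continuous)
  · exact ⟨mem_extChartAt_source x, mem_extChartAt_source (φ.symm x)⟩
  · have h1 : φ ⁻¹' s ⊆ (extChartAt I (φ.symm x)).source := fun z hz => by
      have := (hs hz).2
      simpa using this
    rw [Measure.map_apply hm hsm, riemVolume_eq_chartVolume g x hsm fun z hz => (hs hz).1,
      riemVolume_eq_chartVolume g (φ.symm x) (hm hsm) h1,
      chartVolume_isometric hφ hsm (fun z hz => (hs hz).1) h1]

end Naturality

/-! ### The adjunction map in coordinates -/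

section Coordinates

variable {E : Type*} [NormedAddCommGroup E] [NormedSpace ℝ E] [FiniteDimensional ℝ E]
  [MeasurableSpace E] [BorelSpace E]
  {H : Type*} [TopologicalSpace H] {I : ModelWithCorners ℝ E H} [I.Boundaryless]
  {M : Type*} [TopologicalSpace M] [ChartedSpace H M] [IsManifold I ∞ M]
  [T2Space M] [CompactSpace M] [MeasurableSpace M] [BorelSpace M]
  {g : RMetric I M} (V : Submodule ℝ (SmoothFun g)) [FiniteDimensional ℝ V]

theorem inner_adjunctionDual (x : M) (X : TangentSpace I x) (v : V) :
    inner ℝ (adjunctionDual V x X) v = adjunction V x v X :=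
  inner_riesz _ _

theorem inner_evVec (x : M) (v : V) : inner ℝ (evVec V x) v = v.1 x :=
  inner_riesz _ _

/-- The tangent space at `p` is identified with the model space through the chart at `p` itself. -/
theorem mfderiv_extChartAt_symm_self (p : M) :
    mfderiv 𝓘(ℝ, E) I (extChartAt I p).symm (extChartAt I p p) =
      ContinuousLinearMap.id ℝ E := by
  have h := mfderivWithin_range_extChartAt_symm (I := I) (x := p)
  rw [I.range_eq_univ, mfderivWithin_univ] at h
  exact h

/-- The differentials of the functions in `V`, read in the chart at `p`. -/
def coordDiff (p : M) (y : E) : V →L[ℝ] (E →L[ℝ] ℝ) :=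
  LinearMap.toContinuousLinearMap
    { toFun := fun v => (mvfderiv I (v : SmoothFun g) ((extChartAt I p).symm y)).comp
        (mfderiv 𝓘(ℝ, E) I (extChartAt I p).symm y)
      map_add' := fun u v => by
        have h := (adjunction V ((extChartAt I p).symm y)).map_add u v
        exact congrArg (fun A => ContinuousLinearMap.comp A
          (mfderiv 𝓘(ℝ, E) I (extChartAt I p).symm y)) h
      map_smul' := fun c v => by
        have h := (adjunction V ((extChartAt I p).symm y)).map_smul c v
        exact congrArg (fun A => ContinuousLinearMap.comp A
          (mfderiv 𝓘(ℝ, E) I (extChartAt I p).symm y)) h }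

variable {V}

theorem coordDiff_apply (p : M) (y : E) (v : V) :
    coordDiff V p y v = (mvfderiv I (v : SmoothFun g) ((extChartAt I p).symm y)).comp
        (mfderiv 𝓘(ℝ, E) I (extChartAt I p).symm y) := rfl

theorem contDiffOn_coordFun (p : M) (v : SmoothFun g) :
    ContDiffOn ℝ ∞ (fun y => v ((extChartAt I p).symm y)) (extChartAt I p).target := by
  rw [← contMDiffOn_iff_contDiffOn]
  exact v.contMDiff.comp_contMDiffOn (contMDiffOn_extChartAt_symm p)

theorem coordDiff_eq_fderiv (p : M) {y : E} (hy : y ∈ (extChartAt I p).target) (v : V) :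
    coordDiff V p y v = fderiv ℝ (fun y => v.1 ((extChartAt I p).symm y)) y := by
  have h1 := mdifferentiableAt_extChartAt_symm_of_mem (I := I) p hy
  have h2 : MDifferentiableAt I 𝓘(ℝ, ℝ) v.1 ((extChartAt I p).symm y) :=
    v.1.contMDiff.mdifferentiable (by simp) _
  have h3 := mvfderiv_comp y h2 h1
  rw [coordDiff_apply]
  refine h3.symm.trans ?_
  rw [mvfderiv, mfderiv_eq_fderiv]
  rfl

theorem coordDiff_eq_zero_iff (p : M) {y : E} (hy : y ∈ (extChartAt I p).target) (v : V) :
    coordDiff V p y v = 0 ↔ (extChartAt I p).symm y ∈ critSet v.1 := by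
  have h := isInvertible_mfderivWithin_extChartAt_symm (I := I) hy
  rw [I.range_eq_univ, mfderivWithin_univ] at h
  obtain ⟨e, he⟩ := h
  rw [coordDiff_apply, ← he]
  constructor
  · intro h0
    change mvfderiv I v.1 _ = 0
    ext X
    have h1 := DFunLike.congr_fun h0 (e.symm X)
    have h2 : mvfderiv I v.1 ((extChartAt I p).symm y) (e (e.symm X)) = 0 := h1
    rw [e.apply_symm_apply] at h2
    exact h2
  · intro h0
    have h0' : mvfderiv I v.1 ((extChartAt I p).symm y) = 0 := h0
    rw [h0']
    rfl

theorem contDiffOn_coordDiff (p : M) :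
    ContDiffOn ℝ ∞ (coordDiff V p) (extChartAt I p).target := by
  rw [contDiffOn_clm_apply]
  intro v
  have h := (contDiffOn_coordFun p v.1).fderiv_of_isOpen (m := ∞)
    (isOpen_extChartAt_target p) (by simp)
  exact h.congr fun y hy => coordDiff_eq_fderiv p hy v

theorem coordDiff_self (p : M) (v : V) :
    coordDiff V p (extChartAt I p p) v = mvfderiv I v.1 p := by
  rw [coordDiff_apply, mfderiv_extChartAt_symm_self]
  rw [extChartAt_to_inv]
  rfl

theorem fderiv_coordDiff (p : M) (η : E) (v : V) :
    fderiv ℝ (coordDiff V p) (extChartAt I p p) η v =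
      fderiv ℝ (fderiv ℝ (fun y => v.1 ((extChartAt I p).symm y))) (extChartAt I p p) η := by
  have hmem := mem_extChartAt_target (I := I) p
  have hd : DifferentiableAt ℝ (coordDiff V p) (extChartAt I p p) :=
    ((contDiffOn_coordDiff p).contDiffAt ((isOpen_extChartAt_target p).mem_nhds hmem)
      ).differentiableAt (by simp)
  have h1 : fderiv ℝ (fun y => coordDiff V p y v) (extChartAt I p p) η =
      fderiv ℝ (coordDiff V p) (extChartAt I p p) η v := by
    have := (hd.hasFDerivAt.clm_apply (hasFDerivAt_const v (extChartAt I p p))).fderiv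
    rw [this]
    simp
  rw [← h1]
  have hev : (fun y => coordDiff V p y v) =ᶠ[nhds (extChartAt I p p)]
      fderiv ℝ (fun y => v.1 ((extChartAt I p).symm y)) :=
    Filter.eventually_of_mem ((isOpen_extChartAt_target p).mem_nhds hmem) fun y hy =>
      coordDiff_eq_fderiv p hy v
  rw [hev.fderiv_eq]

variable {ι : Type*} [Fintype ι] [DecidableEq ι]

/-- At a critical point the Christoffel terms are multiplied by a zero differential, so only the
second derivatives in the chart remain. -/
theorem hessian_apply_of_mem_critSpace (p : M) (f : ι → TangentSpace I p) {v : V}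
    (hv : v ∈ critSpace V p) (r s : ι) :
    hessian p f v.1 r s = fderiv ℝ (fderiv ℝ (fun y => v.1 ((extChartAt I p).symm y)))
      (extChartAt I p p) (f r) (f s) := by
  have h0 : mvfderiv I v.1 p = 0 := hv
  simp only [hessian, Matrix.of_apply, h0]
  rw [mfderiv_extChartAt_self]
  simp only [zero_apply, mul_zero, Finset.sum_const_zero, sub_zero]
  rfl

/-! ### Frames -/

theorem linearIndependent_frame {p : M} {f : ι → TangentSpace I p}
    (hf : IsOrthonormalFrame g p f) : LinearIndependent ℝ f := by
  rw [Fintype.linearIndependent_iff]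
  intro c hc i
  have h : g.inner p (f i) (∑ j, c j • f j) = c i := by
    rw [map_sum, Finset.sum_eq_single i]
    · rw [map_smul, hf.1, if_pos rfl, smul_eq_mul, mul_one]
    · intro j _ hj
      rw [map_smul, hf.1, if_neg hj.symm, smul_zero]
    · simp
  rw [hc, map_zero] at h
  exact h.symm

/-- An orthonormal frame as a basis of the model space. -/
def frameBasis {p : M} {f : ι → TangentSpace I p} (hf : IsOrthonormalFrame g p f) :
    Module.Basis ι ℝ E :=
  (Module.Basis.mk (linearIndependent_frame hf) hf.2.ge : Module.Basis ι ℝ (TangentSpace I p))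

theorem frameBasis_apply {p : M} {f : ι → TangentSpace I p} (hf : IsOrthonormalFrame g p f)
    (r : ι) : frameBasis hf r = f r := by
  exact Module.Basis.mk_apply (linearIndependent_frame hf) hf.2.ge r

theorem card_eq_finrank_of_frame {p : M} {f : ι → TangentSpace I p}
    (hf : IsOrthonormalFrame g p f) : Fintype.card ι = Module.finrank ℝ E :=
  (Module.finrank_eq_card_basis (frameBasis hf)).symm

theorem critSpace_eq_orthogonal {p : M} {f : ι → TangentSpace I p}
    (hf : IsOrthonormalFrame g p f) :
    critSpace V p = (Submodule.span ℝ (Set.range fun r => adjunctionDual V p (f r)))ᗮ := by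
  ext v
  rw [Submodule.mem_orthogonal, critSpace, LinearMap.mem_ker]
  constructor
  · intro h u hu
    induction hu using Submodule.span_induction with
    | mem u hu =>
      obtain ⟨r, rfl⟩ := hu
      rw [inner_adjunctionDual, h]
      rfl
    | zero => simp
    | add a b _ _ ha hb => rw [inner_add_left, ha, hb, add_zero]
    | smul c a _ ha => rw [inner_smul_left, ha, mul_zero]
  · intro h
    refine ContinuousLinearMap.coe_injective ((frameBasis hf).ext fun r => ?_)
    rw [frameBasis_apply]
    exact (inner_adjunctionDual V p (f r) v).symm.trans
      (h _ (Submodule.subset_span ⟨r, rfl⟩))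

theorem critSpace_orthogonal {p : M} {f : ι → TangentSpace I p}
    (hf : IsOrthonormalFrame g p f) :
    (critSpace V p)ᗮ = Submodule.span ℝ (Set.range fun r => adjunctionDual V p (f r)) := by
  rw [critSpace_eq_orthogonal hf, Submodule.orthogonal_orthogonal]

/-- Ampleness supplies `v` with `d_p v = g(X, ·)`, and then `(A_p^† X, v) = g(X, X) > 0`. -/
theorem adjunctionDual_ne_zero {p : M} (hV : Function.Surjective (adjunction V p))
    {X : TangentSpace I p} (hX : X ≠ 0) : adjunctionDual V p X ≠ 0 := by
  intro h0
  obtain ⟨v, hv⟩ := hV (g.inner p X)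
  have h1 := inner_adjunctionDual V p X v
  rw [h0, inner_zero_left, hv] at h1
  exact (g.pos p X hX).ne h1

theorem frame_ne_zero {p : M} {f : ι → TangentSpace I p}
    (hf : IsOrthonormalFrame g p f) (r : ι) : f r ≠ 0 := by
  intro h
  have := hf.1 r r
  rw [h] at this
  simp at this

/-- The orthonormal basis of `K_pᗮ` given by the normalized images of an orthonormal frame, when
these are mutually orthogonal. -/
def conormalBasis {p : M} {f : ι → TangentSpace I p} (hf : IsOrthonormalFrame g p f)
    (hV : Function.Surjective (adjunction V p))
    (ho : ∀ r s, r ≠ s → inner ℝ (adjunctionDual V p (f r)) (adjunctionDual V p (f s)) = 0) :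
    OrthonormalBasis ι ℝ (critSpace V p)ᗮ :=
  OrthonormalBasis.mk
    (v := fun r => (⟨‖adjunctionDual V p (f r)‖⁻¹ • adjunctionDual V p (f r),
      (critSpace_orthogonal hf).ge (Submodule.smul_mem _ _ (Submodule.subset_span ⟨r, rfl⟩))⟩ :
      (critSpace V p)ᗮ)) (by
    constructor
    · intro r
      rw [Submodule.coe_norm, norm_smul, norm_inv, norm_norm, inv_mul_cancel₀]
      exact norm_ne_zero_iff.2 (adjunctionDual_ne_zero hV (frame_ne_zero hf r))
    · intro r s hrs
      rw [Submodule.coe_inner, inner_smul_left, inner_smul_right, ho r s hrs]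
      simp) (by
    rintro ⟨u, hu⟩ -
    have hu' := (critSpace_orthogonal hf).le hu
    suffices h : u ∈ Submodule.map (critSpace V p)ᗮ.subtype (Submodule.span ℝ (Set.range fun r =>
        (⟨‖adjunctionDual V p (f r)‖⁻¹ • adjunctionDual V p (f r),
          (critSpace_orthogonal hf).ge (Submodule.smul_mem _ _ (Submodule.subset_span ⟨r, rfl⟩))⟩ :
          (critSpace V p)ᗮ))) by
      obtain ⟨u', hu2, rfl⟩ := h
      exact hu2
    rw [Submodule.map_span]
    refine Submodule.span_le.2 ?_ hu'
    rintro _ ⟨r, rfl⟩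
    have hr := norm_ne_zero_iff.2 (adjunctionDual_ne_zero hV (frame_ne_zero hf r))
    change adjunctionDual V p (f r) ∈ _
    rw [← one_smul ℝ (adjunctionDual V p (f r)), ← mul_inv_cancel₀ hr, mul_smul]
    exact Submodule.smul_mem _ _ (Submodule.subset_span ⟨_, ⟨r, rfl⟩, rfl⟩))

theorem conormalBasis_apply {p : M} {f : ι → TangentSpace I p} (hf : IsOrthonormalFrame g p f)
    (hV : Function.Surjective (adjunction V p))
    (ho : ∀ r s, r ≠ s → inner ℝ (adjunctionDual V p (f r)) (adjunctionDual V p (f s)) = 0)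
    (r : ι) : ((conormalBasis hf hV ho r : (critSpace V p)ᗮ) : V) =
      ‖adjunctionDual V p (f r)‖⁻¹ • adjunctionDual V p (f r) := by
  simp [conormalBasis]

end Coordinates

/-! ### The Kac–Rice formula near a point -/

/-- In the basis `b`, the matrix of `A` is the transpose of `N` with row `s` multiplied by `-1 / a
s`. -/
theorem abs_det_of_inner {C ι : Type*} [NormedAddCommGroup C] [InnerProductSpace ℝ C]
    [FiniteDimensional ℝ C] [Fintype ι] [DecidableEq ι] (b : OrthonormalBasis ι ℝ C)
    {A : C →L[ℝ] C} {a : ι → ℝ} {N : Matrix ι ι ℝ} (ha : ∀ s, 0 < a s)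
    (h : ∀ r s, a s * inner ℝ (b s) (A (b r)) = -N r s) :
    |A.det| = (∏ r, a r)⁻¹ * |N.det| := by
  have hmat : LinearMap.toMatrix b.toBasis b.toBasis (A : C →ₗ[ℝ] C) =
      Matrix.of fun s r => (-(a s)⁻¹) * N.transpose s r := by
    ext s r
    rw [LinearMap.toMatrix_apply, OrthonormalBasis.coe_toBasis,
      OrthonormalBasis.coe_toBasis_repr_apply, OrthonormalBasis.repr_apply_apply, Matrix.of_apply,
      Matrix.transpose_apply, neg_mul, ← mul_neg, ← h, inv_mul_cancel_left₀ (ha s).ne']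
    rfl
  rw [ContinuousLinearMap.det, ← LinearMap.det_toMatrix b.toBasis, hmat, Matrix.det_mul_column,
    Matrix.det_transpose, abs_mul, Finset.abs_prod, ← Finset.prod_inv_distrib]
  congr 1
  exact Finset.prod_congr rfl fun s _ => by rw [abs_neg, abs_of_pos (inv_pos.2 (ha s))]

section Local

variable {E : Type*} [NormedAddCommGroup E] [NormedSpace ℝ E] [FiniteDimensional ℝ E]
  [MeasurableSpace E] [BorelSpace E]
  {H : Type*} [TopologicalSpace H] {I : ModelWithCorners ℝ E H} [I.Boundaryless]
  {M : Type*} [TopologicalSpace M] [ChartedSpace H M] [IsManifold I ∞ M]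
  [T2Space M] [CompactSpace M] [MeasurableSpace M] [BorelSpace M]
  {g : RMetric I M} {V : Submodule ℝ (SmoothFun g)} [FiniteDimensional ℝ V]
  {ι : Type*} [Fintype ι] [DecidableEq ι] {p : M} {f : ι → TangentSpace I p}

/-- The expected number of critical points in `B`, with respect to the Gaussian weight
`exp (-|v|²)`. -/
def critMass (V : Submodule ℝ (SmoothFun g)) [FiniteDimensional ℝ V] (B : Set M) : ℝ≥0∞ :=
  ∫⁻ v : V, ENNReal.ofReal (Real.exp (-‖v‖ ^ 2)) * ((critSet v.1 ∩ B).encard : ℝ≥0∞)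

/-- The density of the expected number of critical points at `p`. -/
def critDensity (V : Submodule ℝ (SmoothFun g)) [FiniteDimensional ℝ V] (p : M)
    (f : ι → TangentSpace I p) : ℝ :=
  (∏ r, ‖adjunctionDual V p (f r)‖)⁻¹ *
    ∫ k : critSpace V p, Real.exp (-‖k‖ ^ 2) * |(hessian p f k.1.1).det|

/-- The isomorphism `K_pᗮ ≃ E` that maps the conormal basis to the frame. -/
def conormalEquiv (hf : IsOrthonormalFrame g p f) (hV : Function.Surjective (adjunction V p))
    (ho : ∀ r s, r ≠ s → inner ℝ (adjunctionDual V p (f r)) (adjunctionDual V p (f s)) = 0) :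
    (critSpace V p)ᗮ ≃L[ℝ] E :=
  ((conormalBasis hf hV ho).toBasis.equiv (frameBasis hf) (Equiv.refl ι)).toContinuousLinearEquiv

theorem conormalEquiv_apply (hf : IsOrthonormalFrame g p f)
    (hV : Function.Surjective (adjunction V p))
    (ho : ∀ r s, r ≠ s → inner ℝ (adjunctionDual V p (f r)) (adjunctionDual V p (f s)) = 0)
    (r : ι) : conormalEquiv hf hV ho (conormalBasis hf hV ho r) = f r := by
  have := (conormalBasis hf hV ho).toBasis.equiv_apply r (frameBasis hf) (Equiv.refl ι)
  rw [frameBasis_apply, OrthonormalBasis.coe_toBasis] at this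
  exact this

theorem map_conormalEquiv_volume (hf : IsOrthonormalFrame g p f)
    (hV : Function.Surjective (adjunction V p))
    (ho : ∀ r s, r ≠ s → inner ℝ (adjunctionDual V p (f r)) (adjunctionDual V p (f s)) = 0) :
    Measure.map (conormalEquiv hf hV ho) volume = (frameBasis hf).addHaar := by
  rw [← (conormalBasis hf hV ho).addHaar_eq_volume, Module.Basis.map_addHaar]
  congr 1
  ext r
  rw [Module.Basis.map_apply, OrthonormalBasis.coe_toBasis, frameBasis_apply]
  exact conormalEquiv_apply hf hV ho r

/-- The chart at `p`, read in the conormal space. -/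
def conormalPoint (hf : IsOrthonormalFrame g p f) (hV : Function.Surjective (adjunction V p))
    (ho : ∀ r s, r ≠ s → inner ℝ (adjunctionDual V p (f r)) (adjunctionDual V p (f s)) = 0)
    (t : (critSpace V p)ᗮ) : E := extChartAt I p p + conormalEquiv hf hV ho t

variable (hf : IsOrthonormalFrame g p f) (hV : Function.Surjective (adjunction V p))
  (ho : ∀ r s, r ≠ s → inner ℝ (adjunctionDual V p (f r)) (adjunctionDual V p (f s)) = 0)

theorem conormalPoint_zero : conormalPoint hf hV ho 0 = extChartAt I p p := by
  rw [conormalPoint, map_zero, add_zero]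

theorem contDiff_conormalPoint : ContDiff ℝ ∞ (conormalPoint hf hV ho) :=
  contDiff_const.add (conormalEquiv hf hV ho).contDiff

theorem hasFDerivAt_conormalPoint (t : (critSpace V p)ᗮ) : HasFDerivAt (conormalPoint hf hV ho)
    (conormalEquiv hf hV ho : (critSpace V p)ᗮ →L[ℝ] E) t :=
  (conormalEquiv hf hV ho).hasFDerivAt.const_add _

theorem injective_conormalPoint : Function.Injective (conormalPoint hf hV ho) := fun _ _ h =>
  (conormalEquiv hf hV ho).injective (add_left_cancel h)

theorem measurePreserving_conormalPoint :
    MeasurePreserving (conormalPoint hf hV ho) volume (frameBasis hf).addHaar := by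
  have h1 : MeasurePreserving (conormalEquiv hf hV ho) volume (frameBasis hf).addHaar :=
    ⟨(conormalEquiv hf hV ho).continuous.measurable, map_conormalEquiv_volume hf hV ho⟩
  exact (measurePreserving_add_left (frameBasis hf).addHaar (extChartAt I p p)).comp h1

theorem measurableEmbedding_conormalPoint : MeasurableEmbedding (conormalPoint hf hV ho) :=
  (measurableEmbedding_addLeft (extChartAt I p p)).comp
    (conormalEquiv hf hV ho).toHomeomorph.measurableEmbedding

/-- The differentials of the functions in `K_pᗮ`. -/
def conormalDiff (t : (critSpace V p)ᗮ) : (critSpace V p)ᗮ →L[ℝ] (E →L[ℝ] ℝ) :=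
  (coordDiff V p (conormalPoint hf hV ho t)).comp (critSpace V p)ᗮ.subtypeL

/-- The differentials of the functions in `K_p`. -/
def kernelDiff (t : (critSpace V p)ᗮ) : critSpace V p →L[ℝ] (E →L[ℝ] ℝ) :=
  (coordDiff V p (conormalPoint hf hV ho t)).comp (critSpace V p).subtypeL

/-- The points at which `K_pᗮ` remains a complement of the space of critical functions. -/
def conormalDomain : Set (critSpace V p)ᗮ :=
  {t | conormalPoint hf hV ho t ∈ (extChartAt I p).target ∧
    conormalDiff hf hV ho t ∈ Set.range
      ((↑) : ((critSpace V p)ᗮ ≃L[ℝ] (E →L[ℝ] ℝ)) → (critSpace V p)ᗮ →L[ℝ] (E →L[ℝ] ℝ))}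

/-- The family `σ` such that `k + c` is critical at `t` if and only if `c = σ t k`. -/
def critFamily (t : (critSpace V p)ᗮ) : critSpace V p →L[ℝ] (critSpace V p)ᗮ :=
  -((conormalDiff hf hV ho t).inverse.comp (kernelDiff hf hV ho t))

theorem contDiffOn_conormalDiff : ContDiffOn ℝ ∞ (conormalDiff hf hV ho)
    (conormalPoint hf hV ho ⁻¹' (extChartAt I p).target) :=
  (((contDiffOn_coordDiff p).comp (contDiff_conormalPoint hf hV ho).contDiffOn
    fun _ h => h)).clm_comp contDiffOn_const

theorem contDiffOn_kernelDiff : ContDiffOn ℝ ∞ (kernelDiff hf hV ho)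
    (conormalPoint hf hV ho ⁻¹' (extChartAt I p).target) :=
  (((contDiffOn_coordDiff p).comp (contDiff_conormalPoint hf hV ho).contDiffOn
    fun _ h => h)).clm_comp contDiffOn_const

theorem isOpen_preimage_target :
    IsOpen (conormalPoint hf hV ho ⁻¹' (extChartAt I p).target) :=
  (isOpen_extChartAt_target p).preimage (contDiff_conormalPoint hf hV ho).continuous

theorem isOpen_conormalDomain : IsOpen (conormalDomain hf hV ho) :=
  (contDiffOn_conormalDiff hf hV ho).continuousOn.isOpen_inter_preimage
    (isOpen_preimage_target hf hV ho) (ContinuousLinearEquiv.isOpen)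

theorem contDiffOn_critFamily : ContDiffOn ℝ 1 (critFamily hf hV ho) (conormalDomain hf hV ho) := by
  intro t ht
  have hnhds := (isOpen_preimage_target hf hV ho).mem_nhds ht.1
  obtain ⟨e, he⟩ := ht.2
  have h1 : ContDiffAt ℝ 1 (conormalDiff hf hV ho) t :=
    ((contDiffOn_conormalDiff hf hV ho).contDiffAt hnhds).of_le (by simp)
  have h2 : ContDiffAt ℝ 1 (kernelDiff hf hV ho) t :=
    ((contDiffOn_kernelDiff hf hV ho).contDiffAt hnhds).of_le (by simp)
  have h3 : ContDiffAt ℝ 1 ContinuousLinearMap.inverse (conormalDiff hf hV ho t) := by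
    rw [← he]
    exact contDiffAt_map_inverse e
  exact (((h3.comp t h1).clm_comp h2).neg).contDiffWithinAt

/-- The condition `d(k + c) = 0` is linear, and on the domain the part acting on `c` is invertible;
solving for `c` produces `critFamily`. -/
theorem critFamily_eq_iff {t : (critSpace V p)ᗮ} (ht : t ∈ conormalDomain hf hV ho)
    (k : critSpace V p) (c : (critSpace V p)ᗮ) :
    critFamily hf hV ho t k = c ↔
      (extChartAt I p).symm (conormalPoint hf hV ho t) ∈ critSet ((k : V) + c : V).1 := by
  rw [← coordDiff_eq_zero_iff p ht.1, map_add]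
  obtain ⟨e, he⟩ := ht.2
  have h1 : coordDiff V p (conormalPoint hf hV ho t) (c : V) = e c :=
    (DFunLike.congr_fun he c).symm
  have h2 : critFamily hf hV ho t k =
      -e.symm (coordDiff V p (conormalPoint hf hV ho t) (k : V)) := by
    rw [critFamily, ← he, ContinuousLinearMap.inverse_equiv]
    rfl
  rw [h1, h2]
  constructor
  · rintro rfl
    rw [map_neg, e.apply_symm_apply, add_neg_cancel]
  · intro h
    rw [eq_neg_of_add_eq_zero_left h, map_neg, e.symm_apply_apply, neg_neg]

theorem conormalDiff_zero_apply (c : (critSpace V p)ᗮ) (s : ι) :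
    conormalDiff hf hV ho 0 c (f s) = ‖adjunctionDual V p (f s)‖ *
      inner ℝ (conormalBasis hf hV ho s) c := by
  have h1 : conormalDiff hf hV ho 0 c = mvfderiv I (c : V).1 p := by
    change coordDiff V p (conormalPoint hf hV ho 0) (c : V) = _
    rw [conormalPoint_zero, coordDiff_self]
  rw [h1, Submodule.coe_inner, conormalBasis_apply, inner_smul_left]
  have h2 := inner_adjunctionDual V p (f s) (c : V)
  have hr := norm_ne_zero_iff.2 (adjunctionDual_ne_zero hV (frame_ne_zero hf s))
  rw [h2, ← mul_assoc]
  simp only [conj_trivial, mul_inv_cancel₀ hr, one_mul]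
  rfl

/-- The point `t = 0` corresponds to `p`, where the functions in `K_p` have zero differential by
definition. -/
theorem kernelDiff_zero : kernelDiff hf hV ho 0 = 0 := by
  ext1 k
  change coordDiff V p (conormalPoint hf hV ho 0) (k : V) = 0
  rw [conormalPoint_zero, coordDiff_self]
  exact k.2

theorem zero_mem_conormalDomain : (0 : (critSpace V p)ᗮ) ∈ conormalDomain hf hV ho := by
  refine ⟨?_, ?_⟩
  · rw [conormalPoint_zero]
    exact mem_extChartAt_target p
  · have hinj : Function.Injective (conormalDiff hf hV ho 0 : (critSpace V p)ᗮ →ₗ[ℝ] (E →L[ℝ] ℝ)) := by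
      rw [← LinearMap.ker_eq_bot, LinearMap.ker_eq_bot']
      intro c hc
      refine (conormalBasis hf hV ho).repr.map_eq_zero_iff.1 (PiLp.ext fun s => ?_)
      have h1 := conormalDiff_zero_apply hf hV ho c s
      have h2 : conormalDiff hf hV ho 0 c = 0 := hc
      have hr := norm_ne_zero_iff.2 (adjunctionDual_ne_zero hV (frame_ne_zero hf s))
      rw [h2] at h1
      rw [OrthonormalBasis.repr_apply_apply]
      exact (mul_eq_zero.1 h1.symm).resolve_left hr
    have hfin : Module.finrank ℝ (critSpace V p)ᗮ = Module.finrank ℝ (E →L[ℝ] ℝ) := by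
      rw [(conormalEquiv hf hV ho).toLinearEquiv.finrank_eq,
        ← (LinearMap.toContinuousLinearMap (𝕜 := ℝ) (E := E) (F' := ℝ)).finrank_eq]
      exact (Subspace.dual_finrank_eq (K := ℝ) (V := E)).symm
    exact ⟨(LinearEquiv.ofInjectiveOfFinrankEq _ hinj hfin).toContinuousLinearEquiv, by ext; rfl⟩

/-- In the product rule for `-(conormalDiff)⁻¹ ∘ kernelDiff` the derivative of the inverse is
multiplied by `kernelDiff` at `0`, which is zero. What remains is the derivative of the differential
of `k`, that is, its second derivative in the chart at `p`. -/
theorem fderiv_critFamily_zero (τ : (critSpace V p)ᗮ) (k : critSpace V p) (s : ι) :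
    ‖adjunctionDual V p (f s)‖ *
      inner ℝ (conormalBasis hf hV ho s) (fderiv ℝ (critFamily hf hV ho) 0 τ k) =
    -fderiv ℝ (fderiv ℝ (fun y => k.1.1 ((extChartAt I p).symm y))) (extChartAt I p p)
      (conormalEquiv hf hV ho τ) (f s) := by
  have h0 := zero_mem_conormalDomain hf hV ho
  have hnhds := (isOpen_preimage_target hf hV ho).mem_nhds h0.1
  obtain ⟨e, he⟩ := h0.2
  have h1 : ContDiffAt ℝ 1 (conormalDiff hf hV ho) 0 :=
    ((contDiffOn_conormalDiff hf hV ho).contDiffAt hnhds).of_le (by simp)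
  have h3 : ContDiffAt ℝ 1 ContinuousLinearMap.inverse (conormalDiff hf hV ho 0) := by
    rw [← he]
    exact contDiffAt_map_inverse e
  have h4 : DifferentiableAt ℝ (fun t => (conormalDiff hf hV ho t).inverse) 0 :=
    (h3.comp 0 h1).differentiableAt (by simp)
  have h5 : HasFDerivAt (coordDiff V p) (fderiv ℝ (coordDiff V p) (extChartAt I p p))
      (conormalPoint hf hV ho 0) := by
    rw [conormalPoint_zero]
    exact (((contDiffOn_coordDiff p).contDiffAt ((isOpen_extChartAt_target p).mem_nhds
      (mem_extChartAt_target p))).differentiableAt (by simp)).hasFDerivAt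
  have h6 := h5.comp (0 : (critSpace V p)ᗮ) (hasFDerivAt_conormalPoint hf hV ho 0)
  have h7 : HasFDerivAt (kernelDiff hf hV ho) _ 0 :=
    h6.clm_comp (hasFDerivAt_const (critSpace V p).subtypeL (0 : (critSpace V p)ᗮ))
  have h8 : HasFDerivAt (critFamily hf hV ho) _ 0 := (h4.hasFDerivAt.clm_comp h7).neg
  have h9 : fderiv ℝ (critFamily hf hV ho) 0 τ k =
      -e.symm (fderiv ℝ (coordDiff V p) (extChartAt I p p) (conormalEquiv hf hV ho τ) (k : V)) := by
    rw [HasFDerivAt.fderiv h8]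
    simp [kernelDiff_zero, ← he]
  have h10 := conormalDiff_zero_apply hf hV ho (fderiv ℝ (critFamily hf hV ho) 0 τ k) s
  rw [← h10, h9, ← he, ← fderiv_coordDiff, ContinuousLinearEquiv.coe_coe, map_neg,
    e.apply_symm_apply]
  rfl

theorem abs_det_fderiv_critFamily_zero (k : critSpace V p) :
    |((fderiv ℝ (critFamily hf hV ho) 0).flip k).det| =
      (∏ r, ‖adjunctionDual V p (f r)‖)⁻¹ * |(hessian p f k.1.1).det| := by
  refine abs_det_of_inner (conormalBasis hf hV ho) (fun s =>
    norm_pos_iff.2 (adjunctionDual_ne_zero hV (frame_ne_zero hf s))) fun r s => ?_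
  have h := fderiv_critFamily_zero hf hV ho (conormalBasis hf hV ho r) k s
  rw [conormalEquiv_apply] at h
  rw [hessian_apply_of_mem_critSpace p f k.2]
  exact h

/-- Since `critFamily` vanishes at `0`, the Gaussian weight reduces to `exp (-‖k‖²)`, and its
Jacobian is the determinant of the Hessian divided by the lengths of the `A_p^† f_r`. -/
theorem familyDensity_zero :
    familyDensity (C := (critSpace V p)ᗮ) (K := critSpace V p) (critFamily hf hV ho) 0 =
      critDensity V p f := by
  have h0 : critFamily hf hV ho 0 = 0 := by
    rw [critFamily, kernelDiff_zero]
    simp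
  unfold familyDensity critDensity
  rw [← integral_const_mul]
  refine integral_congr_ae (Filter.Eventually.of_forall fun k => ?_)
  simp only [h0, abs_det_fderiv_critFamily_zero hf hV ho]
  simp
  ring

end Local

/-! ### Gaussian counts on an orthogonally split space -/

section SplitFamily

variable {V : Type*} [NormedAddCommGroup V] [InnerProductSpace ℝ V] [FiniteDimensional ℝ V]
  [MeasurableSpace V] [BorelSpace V]

/-- The Gaussian count of the zeros of a family, on a Euclidean space split as `K ⊕ Kᗮ`. -/
theorem lintegral_encard_splitFamily (K : Submodule ℝ V) {σ : Kᗮ → K →L[ℝ] Kᗮ} {D B : Set Kᗮ}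
    (hD : IsOpen D) (hσ : ContDiffOn ℝ 1 σ D) (hB : MeasurableSet B) (hBD : B ⊆ D)
    {N : V → ℝ≥0∞} (hN : ∀ (k : K) (c : Kᗮ), N ((k : V) + c) = ({t ∈ B | σ t k = c}).encard) :
    AEMeasurable N ∧ ∫⁻ v, ENNReal.ofReal (Real.exp (-‖v‖ ^ 2)) * N v =
      ∫⁻ t in B, ENNReal.ofReal (familyDensity σ t) := by
  have h1 := aemeasurable_encard_family hD hσ hB hBD
  have hswap : MeasurePreserving (Prod.swap : K × Kᗮ → Kᗮ × K) := Measure.measurePreserving_swap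
  have h2 : AEMeasurable (fun z : K × Kᗮ => N ((z.1 : V) + z.2)) := by
    refine (h1.comp_quasiMeasurePreserving hswap.quasiMeasurePreserving).congr
      (Filter.Eventually.of_forall fun z => ?_)
    exact (hN z.1 z.2).symm
  refine ⟨?_, ?_⟩
  · have h3 := (measurePreserving_orthogonalSum K).symm
    refine (h2.comp_quasiMeasurePreserving h3.quasiMeasurePreserving).congr
      (Filter.Eventually.of_forall fun v => ?_)
    exact congrArg N ((orthogonalSum K).apply_symm_apply v)
  · rw [lintegral_orthogonalSum K, ← lintegral_encard_family hD hσ hB hBD,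
      ← hswap.lintegral_comp_emb MeasurableEquiv.prodComm.measurableEmbedding]
    refine lintegral_congr fun z => ?_
    rw [hN, norm_sq_orthogonal_add, add_comm]
    rfl

/-- Near `t₀` the ratio `h / δ` is within `ε` of `h t₀`, because `δ t₀ = 1`. Both bounds are written
without quotients, and the lower one without subtraction, so that they integrate directly in `ℝ≥0∞`.
-/
theorem exists_isOpen_ratio {C : Type*} [TopologicalSpace C] {h δ : C → ℝ} {D : Set C} {t₀ : C}
    (hD : IsOpen D) (ht₀ : t₀ ∈ D) (hh : ContinuousOn h D) (hδ : ContinuousOn δ D)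
    (hδ₀ : δ t₀ = 1) {ε : ℝ} (hε : 0 < ε) :
    ∃ D' ⊆ D, IsOpen D' ∧ t₀ ∈ D' ∧ ∀ t ∈ D', h t ≤ (h t₀ + ε) * δ t ∧
      h t₀ * δ t ≤ h t + ε * δ t := by
  have h1 : ∀ᶠ t in nhds t₀, h t < (h t₀ + ε) * δ t := by
    refine (hh.continuousAt (hD.mem_nhds ht₀)).eventually_lt
      ((hδ.continuousAt (hD.mem_nhds ht₀)).const_mul _) ?_
    rw [hδ₀]
    linarith
  have h2 : ∀ᶠ t in nhds t₀, h t₀ * δ t < h t + ε * δ t := by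
    refine ((hδ.continuousAt (hD.mem_nhds ht₀)).const_mul _).eventually_lt
      ((hh.continuousAt (hD.mem_nhds ht₀)).add
      ((hδ.continuousAt (hD.mem_nhds ht₀)).const_mul _)) ?_
    rw [hδ₀]
    linarith
  obtain ⟨D', hD', hDo, htD⟩ := eventually_nhds_iff.1 ((h1.and h2).and (hD.mem_nhds ht₀))
  exact ⟨D', fun t ht => (hD' t ht).2, hDo, htD, fun t ht =>
    ⟨(hD' t ht).1.1.le, (hD' t ht).1.2.le⟩⟩

end SplitFamily

/-! ### Critical points against volume near a point -/

section Local

variable {E : Type*} [NormedAddCommGroup E] [NormedSpace ℝ E] [FiniteDimensional ℝ E]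
  [MeasurableSpace E] [BorelSpace E]
  {H : Type*} [TopologicalSpace H] {I : ModelWithCorners ℝ E H} [I.Boundaryless]
  {M : Type*} [TopologicalSpace M] [ChartedSpace H M] [IsManifold I ∞ M]
  [T2Space M] [CompactSpace M] [MeasurableSpace M] [BorelSpace M]
  {g : RMetric I M} {V : Submodule ℝ (SmoothFun g)} [FiniteDimensional ℝ V]
  {ι : Type*} [Fintype ι] [DecidableEq ι] {p : M} {f : ι → TangentSpace I p}
  (hf : IsOrthonormalFrame g p f) (hV : Function.Surjective (adjunction V p))
  (ho : ∀ r s, r ≠ s → inner ℝ (adjunctionDual V p (f r)) (adjunctionDual V p (f s)) = 0)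

/-- The inverse of the chart at `p`, read in the conormal space. -/
def conormalParam (t : (critSpace V p)ᗮ) : M := (extChartAt I p).symm (conormalPoint hf hV ho t)

theorem injOn_conormalParam : Set.InjOn (conormalParam hf hV ho) (conormalDomain hf hV ho) :=
  fun _ ht _ hs h => injective_conormalPoint hf hV ho ((extChartAt I p).symm.injOn ht.1 hs.1 h)

theorem continuousOn_conormalParam :
    ContinuousOn (conormalParam hf hV ho) (conormalDomain hf hV ho) :=
  (continuousOn_extChartAt_symm p).comp (contDiff_conormalPoint hf hV ho).continuous.continuousOn
    fun _ ht => ht.1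

/-- The density of the Riemannian volume in the conormal chart. -/
def conormalDensity (t : (critSpace V p)ᗮ) : ℝ :=
  Real.sqrt (gramMatrix (coordMetric g p (conormalPoint hf hV ho t)) (frameBasis hf)).det

theorem continuousOn_conormalDensity :
    ContinuousOn (conormalDensity hf hV ho) (conormalDomain hf hV ho) := by
  refine Real.continuous_sqrt.comp_continuousOn ?_
  simp only [Matrix.det_apply]
  refine continuousOn_finsetSum _ fun σ _ => ContinuousOn.const_smul ?_ _
  refine continuousOn_finsetProd _ fun i _ => ?_
  exact (continuousOn_coordMetric g p _ _).comp
    (contDiff_conormalPoint hf hV ho).continuous.continuousOn fun _ ht => ht.1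

theorem coordMetric_self (g : RMetric I M) (p : M) (u w : E) :
    coordMetric g p (extChartAt I p p) u w = g.inner p u w := by
  rw [coordMetric_apply, mfderiv_extChartAt_symm_self]
  exact inner_congr g (extChartAt_to_inv p) u w

/-- At the base point the Gram matrix of the metric in an orthonormal frame is the identity. This
normalization makes the density relative to Lebesgue measure on `K_pᗮ` also the density relative to
the Riemannian volume at `p`. -/
theorem conormalDensity_zero : conormalDensity hf hV ho 0 = 1 := by
  have h : gramMatrix (coordMetric g p (conormalPoint hf hV ho 0)) (frameBasis hf) = 1 := by
    ext r s
    change coordMetric g p (conormalPoint hf hV ho 0) (frameBasis hf r) (frameBasis hf s) = _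
    rw [conormalPoint_zero, coordMetric_self, frameBasis_apply, frameBasis_apply, Matrix.one_apply]
    exact hf.1 r s
  rw [conormalDensity, h, Matrix.det_one, Real.sqrt_one]

theorem measurableSet_conormal {D : Set (critSpace V p)ᗮ} (hD : IsOpen D)
    (hDD : D ⊆ conormalDomain hf hV ho) {B : Set M} (hB : MeasurableSet B) :
    MeasurableSet (D ∩ conormalParam hf hV ho ⁻¹' B) :=
  measurableSet_inter_preimage_of_continuousOn ((continuousOn_conormalParam hf hV ho).mono hDD)
    hD.measurableSet hB

/-- The chart volume may be computed in the basis given by the frame, and the Haar measure of that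
basis corresponds to Lebesgue measure on `K_pᗮ`, since the identification takes an orthonormal basis
to the frame. -/
theorem riemVolume_conormal {D : Set (critSpace V p)ᗮ}
    (hDD : D ⊆ conormalDomain hf hV ho) {B : Set M} (hB : MeasurableSet B)
    (hBD : B ⊆ conormalParam hf hV ho '' D) :
    riemVolume g B = ∫⁻ t in D ∩ conormalParam hf hV ho ⁻¹' B,
      ENNReal.ofReal (conormalDensity hf hV ho t) := by
  have hsrc : B ⊆ (extChartAt I p).source := by
    intro x hx
    obtain ⟨t, ht, rfl⟩ := hBD hx
    exact (extChartAt I p).map_target (hDD ht).1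
  rw [riemVolume_eq_chartVolume g p hB hsrc, chartVolume_apply g p hB]
  have h1 := lintegral_sqrt_gram (frameBasis hf) (Module.finBasis ℝ E) (coordMetric g p)
    ((extChartAt I p).target ∩ (extChartAt I p).symm ⁻¹' B) 1
  simp only [Pi.one_apply, mul_one] at h1
  refine h1.trans ?_
  rw [← (measurePreserving_conormalPoint hf hV ho).setLIntegral_comp_preimage_emb
    (measurableEmbedding_conormalPoint hf hV ho)]
  have hset : conormalPoint hf hV ho ⁻¹'
      ((extChartAt I p).target ∩ (extChartAt I p).symm ⁻¹' B) =
      D ∩ conormalParam hf hV ho ⁻¹' B := by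
    ext t
    constructor
    · rintro ⟨ht, htB⟩
      obtain ⟨t', ht', htt'⟩ := hBD htB
      have h2 := injective_conormalPoint hf hV ho
        ((extChartAt I p).symm.injOn (hDD ht').1 ht htt')
      exact ⟨h2 ▸ ht', htB⟩
    · rintro ⟨ht, htB⟩
      exact ⟨(hDD ht).1, htB⟩
  rw [hset]
  rfl

theorem encard_critSet_conormal {D : Set (critSpace V p)ᗮ}
    (hDD : D ⊆ conormalDomain hf hV ho) {B : Set M}
    (hBD : B ⊆ conormalParam hf hV ho '' D) (k : critSpace V p) (c : (critSpace V p)ᗮ) :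
    (critSet ((k : V) + c : V).1 ∩ B).encard =
      ({t ∈ D ∩ conormalParam hf hV ho ⁻¹' B | critFamily hf hV ho t k = c}).encard := by
  have : critSet ((k : V) + c : V).1 ∩ B = conormalParam hf hV ho ''
      {t ∈ D ∩ conormalParam hf hV ho ⁻¹' B | critFamily hf hV ho t k = c} := by
    ext x
    constructor
    · rintro ⟨hx, hxB⟩
      obtain ⟨t, ht, rfl⟩ := hBD hxB
      exact ⟨t, ⟨⟨ht, hxB⟩, (critFamily_eq_iff hf hV ho (hDD ht) k c).2 hx⟩, rfl⟩
    · rintro ⟨t, ⟨⟨ht, hxB⟩, h⟩, rfl⟩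
      exact ⟨(critFamily_eq_iff hf hV ho (hDD ht) k c).1 h, hxB⟩
  rw [this, Set.InjOn.encard_image]
  exact (injOn_conormalParam hf hV ho).mono fun t ht => hDD ht.1.1

theorem isOpen_image_conormalParam {D : Set (critSpace V p)ᗮ} (hD : IsOpen D)
    (hDD : D ⊆ conormalDomain hf hV ho) : IsOpen (conormalParam hf hV ho '' D) := by
  have h : conormalParam hf hV ho '' D = (extChartAt I p).source ∩ extChartAt I p ⁻¹'
      ((fun y => (conormalEquiv hf hV ho).symm (y - extChartAt I p p)) ⁻¹' D) := by
    ext x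
    constructor
    · rintro ⟨t, ht, rfl⟩
      refine ⟨(extChartAt I p).map_target (hDD ht).1, ?_⟩
      rw [Set.mem_preimage, Set.mem_preimage, conormalParam, (extChartAt I p).right_inv (hDD ht).1,
        conormalPoint, add_sub_cancel_left, ContinuousLinearEquiv.symm_apply_apply]
      exact ht
    · rintro ⟨hx, hxD⟩
      refine ⟨_, hxD, ?_⟩
      rw [conormalParam, conormalPoint, ContinuousLinearEquiv.apply_symm_apply,
        add_sub_cancel, (extChartAt I p).left_inv hx]
  rw [h]
  refine (continuousOn_extChartAt p).isOpen_inter_preimage (isOpen_extChartAt_source p)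
    (hD.preimage ?_)
  fun_prop

/-- Near `p`, the expected number of critical points is comparable to the volume. -/
theorem exists_critMass_estimate (hf : IsOrthonormalFrame g p f)
    (hV : Function.Surjective (adjunction V p))
    (ho : ∀ r s, r ≠ s → inner ℝ (adjunctionDual V p (f r)) (adjunctionDual V p (f s)) = 0)
    {ε : ℝ} (hε : 0 < ε) :
    ∃ W : Set M, IsOpen W ∧ p ∈ W ∧ ∀ B ⊆ W, MeasurableSet B →
      AEMeasurable (fun v : V => ((critSet v.1 ∩ B).encard : ℝ≥0∞)) ∧
      critMass V B ≤ ENNReal.ofReal (critDensity V p f + ε) * riemVolume g B ∧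
      ENNReal.ofReal (critDensity V p f) * riemVolume g B ≤
        critMass V B + ENNReal.ofReal ε * riemVolume g B := by
  have hDo := isOpen_conormalDomain hf hV ho
  have hσ := contDiffOn_critFamily hf hV ho
  -- Shrinking to `D` makes the pointwise comparison of the two densities uniform; its integral over
  -- any measurable subset is the estimate wanted.
  obtain ⟨D, hDD, hD, h0, hest⟩ := exists_isOpen_ratio hDo (zero_mem_conormalDomain hf hV ho)
    (continuousOn_familyDensity hDo hσ) (continuousOn_conormalDensity hf hV ho)
    (conormalDensity_zero hf hV ho) hε
  rw [familyDensity_zero hf hV ho] at hest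
  have hc0 : 0 ≤ critDensity V p f :=
    mul_nonneg (inv_nonneg.2 (Finset.prod_nonneg fun _ _ => norm_nonneg _))
      (integral_nonneg fun _ => by positivity)
  have hδ : ∀ t, 0 ≤ conormalDensity hf hV ho t := fun t => Real.sqrt_nonneg _
  refine ⟨conormalParam hf hV ho '' D, isOpen_image_conormalParam hf hV ho hD hDD,
    ⟨0, h0, ?_⟩, fun B hBD hB => ?_⟩
  · rw [conormalParam, conormalPoint_zero, extChartAt_to_inv]
  have hm := measurableSet_conormal hf hV ho hD hDD hB
  obtain ⟨hN, hmass⟩ := lintegral_encard_splitFamily (critSpace V p) hD (hσ.mono hDD) hm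
    Set.inter_subset_left (N := fun v : V => ((critSet v.1 ∩ B).encard : ℝ≥0∞))
    fun k c => by rw [encard_critSet_conormal hf hV ho hDD hBD]
  have hvol := riemVolume_conormal hf hV ho hDD hB hBD
  have hmδ : AEMeasurable (fun t => ENNReal.ofReal (conormalDensity hf hV ho t))
      (volume.restrict (D ∩ conormalParam hf hV ho ⁻¹' B)) :=
    (((continuousOn_conormalDensity hf hV ho).mono
      (Set.inter_subset_left.trans hDD)).aemeasurable hm).ennreal_ofReal
  refine ⟨hN, ?_, ?_⟩
  · rw [critMass, hmass, hvol, ← lintegral_const_mul' _ _ ENNReal.ofReal_ne_top]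
    refine setLIntegral_mono' hm fun t ht => ?_
    rw [← ENNReal.ofReal_mul (by linarith)]
    exact ENNReal.ofReal_le_ofReal (hest t ht.1).1
  · rw [critMass, hmass, hvol, ← lintegral_const_mul' _ _ ENNReal.ofReal_ne_top,
      ← lintegral_const_mul' _ _ ENNReal.ofReal_ne_top, ← lintegral_add_right' _ (hmδ.const_mul _)]
    refine setLIntegral_mono' hm fun t ht => ?_
    rw [← ENNReal.ofReal_mul hc0, ← ENNReal.ofReal_mul hε.le]
    refine (ENNReal.ofReal_le_ofReal (hest t ht.1).2).trans ENNReal.ofReal_add_le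

end Local

/-! ### Symmetries -/

section Symmetry

variable {E : Type*} [NormedAddCommGroup E] [NormedSpace ℝ E] [FiniteDimensional ℝ E]
  [MeasurableSpace E] [BorelSpace E]
  {H : Type*} [TopologicalSpace H] {I : ModelWithCorners ℝ E H} [I.Boundaryless]
  {M : Type*} [TopologicalSpace M] [ChartedSpace H M] [IsManifold I ∞ M]
  [T2Space M] [CompactSpace M] [MeasurableSpace M] [BorelSpace M]
  {g : RMetric I M} {V : Submodule ℝ (SmoothFun g)}

/-- The diffeomorphism given by an element of a group that acts smoothly. -/
def smulDiffeomorph {EG : Type*} [NormedAddCommGroup EG] [NormedSpace ℝ EG]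
    {HG : Type*} [TopologicalSpace HG] {IG : ModelWithCorners ℝ EG HG}
    {G : Type*} [Group G] [TopologicalSpace G] [ChartedSpace HG G] [MulAction G M]
    (h : ContMDiff (IG.prod I) I ∞ fun q : G × M => q.1 • q.2) (a : G) : M ≃ₘ⟮I, I⟯ M where
  toEquiv := MulAction.toPerm a
  contMDiff_toFun := h.comp (contMDiff_const.prodMk contMDiff_id)
  contMDiff_invFun := h.comp (contMDiff_const.prodMk contMDiff_id)

/-- A linear isometry of `V` is the pullback by a diffeomorphism. -/
def IsPullback (φ : M ≃ₘ⟮I, I⟯ M) (T : V ≃ₗᵢ[ℝ] V) : Prop :=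
  ∀ (v : V) (x : M), (T v).1 x = v.1 (φ x)

/-- A pullback is determined by its values, so choosing one for each `v` gives a linear map
automatically. It preserves inner products, hence is injective, and is onto because `V` is finite
dimensional. -/
theorem exists_isPullback [FiniteDimensional ℝ V] {φ : M ≃ₘ⟮I, I⟯ M}
    (hmem : ∀ v ∈ V, ∃ u ∈ V, ∀ x, u x = v (φ x))
    (hinner : ∀ v ∈ V, ∀ v' ∈ V, ∀ u ∈ V, ∀ u' ∈ V,
      (∀ x, u x = v (φ x)) → (∀ x, u' x = v' (φ x)) → inner ℝ u u' = inner ℝ v v') :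
    ∃ T : V ≃ₗᵢ[ℝ] V, IsPullback φ T := by
  choose! P hP hPx using hmem
  let T₀ : V →ₗ[ℝ] V :=
    { toFun := fun v => ⟨P v.1, hP _ v.2⟩
      map_add' := fun u v => Subtype.ext <| SmoothFun.ext fun x => by
        change P (u + v : V).1 x = P u.1 x + P v.1 x
        rw [hPx _ (u + v).2, hPx _ u.2, hPx _ v.2]
        rfl
      map_smul' := fun c v => Subtype.ext <| SmoothFun.ext fun x => by
        change P (c • v : V).1 x = c * P v.1 x
        rw [hPx _ (c • v).2, hPx _ v.2]
        rfl }
  let T₁ : V →ₗᵢ[ℝ] V := T₀.isometryOfInner fun u v =>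
    hinner u.1 u.2 v.1 v.2 _ (hP _ u.2) _ (hP _ v.2) (hPx _ u.2) (hPx _ v.2)
  exact ⟨T₁.toLinearIsometryEquiv rfl, fun v x => hPx _ v.2 x⟩

/-- In a homogeneous triple any two points are related by an isometry that preserves `V`. -/
theorem IsHomogeneousTriple.exists_symmetry [FiniteDimensional ℝ V]
    (hV : IsHomogeneousTriple g V) (x y : M) :
    ∃ (φ : M ≃ₘ⟮I, I⟯ M) (T : V ≃ₗᵢ[ℝ] V), φ x = y ∧ IsIsometric g φ ∧ IsPullback φ T := by
  obtain ⟨-, EG, _, _, _, HG, _, IG, _, G, _, _, _, _, _, _, _, h⟩ := hV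
  obtain ⟨a, ha⟩ := h.transitive x y
  obtain ⟨T, hT⟩ := exists_isPullback (φ := smulDiffeomorph h.smooth a)
    (h.pullback_mem a) (h.pullback_inner a)
  exact ⟨smulDiffeomorph h.smooth a, T, ha, h.isometric a, hT⟩

theorem mem_critSet_of_comp {u v : SmoothFun g} {φ : M ≃ₘ⟮I, I⟯ M} (h : ∀ x, u x = v (φ x)) {x : M}
    (hx : φ x ∈ critSet v) : x ∈ critSet u := by
  have hx' : mvfderiv I v (φ x) = 0 := hx
  have hu : (u : M → ℝ) = v ∘ φ := funext h
  change mvfderiv I u x = 0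
  rw [hu, mvfderiv_comp x (v.contMDiff.mdifferentiable (by simp) _)
    ((φ.contMDiff x).mdifferentiableAt (by simp)), hx']
  rfl

variable {φ : M ≃ₘ⟮I, I⟯ M} {T : V ≃ₗᵢ[ℝ] V}

theorem IsPullback.critSet_eq (hT : IsPullback φ T) (v : V) :
    critSet (T v).1 = φ ⁻¹' critSet v.1 := by
  ext x
  constructor
  · intro hx
    refine mem_critSet_of_comp (u := v.1) (v := (T v).1) (φ := φ.symm) (fun y => ?_) ?_
    · rw [hT, φ.apply_symm_apply]
    · rwa [φ.symm_apply_apply]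
  · exact fun hx => mem_critSet_of_comp (hT v) hx

theorem IsPullback.encard_critSet (hT : IsPullback φ T) (v : V) (B : Set M) :
    (critSet (T v).1 ∩ φ ⁻¹' B).encard = (critSet v.1 ∩ B).encard := by
  rw [hT.critSet_eq, ← Set.preimage_inter]
  exact Set.encard_preimage_of_bijective φ.bijective _

variable [FiniteDimensional ℝ V]

theorem IsPullback.critMass_eq (hT : IsPullback φ T) (B : Set M) :
    critMass V (φ ⁻¹' B) = critMass V B := by
  rw [critMass, critMass, ← T.measurePreserving.lintegral_comp_emb
    T.toHomeomorph.measurableEmbedding]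
  refine lintegral_congr fun v => ?_
  rw [hT.encard_critSet, T.norm_map]

theorem IsPullback.aemeasurable (hT : IsPullback φ T) {B : Set M}
    (h : AEMeasurable (fun v : V => ((critSet v.1 ∩ φ ⁻¹' B).encard : ℝ≥0∞))) :
    AEMeasurable (fun v : V => ((critSet v.1 ∩ B).encard : ℝ≥0∞)) := by
  refine (h.comp_quasiMeasurePreserving T.measurePreserving.quasiMeasurePreserving).congr
    (Filter.Eventually.of_forall fun v => ?_)
  change ((critSet (T v).1 ∩ φ ⁻¹' B).encard : ℝ≥0∞) = _
  rw [hT.encard_critSet]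

variable [SecondCountableTopology M] {ι : Type*} [Fintype ι] [DecidableEq ι] {p : M}
  {f : ι → TangentSpace I p}

/-- Each point `x` has a symmetry taking it to `p`, so the preimages of the good neighbourhood of
`p` cover `M`. On each piece of a countable partition subordinate to them, the count and the volume
can be moved into that neighbourhood without change. The constant is the one at `p` throughout, so
the estimates can be summed. -/
theorem critMass_estimate (hV : IsHomogeneousTriple g V) (hf : IsOrthonormalFrame g p f)
    (ho : ∀ r s, r ≠ s → inner ℝ (adjunctionDual V p (f r)) (adjunctionDual V p (f s)) = 0)
    {ε : ℝ} (hε : 0 < ε) :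
    AEMeasurable (fun v : V => ((critSet v.1).encard : ℝ≥0∞)) ∧
      critMass V Set.univ ≤ ENNReal.ofReal (critDensity V p f + ε) * riemVolume g Set.univ ∧
      ENNReal.ofReal (critDensity V p f) * riemVolume g Set.univ ≤
        critMass V Set.univ + ENNReal.ofReal ε * riemVolume g Set.univ := by
  obtain ⟨W, hWo, hpW, hW⟩ := exists_critMass_estimate hf (hV.1 p) ho hε
  choose φ T hφp hφ hT using fun x : M => hV.exists_symmetry x p
  obtain ⟨B, hBm, hBd, hBU, hB⟩ := exists_partition_subset (U := fun x => φ x ⁻¹' W)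
    (fun x => hWo.preimage (φ x).continuous) fun x => by
      rw [Set.mem_preimage, hφp]; exact hpW
  have hloc : ∀ n, AEMeasurable (fun v : V => ((critSet v.1 ∩ B n).encard : ℝ≥0∞)) ∧
      critMass V (B n) ≤ ENNReal.ofReal (critDensity V p f + ε) * riemVolume g (B n) ∧
      ENNReal.ofReal (critDensity V p f) * riemVolume g (B n) ≤
        critMass V (B n) + ENNReal.ofReal ε * riemVolume g (B n) := by
    intro n
    rcases hB n with h0 | ⟨x, hx⟩
    · rw [h0]
      simp [critMass]
    · have hpre : B n = φ x ⁻¹' ((φ x).symm ⁻¹' B n) := by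
        ext z; simp
      have hm : MeasurableSet ((φ x).symm ⁻¹' B n) := (φ x).symm.continuous.measurable (hBm n)
      have hsub : (φ x).symm ⁻¹' B n ⊆ W := fun z hz => by
        have := hx hz
        simpa using this
      obtain ⟨h1, h2, h3⟩ := hW _ hsub hm
      have hvol : riemVolume g (B n) = riemVolume g ((φ x).symm ⁻¹' B n) := by
        conv_lhs => rw [hpre]
        exact (measurePreserving_isometric (hφ x)).measure_preimage hm.nullMeasurableSet
      have hmass : critMass V (B n) = critMass V ((φ x).symm ⁻¹' B n) := by
        conv_lhs => rw [hpre]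
        exact (hT x).critMass_eq _
      rw [hvol, hmass]
      refine ⟨?_, h2, h3⟩
      -- Measurability is known for the moved piece; the inverse symmetry carries it back to `B n`.
      have h4 : IsPullback (φ x).symm (T x).symm := fun v z => by
        have := hT x ((T x).symm v) ((φ x).symm z)
        rw [(T x).apply_symm_apply, (φ x).apply_symm_apply] at this
        exact this.symm
      exact h4.aemeasurable h1
  have hN : ∀ v : V, ((critSet v.1).encard : ℝ≥0∞) =
      ∑' n, ((critSet v.1 ∩ B n).encard : ℝ≥0∞) := by
    intro v
    rw [← coe_encard_iUnion, ← Set.inter_iUnion, hBU, Set.inter_univ]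
    exact fun i j hij => (hBd hij).mono Set.inter_subset_right Set.inter_subset_right
  have hmass : critMass V Set.univ = ∑' n, critMass V (B n) := by
    have hw : Measurable fun v : V => ENNReal.ofReal (Real.exp (-‖v‖ ^ 2)) := by fun_prop
    simp only [critMass, Set.inter_univ, hN, ← ENNReal.tsum_mul_left]
    exact lintegral_tsum fun n => hw.aemeasurable.mul (hloc n).1
  have hvol : riemVolume g Set.univ = ∑' n, riemVolume g (B n) := by
    rw [← hBU, measure_iUnion hBd hBm]
  refine ⟨?_, ?_, ?_⟩
  · simp only [hN]
    exact AEMeasurable.tsum fun n => (hloc n).1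
  · rw [hmass, hvol, ← ENNReal.tsum_mul_left]
    exact ENNReal.tsum_le_tsum fun n => (hloc n).2.1
  · rw [hmass, hvol, ← ENNReal.tsum_mul_left, ← ENNReal.tsum_mul_left, ← ENNReal.tsum_add]
    exact ENNReal.tsum_le_tsum fun n => (hloc n).2.2

theorem critDensity_nonneg : 0 ≤ critDensity V p f :=
  mul_nonneg (inv_nonneg.2 (Finset.prod_nonneg fun _ _ => norm_nonneg _))
    (integral_nonneg fun _ => by positivity)

/-- The **Kac–Rice formula** for homogeneous triples. -/
theorem critMass_univ (hV : IsHomogeneousTriple g V) (hf : IsOrthonormalFrame g p f)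
    (ho : ∀ r s, r ≠ s → inner ℝ (adjunctionDual V p (f r)) (adjunctionDual V p (f s)) = 0) :
    critMass V Set.univ = ENNReal.ofReal (critDensity V p f * (riemVolume g).real Set.univ) := by
  set c := critDensity V p f
  have hc : 0 ≤ c := critDensity_nonneg
  set b := (riemVolume g).real Set.univ with hb
  have hb0 : 0 ≤ b := measureReal_nonneg
  have hvol : riemVolume g Set.univ = ENNReal.ofReal b := by
    rw [hb, ofReal_measureReal]
  have hest := fun {ε : ℝ} (hε : 0 < ε) => (critMass_estimate hV hf ho hε).2
  rw [hvol] at hest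
  -- The estimate with `ε = 1` bounds the mass, after which the limit can be taken in real numbers.
  have hfin : critMass V Set.univ ≠ ⊤ := by
    refine ne_top_of_le_ne_top ?_ (hest one_pos).1
    exact ENNReal.mul_ne_top ENNReal.ofReal_ne_top ENNReal.ofReal_ne_top
  have hcrit : critMass V Set.univ = ENNReal.ofReal (critMass V Set.univ).toReal :=
    (ENNReal.ofReal_toReal hfin).symm
  set x := (critMass V Set.univ).toReal
  have hx : 0 ≤ x := ENNReal.toReal_nonneg
  rw [hcrit]
  congr 1
  have h1 : ∀ ε : ℝ, 0 < ε → x ≤ c * b + ε * b := fun ε hε => by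
    have := (hest hε).1
    rw [hcrit, ← ENNReal.ofReal_mul (by positivity),
      ENNReal.ofReal_le_ofReal_iff (by positivity)] at this
    linarith
  have h2 : ∀ ε : ℝ, 0 < ε → c * b ≤ x + ε * b := fun ε hε => by
    have := (hest hε).2
    rw [hcrit, ← ENNReal.ofReal_mul (by positivity), ← ENNReal.ofReal_mul (by positivity),
      ← ENNReal.ofReal_add hx (by positivity), ENNReal.ofReal_le_ofReal_iff (by positivity)] at this
    exact this
  refine le_antisymm ?_ ?_
  -- Dividing by `b + 1` makes the error `ε * b` at most `δ` even when `b` is zero.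
  · refine le_of_forall_pos_le_add fun δ hδ => (h1 (δ / (b + 1)) (by positivity)).trans ?_
    have : δ / (b + 1) * b ≤ δ := by
      rw [div_mul_eq_mul_div, div_le_iff₀ (by positivity)]
      nlinarith
    linarith
  · refine le_of_forall_pos_le_add fun δ hδ => (h2 (δ / (b + 1)) (by positivity)).trans ?_
    have : δ / (b + 1) * b ≤ δ := by
      rw [div_mul_eq_mul_div, div_le_iff₀ (by positivity)]
      nlinarith
    linarith

end Symmetry

/-! ### The expected number of critical points of a special triple -/

section Expected

variable {E : Type*} [NormedAddCommGroup E] [NormedSpace ℝ E] [FiniteDimensional ℝ E]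
  [MeasurableSpace E] [BorelSpace E]
  {H : Type*} [TopologicalSpace H] {I : ModelWithCorners ℝ E H} [I.Boundaryless]
  {M : Type*} [TopologicalSpace M] [ChartedSpace H M] [IsManifold I ∞ M]
  [T2Space M] [CompactSpace M] [MeasurableSpace M] [BorelSpace M]
  {g : RMetric I M} {V : Submodule ℝ (SmoothFun g)} [FiniteDimensional ℝ V]
  {ι : Type*} [Fintype ι] [DecidableEq ι] {p : M} {f : ι → TangentSpace I p}

theorem critSet_smul {r : ℝ} (hr : r ≠ 0) (v : V) : critSet (r • v : V).1 = critSet v.1 := by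
  ext x
  have h : adjunction V x (r • v) = r • adjunction V x v := map_smul _ _ _
  change adjunction V x (r • v) = 0 ↔ adjunction V x v = 0
  rw [h, smul_eq_zero_iff_right hr]

/-- The count is homogeneous of degree `0`, like the constant `1`, so polar coordinates give both
the same radial factor. It cancels in the quotient, where the integral of `1` becomes the total
Gaussian mass. -/
theorem expectedCrit_eq_critMass_div [Nontrivial V]
    (hm : AEMeasurable (fun v : V => ((critSet v.1).encard : ℝ≥0∞))) :
    expectedCrit g V = critMass V Set.univ /
      ENNReal.ofReal (Real.pi ^ ((Module.finrank ℝ V : ℝ) / 2)) := by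
  have h1 := (ae_sphere_of_homogeneous (W := V) 0 hm fun r v hr => by
    rw [critSet_smul hr.ne', pow_zero, ENNReal.ofReal_one, one_mul]).2
  have h2 := (ae_sphere_of_homogeneous (W := V) 0 (F := fun _ => 1) aemeasurable_const
    fun r v hr => by simp).2
  simp only [Nat.cast_zero, add_zero, mul_one, lintegral_one] at h1 h2
  have h3 : ∫⁻ v : V, ENNReal.ofReal (Real.exp (-‖v‖ ^ 2)) =
      ENNReal.ofReal (Real.pi ^ ((Module.finrank ℝ V : ℝ) / 2)) := by
    have h4 := GaussianFourier.integral_rexp_neg_mul_sq_norm (V := V) one_pos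
    have h5 := integrable_gaussian (W := V) one_pos
    simp only [neg_one_mul, div_one] at h4 h5
    rw [← h4, ofReal_integral_eq_lintegral_ofReal h5
      (Filter.Eventually.of_forall fun v => by simp only [Pi.zero_apply]; positivity)]
  have hΓ : 0 < Real.Gamma ((Module.finrank ℝ V : ℝ) / 2) / 2 := by
    have : 0 < Module.finrank ℝ V := Module.finrank_pos
    have := Real.Gamma_pos_of_pos (s := (Module.finrank ℝ V : ℝ) / 2) (by positivity)
    positivity
  rw [expectedCrit, critMass, ← h3, h2]
  simp only [Set.inter_univ]
  rw [h1]
  exact (ENNReal.mul_div_mul_left _ _ (ENNReal.ofReal_pos.2 hΓ).ne' ENNReal.ofReal_ne_top).symm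

variable (V p) in
/-- The functional `v ↦ ∂_X ∂_Y v` on `V`, in the coordinates of the chart at `p`. -/
def coordHessian (X Y : E) : V →ₗ[ℝ] ℝ where
  toFun v := fderiv ℝ (coordDiff V p) (extChartAt I p p) X v Y
  map_add' u v := by rw [map_add]; rfl
  map_smul' c v := by rw [map_smul]; rfl

variable (g p) in
/-- The Christoffel symbol `Γ_{XY}^Z` of the chart at `p`. -/
def christoffel (X Y Z : E) : ℝ :=
  (fderiv ℝ (fun y => coordMetric g p y Y Z) (extChartAt I p p) X +
    fderiv ℝ (fun y => coordMetric g p y X Z) (extChartAt I p p) Y -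
    fderiv ℝ (fun y => coordMetric g p y X Y) (extChartAt I p p) Z) / 2

/-- The Christoffel symbols do not involve `v`, so the Hessian is displayed as a combination of
linear functionals of `v`. Its linearity and its product formula both start from here. -/
theorem hessian_apply (v : V) (r s : ι) : hessian p f v.1 r s =
    coordHessian V p (f r) (f s) v -
      ∑ t, christoffel g p (f r) (f s) (f t) * diffAt V p (f t) v := by
  have h := congrArg (fun A : E →L[ℝ] ℝ => A (f s)) (fderiv_coordDiff (V := V) p (f r) v)
  refine Eq.trans ?_ (congrArg₂ (· - ·) h.symm rfl)
  simp only [hessian, Matrix.of_apply]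
  rw [mfderiv_extChartAt_self]
  rfl

variable (V p f) in
/-- The Hessian as a linear map on `V`. -/
def hessianMap : V →ₗ[ℝ] Matrix ι ι ℝ where
  toFun v := hessian p f v.1
  map_add' u v := by
    ext r s
    rw [Matrix.add_apply, hessian_apply, hessian_apply, hessian_apply]
    simp only [map_add, mul_add, Finset.sum_add_distrib]
    ring
  map_smul' c v := by
    ext r s
    rw [RingHom.id_apply, Matrix.smul_apply, hessian_apply, hessian_apply]
    simp only [map_smul, smul_eq_mul, mul_sub, Finset.mul_sum]
    congr 1
    exact Finset.sum_congr rfl fun t _ => by ring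

theorem hessianMap_apply (v : V) : hessianMap V p f v = hessian p f v.1 := rfl

theorem continuous_det_hessian : Continuous fun v : V => (hessian p f v.1).det := by
  have : Continuous (hessianMap V p f) := (hessianMap V p f).continuous_of_finiteDimensional
  exact this.matrix_det

/-- The Gaussian integral of a function that is constant along a complement. -/
theorem integral_gaussian_of_const {W : Type*} [NormedAddCommGroup W] [InnerProductSpace ℝ W]
    [FiniteDimensional ℝ W] [MeasurableSpace W] [BorelSpace W] (K L : Submodule ℝ W) (hLK : L ≤ K)
    {F : W → ℝ} (hF : ∀ u ∈ L, ∀ v ∈ Lᗮ, v ∈ K → F (u + v) = F u) :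
    ∫ k : K, Real.exp (-‖k‖ ^ 2) * F k =
      Real.pi ^ (((Module.finrank ℝ K : ℝ) - Module.finrank ℝ L) / 2) *
        ∫ u : L, Real.exp (-‖u‖ ^ 2) * F u := by
  -- This is `L` seen inside `K`; its complement there is `K ∩ Lᗮ`, along which `F` is constant.
  set L' : Submodule ℝ K := L.comap K.subtype
  let e : L' ≃ₗᵢ[ℝ] L := ⟨Submodule.comapSubtypeEquivOfLe hLK, fun x => rfl⟩
  have he : ∫ u : L', Real.exp (-‖u‖ ^ 2) * F (u : K) = ∫ u : L, Real.exp (-‖u‖ ^ 2) * F u := by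
    rw [← e.measurePreserving.integral_comp e.toHomeomorph.measurableEmbedding]
    refine integral_congr_ae (Filter.Eventually.of_forall fun u => ?_)
    simp only [e.norm_map]
    rfl
  have hdim : Module.finrank ℝ L' = Module.finrank ℝ L := e.toLinearEquiv.finrank_eq
  have hsum : Module.finrank ℝ L' + Module.finrank ℝ L'ᗮ = Module.finrank ℝ K :=
    L'.finrank_add_finrank_orthogonal
  rw [integral_orthogonalSum L', ← he]
  have hrw : ∀ z : L' × L'ᗮ, Real.exp (-‖(z.1 : K) + z.2‖ ^ 2) * F ((z.1 : K) + z.2 : K) =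
      (Real.exp (-‖z.1‖ ^ 2) * F (z.1 : K)) * Real.exp (-‖z.2‖ ^ 2) := by
    intro z
    have hz : ((z.2 : K) : W) ∈ Lᗮ := by
      rw [Submodule.mem_orthogonal]
      intro u hu
      exact (Submodule.mem_orthogonal _ _).1 z.2.2 ⟨u, hLK hu⟩ hu
    rw [norm_sq_orthogonal_add, Submodule.coe_add, hF ((z.1 : K) : W) z.1.2 _ hz (z.2 : K).2, neg_add,
      Real.exp_add]
    ring
  simp only [hrw]
  rw [Measure.volume_eq_prod, integral_prod_mul (fun u : L' => Real.exp (-‖u‖ ^ 2) * F (u : K))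
    fun v : L'ᗮ => Real.exp (-‖v‖ ^ 2), mul_comm]
  congr 1
  have h4 := GaussianFourier.integral_rexp_neg_mul_sq_norm (V := L'ᗮ) one_pos
  simp only [neg_one_mul, div_one] at h4
  rw [h4, ← hdim, ← hsum]
  push_cast
  congr 2
  ring

/-- Integration of a homogeneous function in polar coordinates. -/
theorem integral_gaussian_polar {W : Type*} [NormedAddCommGroup W] [InnerProductSpace ℝ W]
    [FiniteDimensional ℝ W] [MeasurableSpace W] [BorelSpace W] {n : ℕ} (hn : 0 < n) {F : W → ℝ}
    (hF : Continuous F) (hF0 : ∀ u, 0 ≤ F u) (hom : ∀ (r : ℝ) (u : W), 0 ≤ r → F (r • u) = r ^ n * F u) :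
    ∫ u : W, Real.exp (-‖u‖ ^ 2) * F u =
      Real.Gamma (((Module.finrank ℝ W : ℝ) + n) / 2) / 2 *
        ∫ u : Metric.sphere (0 : W) 1, F u ∂(volume : Measure W).toSphere := by
  rcases subsingleton_or_nontrivial W with hW | hW
  -- On the zero space the sphere is empty, so the integral on the left must vanish as well.
  -- Positive degree is needed here: it forces `F 0 = 0`.
  · have h0 : ∀ u : W, F u = 0 := by
      intro u
      have := hom 0 u le_rfl
      rwa [zero_pow hn.ne', zero_mul, Subsingleton.elim (0 • u) u] at this
    simp [h0]
  · have h1 := (ae_sphere_of_homogeneous (W := W) n (F := fun u => ENNReal.ofReal (F u))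
      hF.measurable.ennreal_ofReal.aemeasurable fun r u hr => by
        rw [hom r u hr.le, ENNReal.ofReal_mul (by positivity)]).2
    rw [integral_eq_lintegral_of_nonneg_ae
      (Filter.Eventually.of_forall fun u => mul_nonneg (Real.exp_pos _).le (hF0 u))
      (by fun_prop), integral_eq_lintegral_of_nonneg_ae (f := fun u : Metric.sphere (0 : W) 1 => F u)
      (Filter.Eventually.of_forall fun u => hF0 u)
      (hF.comp continuous_subtype_val).aestronglyMeasurable]
    have hΓ : 0 < Real.Gamma (((Module.finrank ℝ W : ℝ) + n) / 2) :=
      Real.Gamma_pos_of_pos (by positivity)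
    simp only [ENNReal.ofReal_mul (Real.exp_pos _).le]
    rw [h1, ENNReal.toReal_mul, ENNReal.toReal_ofReal (by positivity)]

variable [SecondCountableTopology M]

theorem finrank_critSpace (hV : Function.Surjective (adjunction V p)) :
    (Module.finrank ℝ (critSpace V p) : ℝ) = Module.finrank ℝ V - Module.finrank ℝ E := by
  have h := (adjunction V p).finrank_range_add_finrank_ker
  have h1 : Module.finrank ℝ (TangentSpace I p →L[ℝ] ℝ) = Module.finrank ℝ E := by
    change Module.finrank ℝ (E →L[ℝ] ℝ) = _
    rw [← (LinearMap.toContinuousLinearMap (𝕜 := ℝ) (E := E) (F' := ℝ)).finrank_eq]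
    exact Subspace.dual_finrank_eq (K := ℝ) (V := E)
  rw [LinearMap.range_eq_top.2 hV, finrank_top, h1] at h
  rw [← h]
  push_cast
  change _ = _ + (Module.finrank ℝ (critSpace V p) : ℝ) - _
  ring

/-- The expected number of critical points of a special triple as a Gaussian integral. -/
theorem IsCore.expectedCrit_eq (hV : IsHomogeneousTriple g V) {L : Submodule ℝ V} {w : V}
    (hcore : IsCore g V p f L w) :
    expectedCrit g V = ENNReal.ofReal
      ((riemVolume g).real Set.univ /
        (Real.pi ^ (((Module.finrank ℝ L : ℝ) + Module.finrank ℝ E) / 2) *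
          ∏ r, ‖adjunctionDual V p (f r)‖) *
        ∫ u : L, Real.exp (-‖u‖ ^ 2) * |(hessian p f u.1.1).det| ∂(euclVolume L)) := by
  -- The unit vector `w` shows that the sphere of `V` is not empty.
  have : Nontrivial V := ⟨⟨w, 0, fun h => by
    have := hcore.norm_eq_one
    rw [h, norm_zero] at this
    exact zero_ne_one this⟩⟩
  have hm := (critMass_estimate hV hcore.frame hcore.orthogonal one_pos).1
  -- By (P₂), adding a vector of `Lᗮ` does not change the Hessian, so the integral over `K_p`
  -- reduces to `L`.
  have hint := integral_gaussian_of_const (critSpace V p) L hcore.le_critSpace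
    (F := fun v : V => |(hessian p f v.1).det|) fun u _ v hv _ => by
      have h := (hessianMap V p f).map_add u v
      simp only [hessianMap_apply, hcore.hessian_eq_zero v hv, add_zero] at h
      rw [h]
  rw [expectedCrit_eq_critMass_div hm, critMass_univ hV hcore.frame hcore.orthogonal,
    ← ENNReal.ofReal_div_of_pos (by positivity), critDensity, hint, finrank_critSpace (hV.1 p)]
  congr 1
  set A := ∫ u : L, Real.exp (-‖u‖ ^ 2) * |(hessian p f u.1.1).det|
  change _ = _ * A
  -- The complement of `L` in `K_p` has dimension `dim V - m - ℓ`; dividing its Gaussian mass by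
  -- that of `V` leaves the exponent `-(ℓ + m) / 2`.
  have hpi : Real.pi ^ (((Module.finrank ℝ V : ℝ) - Module.finrank ℝ E - Module.finrank ℝ L) / 2) =
      Real.pi ^ ((Module.finrank ℝ V : ℝ) / 2) /
        Real.pi ^ (((Module.finrank ℝ L : ℝ) + Module.finrank ℝ E) / 2) := by
    rw [← Real.rpow_sub Real.pi_pos]
    congr 1
    ring
  rw [hpi]
  have h1 : 0 < Real.pi ^ ((Module.finrank ℝ V : ℝ) / 2) := by positivity
  have h2 : 0 < Real.pi ^ (((Module.finrank ℝ L : ℝ) + Module.finrank ℝ E) / 2) := by positivity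
  have h3 : ∏ r, ‖adjunctionDual V p (f r)‖ ≠ 0 := Finset.prod_ne_zero_iff.2 fun r _ =>
    norm_ne_zero_iff.2 (adjunctionDual_ne_zero (hV.1 p) (frame_ne_zero hcore.frame r))
  field_simp

/-- The expected number of critical points of a special triple as an integral over a sphere. -/
theorem IsCore.expectedCrit_eq_sphere (hV : IsHomogeneousTriple g V) {L : Submodule ℝ V} {w : V}
    (hcore : IsCore g V p f L w) (hE : 0 < Module.finrank ℝ E) :
    expectedCrit g V = ENNReal.ofReal
      ((riemVolume g).real Set.univ *
          Real.Gamma (((Module.finrank ℝ L : ℝ) + Module.finrank ℝ E) / 2) /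
        (2 * Real.pi ^ (((Module.finrank ℝ L : ℝ) + Module.finrank ℝ E) / 2) *
          ∏ r, ‖adjunctionDual V p (f r)‖) *
        ∫ v : Metric.sphere (0 : L) 1, |(hessian p f (v : L).1.1).det| ∂(sphereArea L)) := by
  have hint := integral_gaussian_polar (W := L) hE (F := fun u : L => |(hessian p f u.1.1).det|)
    ((continuous_det_hessian.comp continuous_subtype_val).abs) (fun u => abs_nonneg _)
    fun r u hr => by
      have h := (hessianMap V p f).map_smul r (u : V)
      simp only [hessianMap_apply] at h
      change |(hessian p f (r • (u : V) : V).1).det| = _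
      -- The degree of homogeneity is the size of the matrix, which is `m` because the frame is a
      -- basis.
      rw [h, Matrix.det_smul, abs_mul, abs_of_nonneg (by positivity),
        card_eq_finrank_of_frame hcore.frame]
  rw [hcore.expectedCrit_eq hV]
  change ENNReal.ofReal (_ * ∫ u : L, Real.exp (-‖u‖ ^ 2) * |(hessian p f u.1.1).det|) = _
  rw [hint]
  congr 1
  change _ = _ * ∫ v : Metric.sphere (0 : L) 1, |(hessian p f (v : L).1.1).det|
    ∂(volume : Measure L).toSphere
  ring

end Expected

/-! ### The geometry of a product -/

section ProductGeometry

variable {E₁ : Type*} [NormedAddCommGroup E₁] [NormedSpace ℝ E₁] [FiniteDimensional ℝ E₁]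
  {H₁ : Type*} [TopologicalSpace H₁] {I₁ : ModelWithCorners ℝ E₁ H₁} [I₁.Boundaryless]
  {M₁ : Type*} [TopologicalSpace M₁] [ChartedSpace H₁ M₁] [IsManifold I₁ ∞ M₁]
  {E₂ : Type*} [NormedAddCommGroup E₂] [NormedSpace ℝ E₂] [FiniteDimensional ℝ E₂]
  {H₂ : Type*} [TopologicalSpace H₂] {I₂ : ModelWithCorners ℝ E₂ H₂} [I₂.Boundaryless]
  {M₂ : Type*} [TopologicalSpace M₂] [ChartedSpace H₂ M₂] [IsManifold I₂ ∞ M₂]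
  (g₁ : RMetric I₁ M₁) (g₂ : RMetric I₂ M₂)

theorem mem_extChartAt_prod_target {p : M₁ × M₂} {y : E₁ × E₂} :
    y ∈ (extChartAt (I₁.prod I₂) p).target ↔
      y.1 ∈ (extChartAt I₁ p.1).target ∧ y.2 ∈ (extChartAt I₂ p.2).target := by
  rw [extChartAt_prod]
  rfl

theorem extChartAt_prod_symm_apply (p : M₁ × M₂) (y : E₁ × E₂) :
    (extChartAt (I₁.prod I₂) p).symm y =
      ((extChartAt I₁ p.1).symm y.1, (extChartAt I₂ p.2).symm y.2) := by
  rw [extChartAt_prod]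
  rfl

theorem extChartAt_prod_apply_self (p : M₁ × M₂) :
    extChartAt (I₁.prod I₂) p p = (extChartAt I₁ p.1 p.1, extChartAt I₂ p.2 p.2) := by
  rw [extChartAt_prod]
  rfl

theorem mfderiv_extChartAt_prod_symm (p : M₁ × M₂) {y : E₁ × E₂}
    (hy : y ∈ (extChartAt (I₁.prod I₂) p).target) (u : E₁ × E₂) :
    (mfderiv 𝓘(ℝ, E₁ × E₂) (I₁.prod I₂) (extChartAt (I₁.prod I₂) p).symm y u : E₁ × E₂) =
      ((mfderiv 𝓘(ℝ, E₁) I₁ (extChartAt I₁ p.1).symm y.1 u.1 : E₁),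
        (mfderiv 𝓘(ℝ, E₂) I₂ (extChartAt I₂ p.2).symm y.2 u.2 : E₂)) := by
  obtain ⟨hy1, hy2⟩ := mem_extChartAt_prod_target.1 hy
  have h := mdifferentiableAt_extChartAt_symm_of_mem (I := I₁.prod I₂) p hy
  have h1 := mdifferentiableAt_extChartAt_symm_of_mem (I := I₁) p.1 hy1
  have h2 := mdifferentiableAt_extChartAt_symm_of_mem (I := I₂) p.2 hy2
  have e1 : HasMFDerivAt 𝓘(ℝ, E₁ × E₂) I₁
      (fun y : E₁ × E₂ => (extChartAt I₁ p.1).symm y.1) y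
      ((mfderiv 𝓘(ℝ, E₁) I₁ (extChartAt I₁ p.1).symm y.1).comp
        (ContinuousLinearMap.fst ℝ E₁ E₂)) :=
    h1.hasMFDerivAt.comp y
      (hasFDerivAt_fst (𝕜 := ℝ) (E := E₁) (F := E₂) (p := y)).hasMFDerivAt
  have e2 : HasMFDerivAt 𝓘(ℝ, E₁ × E₂) I₂
      (fun y : E₁ × E₂ => (extChartAt I₂ p.2).symm y.2) y
      ((mfderiv 𝓘(ℝ, E₂) I₂ (extChartAt I₂ p.2).symm y.2).comp
        (ContinuousLinearMap.snd ℝ E₁ E₂)) :=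
    h2.hasMFDerivAt.comp y
      (hasFDerivAt_snd (𝕜 := ℝ) (E := E₁) (F := E₂) (p := y)).hasMFDerivAt
  have e3 := e1.prodMk e2
  have e4 : (fun y : E₁ × E₂ => ((extChartAt I₁ p.1).symm y.1, (extChartAt I₂ p.2).symm y.2)) =
      (extChartAt (I₁.prod I₂) p).symm :=
    funext fun y => (extChartAt_prod_symm_apply p y).symm
  rw [e4] at e3
  rw [e3.mfderiv]
  rfl

theorem coordMetric_prod (p : M₁ × M₂) {y : E₁ × E₂}
    (hy : y ∈ (extChartAt (I₁.prod I₂) p).target) (u w : E₁ × E₂) :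
    coordMetric (prodMetric g₁ g₂) p y u w =
      coordMetric g₁ p.1 y.1 u.1 w.1 + coordMetric g₂ p.2 y.2 u.2 w.2 := by
  rw [coordMetric_apply]
  refine (prodInner_apply g₁ g₂ _ _ _).trans ?_
  have hu := mfderiv_extChartAt_prod_symm (I₁ := I₁) (I₂ := I₂) p hy u
  have hw := mfderiv_extChartAt_prod_symm (I₁ := I₁) (I₂ := I₂) p hy w
  have hx := extChartAt_prod_symm_apply (I₁ := I₁) (I₂ := I₂) p y
  refine congrArg₂ (· + ·) ?_ ?_
  · refine (inner_congr g₁ (congrArg Prod.fst hx) _ _).trans ?_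
    exact congrArg₂ (fun a b : E₁ => g₁.inner ((extChartAt I₁ p.1).symm y.1) a b)
      (congrArg Prod.fst hu) (congrArg Prod.fst hw)
  · refine (inner_congr g₂ (congrArg Prod.snd hx) _ _).trans ?_
    exact congrArg₂ (fun a b : E₂ => g₂.inner ((extChartAt I₂ p.2).symm y.2) a b)
      (congrArg Prod.snd hu) (congrArg Prod.snd hw)

theorem differentiableAt_coordMetric (g : RMetric I₁ M₁) (p : M₁) (u w : E₁) :
    DifferentiableAt ℝ (fun y => coordMetric g p y u w) (extChartAt I₁ p p) := by
  have h := contMDiffAt_pullbackForm g (contMDiffAt_extChartAt_symm_of_mem (I := I₁) p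
    (mem_extChartAt_target (I := I₁) p))
  have hu : ∀ u : E₁, ContMDiffAt 𝓘(ℝ, E₁) (𝓘(ℝ, E₁).prod 𝓘(ℝ, E₁)) ∞
      (fun y : E₁ => (Bundle.TotalSpace.mk' E₁ y u : TangentBundle 𝓘(ℝ, E₁) E₁))
      (extChartAt I₁ p p) :=
    fun u => contMDiffAt_vectorSpace_iff_contDiffAt.2 contDiffAt_const
  have h2 := ContMDiffAt.clm_bundle_apply₂ (F₁ := E₁) (F₂ := E₁) (F₃ := ℝ)
    (E₃ := Bundle.Trivial E₁ ℝ) h (hu u) (hu w)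
  exact ((contMDiffAt_iff_contDiffAt.1 (Bundle.contMDiffAt_totalSpace.1 h2).2).differentiableAt
    (by simp))

theorem fderiv_coordMetric_prod (p : M₁ × M₂) (X u w : E₁ × E₂) :
    fderiv ℝ (fun y => coordMetric (prodMetric g₁ g₂) p y u w)
        (extChartAt (I₁.prod I₂) p p) X =
      fderiv ℝ (fun y => coordMetric g₁ p.1 y u.1 w.1) (extChartAt I₁ p.1 p.1) X.1 +
        fderiv ℝ (fun y => coordMetric g₂ p.2 y u.2 w.2) (extChartAt I₂ p.2 p.2) X.2 := by
  have hev : (fun y => coordMetric (prodMetric g₁ g₂) p y u w) =ᶠ[nhds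
      (extChartAt (I₁.prod I₂) p p)] fun y => coordMetric g₁ p.1 y.1 u.1 w.1 +
        coordMetric g₂ p.2 y.2 u.2 w.2 := by
    filter_upwards [extChartAt_target_mem_nhds (I := I₁.prod I₂) p] with y hy
    exact coordMetric_prod g₁ g₂ p hy u w
  rw [hev.fderiv_eq, extChartAt_prod_apply_self]
  have h1 := (differentiableAt_coordMetric g₁ p.1 u.1 w.1).hasFDerivAt.comp
    (x := (extChartAt I₁ p.1 p.1, extChartAt I₂ p.2 p.2))
    (hasFDerivAt_fst (𝕜 := ℝ) (E := E₁) (F := E₂))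
  have h2 := (differentiableAt_coordMetric g₂ p.2 u.2 w.2).hasFDerivAt.comp
    (x := (extChartAt I₁ p.1 p.1, extChartAt I₂ p.2 p.2))
    (hasFDerivAt_snd (𝕜 := ℝ) (E := E₁) (F := E₂))
  exact congrArg (fun A : E₁ × E₂ →L[ℝ] ℝ => A X) (h1.add h2).fderiv

/-- The coefficients of the product metric are sums of functions of one factor each, so there is no
interaction between the factors. -/
theorem christoffel_prod (p : M₁ × M₂) (X Y Z : E₁ × E₂) :
    christoffel (prodMetric g₁ g₂) p X Y Z =
      christoffel g₁ p.1 X.1 Y.1 Z.1 + christoffel g₂ p.2 X.2 Y.2 Z.2 := by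
  simp only [christoffel, fderiv_coordMetric_prod]
  ring

theorem christoffel_zero_left (g : RMetric I₁ M₁) (p : M₁) (Y Z : E₁) :
    christoffel g p 0 Y Z = 0 := by simp [christoffel]

theorem christoffel_zero_middle (g : RMetric I₁ M₁) (p : M₁) (X Z : E₁) :
    christoffel g p X 0 Z = 0 := by simp [christoffel]

theorem christoffel_zero_right (g : RMetric I₁ M₁) (p : M₁) (X Y : E₁) :
    christoffel g p X Y 0 = 0 := by simp [christoffel]

variable [MeasurableSpace E₁] [BorelSpace E₁] [MeasurableSpace E₂] [BorelSpace E₂]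

variable [T2Space M₁] [SecondCountableTopology M₁] [CompactSpace M₁] [MeasurableSpace M₁] [BorelSpace M₁]
  [T2Space M₂] [SecondCountableTopology M₂] [CompactSpace M₂] [MeasurableSpace M₂] [BorelSpace M₂]

theorem sqrt_det_coordGram_prod (p : M₁ × M₂) {y : E₁ × E₂}
    (hy : y ∈ (extChartAt (I₁.prod I₂) p).target) :
    Real.sqrt (gramMatrix (coordMetric (prodMetric g₁ g₂) p y)
      ((Module.finBasis ℝ E₁).prod (Module.finBasis ℝ E₂))).det =
      Real.sqrt (coordGram g₁ p.1 y.1).det * Real.sqrt (coordGram g₂ p.2 y.2).det := by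
  have h : gramMatrix (coordMetric (prodMetric g₁ g₂) p y)
      ((Module.finBasis ℝ E₁).prod (Module.finBasis ℝ E₂)) =
      Matrix.fromBlocks (coordGram g₁ p.1 y.1) 0 0 (coordGram g₂ p.2 y.2) := by
    ext i j
    rcases i with i | i <;> rcases j with j | j <;>
      simp [gramMatrix, coordMetric_prod g₁ g₂ p hy, coordGram]
  have h0 := density_pos g₁ p.1 (mem_extChartAt_prod_target.1 hy).1
  rw [h, Matrix.det_fromBlocks_zero₂₁, Real.sqrt_mul (Real.sqrt_pos.1 h0).le]

theorem chartVolume_prod (q : M₁ × M₂) {s : Set M₁} {t : Set M₂} (hs : MeasurableSet s)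
    (ht : MeasurableSet t) :
    chartVolume (prodMetric g₁ g₂) q (s ×ˢ t) = chartVolume g₁ q.1 s * chartVolume g₂ q.2 t := by
  rw [chartVolume_apply _ _ (hs.prod ht), chartVolume_apply _ _ hs, chartVolume_apply _ _ ht]
  set S₁ := (extChartAt I₁ q.1).target ∩ (extChartAt I₁ q.1).symm ⁻¹' s
  set S₂ := (extChartAt I₂ q.2).target ∩ (extChartAt I₂ q.2).symm ⁻¹' t
  have hS : (extChartAt (I₁.prod I₂) q).target ∩
      (extChartAt (I₁.prod I₂) q).symm ⁻¹' (s ×ˢ t) = S₁ ×ˢ S₂ := by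
    ext y
    rw [Set.mem_inter_iff, mem_extChartAt_prod_target, Set.mem_preimage,
      extChartAt_prod_symm_apply]
    exact and_and_and_comm
  -- The basis chosen for `E₁ × E₂` need not be the product basis, whereas the Gram matrix is block
  -- diagonal only in the latter.
  have h1 := lintegral_sqrt_gram ((Module.finBasis ℝ E₁).prod (Module.finBasis ℝ E₂))
    (Module.finBasis ℝ (E₁ × E₂)) (coordMetric (prodMetric g₁ g₂) q) (S₁ ×ˢ S₂) 1
  simp only [Pi.one_apply, mul_one, ← coordGram_eq_gramMatrix] at h1
  have hm₁ : MeasurableSet S₁ := measurableSet_coord q.1 hs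
  have hm₂ : MeasurableSet S₂ := measurableSet_coord q.2 ht
  rw [hS, h1, setLIntegral_congr_fun (g := fun y : E₁ × E₂ =>
    ENNReal.ofReal (Real.sqrt (coordGram g₁ q.1 y.1).det) *
      ENNReal.ofReal (Real.sqrt (coordGram g₂ q.2 y.2).det)) (hm₁.prod hm₂) fun y hy => by
      rw [sqrt_det_coordGram_prod g₁ g₂ q (mem_extChartAt_prod_target.2 ⟨hy.1.1, hy.2.1⟩),
        ENNReal.ofReal_mul (Real.sqrt_nonneg _)]]
  rw [Module.Basis.prod_addHaar, ← Measure.prod_restrict (μ := (Module.finBasis ℝ E₁).addHaar)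
    (ν := (Module.finBasis ℝ E₂).addHaar)]
  refine lintegral_prod_mul (μ := (Module.finBasis ℝ E₁).addHaar.restrict S₁)
    (ν := (Module.finBasis ℝ E₂).addHaar.restrict S₂)
    (f := fun y => ENNReal.ofReal (Real.sqrt (coordGram g₁ q.1 y).det))
    (g := fun y => ENNReal.ofReal (Real.sqrt (coordGram g₂ q.2 y).det)) ?_ ?_
  · exact (((continuousOn_density g₁ q.1).mono Set.inter_subset_left).aemeasurable
      hm₁).ennreal_ofReal
  · exact (((continuousOn_density g₂ q.2).mono Set.inter_subset_left).aemeasurable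
      hm₂).ennreal_ofReal

/-- The Riemannian volume of a product is the product of the Riemannian volumes. -/
theorem riemVolume_prod :
    riemVolume (prodMetric g₁ g₂) = (riemVolume g₁).prod (riemVolume g₂) := by
  have hs : ∀ x : M₁ × M₂, (extChartAt (I₁.prod I₂) x).source =
      (extChartAt I₁ x.1).source ×ˢ (extChartAt I₂ x.2).source := fun x => by
    rw [extChartAt_prod]
    rfl
  refine measure_ext_of_local (U := fun x => (extChartAt (I₁.prod I₂) x).source)
    (fun x => isOpen_extChartAt_source x) (fun x => mem_extChartAt_source x) fun x s hsx hsm => ?_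
  have hU₁ : MeasurableSet (extChartAt I₁ x.1).source := (isOpen_extChartAt_source _).measurableSet
  have hU₂ : MeasurableSet (extChartAt I₂ x.2).source := (isOpen_extChartAt_source _).measurableSet
  have h : ((riemVolume g₁).restrict (extChartAt I₁ x.1).source).prod
      ((riemVolume g₂).restrict (extChartAt I₂ x.2).source) =
      (riemVolume (prodMetric g₁ g₂)).restrict (extChartAt (I₁.prod I₂) x).source := by
    -- On a product of chart domains it suffices to compare rectangles, where both sides are
    -- products of chart volumes.
    refine Measure.prod_eq fun s t hs' ht' => ?_
    rw [Measure.restrict_apply hs', Measure.restrict_apply ht',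
      Measure.restrict_apply (hs'.prod ht'), hs, Set.prod_inter_prod,
      riemVolume_eq_chartVolume g₁ x.1 (hs'.inter hU₁) Set.inter_subset_right,
      riemVolume_eq_chartVolume g₂ x.2 (ht'.inter hU₂) Set.inter_subset_right,
      ← chartVolume_prod g₁ g₂ x (hs'.inter hU₁) (ht'.inter hU₂)]
    refine riemVolume_eq_chartVolume _ x ((hs'.inter hU₁).prod (ht'.inter hU₂)) ?_
    rw [hs]
    exact Set.prod_mono Set.inter_subset_right Set.inter_subset_right
  rw [Measure.prod_restrict, ← hs] at h
  have h' := congrArg (fun μ => μ s) h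
  simp only [Measure.restrict_apply hsm, Set.inter_eq_left.2 hsx] at h'
  exact h'.symm

end ProductGeometry

/-! ### Tensor products of function spaces -/

section Tensor

variable {E₁ : Type*} [NormedAddCommGroup E₁] [NormedSpace ℝ E₁] [FiniteDimensional ℝ E₁]
  [MeasurableSpace E₁] [BorelSpace E₁]
  {H₁ : Type*} [TopologicalSpace H₁] {I₁ : ModelWithCorners ℝ E₁ H₁} [I₁.Boundaryless]
  {M₁ : Type*} [TopologicalSpace M₁] [ChartedSpace H₁ M₁] [IsManifold I₁ ∞ M₁]
  [T2Space M₁] [SecondCountableTopology M₁] [CompactSpace M₁] [MeasurableSpace M₁] [BorelSpace M₁]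
  {E₂ : Type*} [NormedAddCommGroup E₂] [NormedSpace ℝ E₂] [FiniteDimensional ℝ E₂]
  [MeasurableSpace E₂] [BorelSpace E₂]
  {H₂ : Type*} [TopologicalSpace H₂] {I₂ : ModelWithCorners ℝ E₂ H₂} [I₂.Boundaryless]
  {M₂ : Type*} [TopologicalSpace M₂] [ChartedSpace H₂ M₂] [IsManifold I₂ ∞ M₂]
  [T2Space M₂] [SecondCountableTopology M₂] [CompactSpace M₂] [MeasurableSpace M₂] [BorelSpace M₂]
  {g₁ : RMetric I₁ M₁} {g₂ : RMetric I₂ M₂}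
  {V₁ : Submodule ℝ (SmoothFun g₁)} {V₂ : Submodule ℝ (SmoothFun g₂)}

theorem tmulV_apply (u : V₁) (v : V₂) (x : M₁ × M₂) :
    (tmulV V₁ V₂ u v).1 x = u.1 x.1 * v.1 x.2 := rfl

/-- Fubini's theorem for the product volume. Every orthogonality statement about the product triple
reduces to this formula. -/
theorem inner_tmulV (u u' : V₁) (v v' : V₂) :
    inner ℝ (tmulV V₁ V₂ u v) (tmulV V₁ V₂ u' v') = inner ℝ u u' * inner ℝ v v' := by
  rw [Submodule.coe_inner, Submodule.coe_inner, Submodule.coe_inner, SmoothFun.inner_def,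
    SmoothFun.inner_def, SmoothFun.inner_def, riemVolume_prod, ← integral_prod_mul]
  refine integral_congr_ae (Filter.Eventually.of_forall fun x => ?_)
  simp only [tmulV_apply]
  ring

theorem norm_tmulV (u : V₁) (v : V₂) : ‖tmulV V₁ V₂ u v‖ = ‖u‖ * ‖v‖ := by
  have h : ‖tmulV V₁ V₂ u v‖ ^ 2 = (‖u‖ * ‖v‖) ^ 2 := by
    rw [mul_pow, ← real_inner_self_eq_norm_sq, ← real_inner_self_eq_norm_sq,
      ← real_inner_self_eq_norm_sq, inner_tmulV]
  exact (sq_eq_sq₀ (norm_nonneg _) (by positivity)).1 h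

theorem tmulV_mem_tensorSub {W₁ : Submodule ℝ V₁} {W₂ : Submodule ℝ V₂} {u : V₁} {v : V₂}
    (hu : u ∈ W₁) (hv : v ∈ W₂) : tmulV V₁ V₂ u v ∈ tensorSub W₁ W₂ :=
  Submodule.apply_mem_map₂ _ hu hv

theorem tensorSub_top : tensorSub (⊤ : Submodule ℝ V₁) (⊤ : Submodule ℝ V₂) = ⊤ := by
  refine Submodule.map_injective_of_injective (tensorSpace V₁ V₂).injective_subtype ?_
  rw [Submodule.map_subtype_top, tensorSub, Submodule.map_map₂]
  refine le_antisymm (Submodule.map₂_le.2 fun u _ v _ => ?_) (Submodule.map₂_le.2 fun u hu v hv => ?_)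
  · exact (tmulV V₁ V₂ u v).2
  · exact Submodule.apply_mem_map₂ ((tmulV V₁ V₂).compr₂ (tensorSpace V₁ V₂).subtype)
      (Submodule.mem_top (x := (⟨u, hu⟩ : V₁))) (Submodule.mem_top (x := (⟨v, hv⟩ : V₂)))

/-- Decomposable functions span `V₁ ⊗ V₂`, so linear identities need only be checked on them. -/
theorem tensor_hom_ext {W : Type*} [AddCommGroup W] [Module ℝ W]
    {φ ψ : tensorSpace V₁ V₂ →ₗ[ℝ] W}
    (h : ∀ u v, φ (tmulV V₁ V₂ u v) = ψ (tmulV V₁ V₂ u v)) : φ = ψ := by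
  have : (⊤ : Submodule ℝ (tensorSpace V₁ V₂)) ≤ LinearMap.eqLocus φ ψ := by
    rw [← tensorSub_top]
    exact Submodule.map₂_le.2 fun u _ v _ => h u v
  exact LinearMap.ext fun x => this Submodule.mem_top

theorem tensorSub_orthogonal {W₁ W₁' : Submodule ℝ V₁} (h : W₁ ⟂ W₁') (W₂ W₂' : Submodule ℝ V₂) :
    Submodule.IsOrtho (𝕜 := ℝ) (E := tensorSpace V₁ V₂) (tensorSub W₁ W₂) (tensorSub W₁' W₂') := by
  rw [Submodule.isOrtho_iff_le]
  refine Submodule.map₂_le.2 fun u hu v _ => ?_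
  rw [Submodule.mem_orthogonal']
  intro z hz
  have : tensorSub W₁' W₂' ≤ LinearMap.ker (innerₛₗ ℝ (tmulV V₁ V₂ u v)) :=
    Submodule.map₂_le.2 fun u' hu' v' _ => by
      rw [LinearMap.mem_ker, innerₛₗ_apply_apply, inner_tmulV,
        Submodule.isOrtho_iff_inner_eq.1 h u hu u' hu', zero_mul]
  exact this hz

/-- The differential of `u ⊗ v`. -/
theorem adjunction_tmulV (x : M₁ × M₂) (u : V₁) (v : V₂) (X : TangentSpace (I₁.prod I₂) x) :
    adjunction (tensorSpace V₁ V₂) x (tmulV V₁ V₂ u v) X =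
      adjunction V₁ x.1 u X.1 * v.1 x.2 + u.1 x.1 * adjunction V₂ x.2 v X.2 := by
  have hu : HasMFDerivAt I₁ 𝓘(ℝ, ℝ) u.1 x.1 (mfderiv I₁ 𝓘(ℝ, ℝ) u.1 x.1) :=
    (u.1.contMDiff.mdifferentiable (by simp) _).hasMFDerivAt
  have hv : HasMFDerivAt I₂ 𝓘(ℝ, ℝ) v.1 x.2 (mfderiv I₂ 𝓘(ℝ, ℝ) v.1 x.2) :=
    (v.1.contMDiff.mdifferentiable (by simp) _).hasMFDerivAt
  have h1 := hu.comp x (hasMFDerivAt_fst (I := I₁) (I' := I₂) x)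
  have h2 := hv.comp x (hasMFDerivAt_snd (I := I₁) (I' := I₂) x)
  have h3 := h1.mul h2
  have h4 : adjunction (tensorSpace V₁ V₂) x (tmulV V₁ V₂ u v) X =
    mfderiv (I₁.prod I₂) 𝓘(ℝ, ℝ) ((u.1 ∘ Prod.fst) * (v.1 ∘ Prod.snd)) x X := rfl
  rw [h4, h3.mfderiv]
  change u.1 x.1 * adjunction V₂ x.2 v X.2 + v.1 x.2 * adjunction V₁ x.1 u X.1 = _
  ring

/-! ### Evaluation, dual adjunction and second derivatives on a product -/

section Dual

variable [FiniteDimensional ℝ V₁] [FiniteDimensional ℝ V₂]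

theorem evVec_tensor (x : M₁ × M₂) :
    evVec (tensorSpace V₁ V₂) x = tmulV V₁ V₂ (evVec V₁ x.1) (evVec V₂ x.2) := by
  refine riesz_unique fun z => ?_
  have h : innerₛₗ ℝ (tmulV V₁ V₂ (evVec V₁ x.1) (evVec V₂ x.2)) =
      evalAt (tensorSpace V₁ V₂) x := tensor_hom_ext fun u v => by
    rw [innerₛₗ_apply_apply, inner_tmulV, inner_evVec, inner_evVec]
    rfl
  exact LinearMap.congr_fun h z

/-- Pairing the right side with `u ⊗ v` gives the Leibniz rule for `d(u ⊗ v)`, and decomposable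
functions suffice. -/
theorem adjunctionDual_tensor (x : M₁ × M₂) (X : TangentSpace (I₁.prod I₂) x) :
    adjunctionDual (tensorSpace V₁ V₂) x X =
      tmulV V₁ V₂ (adjunctionDual V₁ x.1 X.1) (evVec V₂ x.2) +
        tmulV V₁ V₂ (evVec V₁ x.1) (adjunctionDual V₂ x.2 X.2) := by
  refine riesz_unique fun z => ?_
  have h : innerₛₗ ℝ (tmulV V₁ V₂ (adjunctionDual V₁ x.1 X.1) (evVec V₂ x.2) +
        tmulV V₁ V₂ (evVec V₁ x.1) (adjunctionDual V₂ x.2 X.2)) =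
      diffAt (tensorSpace V₁ V₂) x X := tensor_hom_ext fun u v => by
    rw [innerₛₗ_apply_apply, inner_add_left, inner_tmulV, inner_tmulV, inner_evVec, inner_evVec]
    exact (congrArg₂ (fun a b => a * v.1 x.2 + u.1 x.1 * b) (inner_adjunctionDual V₁ x.1 X.1 u)
      (inner_adjunctionDual V₂ x.2 X.2 v)).trans (adjunction_tmulV x u v X).symm
  exact LinearMap.congr_fun h z

theorem fderiv_fderiv_mul_prod {a : E₁ → ℝ} {b : E₂ → ℝ} {y : E₁ × E₂}
    (ha : ContDiffAt ℝ ∞ a y.1) (hb : ContDiffAt ℝ ∞ b y.2) (X Y : E₁ × E₂) :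
    fderiv ℝ (fderiv ℝ (fun z : E₁ × E₂ => a z.1 * b z.2)) y X Y =
      fderiv ℝ (fderiv ℝ a) y.1 X.1 Y.1 * b y.2 + fderiv ℝ a y.1 Y.1 * fderiv ℝ b y.2 X.2 +
        fderiv ℝ a y.1 X.1 * fderiv ℝ b y.2 Y.2 + a y.1 * fderiv ℝ (fderiv ℝ b) y.2 X.2 Y.2 := by
  have hF : ContDiffAt ℝ ∞ (fun z : E₁ × E₂ => a z.1 * b z.2) y :=
    (ha.comp y contDiffAt_fst).mul (hb.comp y contDiffAt_snd)
  have hFd : DifferentiableAt ℝ (fderiv ℝ (fun z : E₁ × E₂ => a z.1 * b z.2)) y :=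
    (hF.fderiv_right (m := ∞) (by simp)).differentiableAt (by simp)
  -- Fixing `Y` first replaces a derivative of linear maps by the derivative of a scalar function,
  -- to which the product rule applies again.
  have h0 : fderiv ℝ (fderiv ℝ (fun z : E₁ × E₂ => a z.1 * b z.2)) y X Y =
      fderiv ℝ (fun z => fderiv ℝ (fun z : E₁ × E₂ => a z.1 * b z.2) z Y) y X := by
    rw [fderiv_clm_apply hFd (differentiableAt_const Y)]
    simp
  have had : ∀ᶠ z in nhds y, DifferentiableAt ℝ a z.1 := by
    have h1 : ∀ᶠ z in nhds y.1, DifferentiableAt ℝ a z :=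
      ((ha.of_le (m := 1) (by simp)).eventually (by simp)).mono
        fun z hz => hz.differentiableAt (by simp)
    exact continuous_fst.continuousAt.eventually h1
  have hbd : ∀ᶠ z in nhds y, DifferentiableAt ℝ b z.2 := by
    have h1 : ∀ᶠ z in nhds y.2, DifferentiableAt ℝ b z :=
      ((hb.of_le (m := 1) (by simp)).eventually (by simp)).mono
        fun z hz => hz.differentiableAt (by simp)
    exact continuous_snd.continuousAt.eventually h1
  have hev : (fun z => fderiv ℝ (fun z : E₁ × E₂ => a z.1 * b z.2) z Y) =ᶠ[nhds y]
      fun z => a z.1 * fderiv ℝ b z.2 Y.2 + b z.2 * fderiv ℝ a z.1 Y.1 := by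
    filter_upwards [had, hbd] with z hza hzb
    have h1 := hza.hasFDerivAt.comp z (hasFDerivAt_fst (𝕜 := ℝ) (E := E₁) (F := E₂))
    have h2 := hzb.hasFDerivAt.comp z (hasFDerivAt_snd (𝕜 := ℝ) (E := E₁) (F := E₂))
    exact congrArg (fun A : E₁ × E₂ →L[ℝ] ℝ => A Y) (h1.mul h2).fderiv
  have ha' : HasFDerivAt (fun z => fderiv ℝ a z Y.1)
      ((ContinuousLinearMap.apply ℝ ℝ Y.1).comp (fderiv ℝ (fderiv ℝ a) y.1)) y.1 := by
    have h1 : DifferentiableAt ℝ (fderiv ℝ a) y.1 :=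
      (ha.fderiv_right (m := ∞) (by simp)).differentiableAt (by simp)
    exact (ContinuousLinearMap.apply ℝ ℝ Y.1).hasFDerivAt.comp y.1 h1.hasFDerivAt
  have hb' : HasFDerivAt (fun z => fderiv ℝ b z Y.2)
      ((ContinuousLinearMap.apply ℝ ℝ Y.2).comp (fderiv ℝ (fderiv ℝ b) y.2)) y.2 := by
    have h1 : DifferentiableAt ℝ (fderiv ℝ b) y.2 :=
      (hb.fderiv_right (m := ∞) (by simp)).differentiableAt (by simp)
    exact (ContinuousLinearMap.apply ℝ ℝ Y.2).hasFDerivAt.comp y.2 h1.hasFDerivAt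
  have e1 := (ha.differentiableAt (by simp)).hasFDerivAt.comp y
    (hasFDerivAt_fst (𝕜 := ℝ) (E := E₁) (F := E₂))
  have e2 := (hb.differentiableAt (by simp)).hasFDerivAt.comp y
    (hasFDerivAt_snd (𝕜 := ℝ) (E := E₁) (F := E₂))
  have e3 := ha'.comp y (hasFDerivAt_fst (𝕜 := ℝ) (E := E₁) (F := E₂))
  have e4 := hb'.comp y (hasFDerivAt_snd (𝕜 := ℝ) (E := E₁) (F := E₂))
  have e5 := (e1.mul e4).add (e2.mul e3)
  rw [h0, hev.fderiv_eq]
  refine (congrArg (fun A : E₁ × E₂ →L[ℝ] ℝ => A X) e5.fderiv).trans ?_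
  change (a y.1 * fderiv ℝ (fderiv ℝ b) y.2 X.2 Y.2 + fderiv ℝ b y.2 Y.2 * fderiv ℝ a y.1 X.1) +
    (b y.2 * fderiv ℝ (fderiv ℝ a) y.1 X.1 Y.1 + fderiv ℝ a y.1 Y.1 * fderiv ℝ b y.2 X.2) = _
  ring

theorem coordHessian_eq (p : M₁) (u : V₁) (X Y : E₁) : coordHessian V₁ p X Y u =
    fderiv ℝ (fderiv ℝ (fun y => u.1 ((extChartAt I₁ p).symm y))) (extChartAt I₁ p p) X Y :=
  congrArg (fun A : E₁ →L[ℝ] ℝ => A Y) (fderiv_coordDiff p X u)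

theorem fderiv_coordFun (p : M₁) (u : V₁) (X : E₁) :
    fderiv ℝ (fun y => u.1 ((extChartAt I₁ p).symm y)) (extChartAt I₁ p p) X =
      diffAt V₁ p X u := by
  rw [← coordDiff_eq_fderiv p (mem_extChartAt_target p) u, coordDiff_self]
  rfl

theorem coordHessian_tmulV (p : M₁ × M₂) (u : V₁) (v : V₂) (X Y : E₁ × E₂) :
    coordHessian (tensorSpace V₁ V₂) p X Y (tmulV V₁ V₂ u v) =
      coordHessian V₁ p.1 X.1 Y.1 u * v.1 p.2 + diffAt V₁ p.1 Y.1 u * diffAt V₂ p.2 X.2 v +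
        diffAt V₁ p.1 X.1 u * diffAt V₂ p.2 Y.2 v + u.1 p.1 * coordHessian V₂ p.2 X.2 Y.2 v := by
  have hu : ContDiffAt ℝ ∞ (fun y => u.1 ((extChartAt I₁ p.1).symm y)) (extChartAt I₁ p.1 p.1) :=
    (contDiffOn_coordFun p.1 u.1).contDiffAt (extChartAt_target_mem_nhds p.1)
  have hv : ContDiffAt ℝ ∞ (fun y => v.1 ((extChartAt I₂ p.2).symm y)) (extChartAt I₂ p.2 p.2) :=
    (contDiffOn_coordFun p.2 v.1).contDiffAt (extChartAt_target_mem_nhds p.2)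
  have h := fderiv_fderiv_mul_prod (y := (extChartAt I₁ p.1 p.1, extChartAt I₂ p.2 p.2))
    hu hv X Y
  rw [coordHessian_eq, coordHessian_eq, coordHessian_eq, extChartAt_prod_apply_self]
  have hfun : (fun y => (tmulV V₁ V₂ u v).1 ((extChartAt (I₁.prod I₂) p).symm y)) =
      fun y : E₁ × E₂ => u.1 ((extChartAt I₁ p.1).symm y.1) * v.1 ((extChartAt I₂ p.2).symm y.2) :=
    funext fun y => by rw [extChartAt_prod_symm_apply, tmulV_apply]
  rw [hfun, h]
  simp only [fderiv_coordFun, extChartAt_to_inv]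

end Dual

end Tensor

/-! ### The product of two cores -/

section Core

variable {E : Type*} [NormedAddCommGroup E] [NormedSpace ℝ E] [FiniteDimensional ℝ E]
  [MeasurableSpace E] [BorelSpace E]
  {H : Type*} [TopologicalSpace H] {I : ModelWithCorners ℝ E H} [I.Boundaryless]
  {M : Type*} [TopologicalSpace M] [ChartedSpace H M] [IsManifold I ∞ M]
  [T2Space M] [CompactSpace M] [MeasurableSpace M] [BorelSpace M]
  {g : RMetric I M} {V : Submodule ℝ (SmoothFun g)} [FiniteDimensional ℝ V]
  {ι : Type*} [Fintype ι] [DecidableEq ι] {p : M} {f : ι → TangentSpace I p}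
  {L : Submodule ℝ V} {w : V}

theorem IsCore.hatSpace_le_critSpace (h : IsCore g V p f L w) :
    hatSpace L w ≤ critSpace V p :=
  sup_le h.le_critSpace ((Submodule.span_singleton_le_iff_mem _ _).2 h.mem_critSpace)

/-- (P₄) says that `ev_p` is orthogonal to `L̂ᗮ`, and a finite dimensional subspace is its own
double complement. -/
theorem IsCore.evVec_mem_hatSpace (h : IsCore g V p f L w) : evVec V p ∈ hatSpace L w := by
  rw [← Submodule.orthogonal_orthogonal (hatSpace L w), Submodule.mem_orthogonal']
  intro v hv
  rw [inner_evVec, h.eval_eq_zero v hv]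

theorem IsCore.evVec_mem_critSpace (h : IsCore g V p f L w) : evVec V p ∈ critSpace V p :=
  h.hatSpace_le_critSpace h.evVec_mem_hatSpace

theorem IsCore.evVec_ne_zero (h : IsCore g V p f L w) : evVec V p ≠ 0 := fun h0 => by
  have := inner_evVec V p w
  rw [h0, inner_zero_left] at this
  exact h.eval_ne_zero this.symm

/-- As an element of `V`, `ev_p` has a critical point at `p`. This kills the mixed inner products
between the two halves of the product frame. -/
theorem IsCore.inner_adjunctionDual_evVec (h : IsCore g V p f L w) (X : TangentSpace I p) :
    inner ℝ (adjunctionDual V p X) (evVec V p) = 0 := by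
  have h0 : adjunction V p (evVec V p) = 0 := h.evVec_mem_critSpace
  rw [inner_adjunctionDual, h0]
  rfl

theorem IsCore.apply_eq_zero_of_mem_orthogonal (h : IsCore g V p f L w) {v : V}
    (hv : v ∈ (critSpace V p)ᗮ) : v.1 p = 0 := by
  rw [← inner_evVec]
  exact (Submodule.mem_orthogonal _ _).1 hv _ h.evVec_mem_critSpace

theorem adjunctionDual_mem_orthogonal (X : TangentSpace I p) :
    adjunctionDual V p X ∈ (critSpace V p)ᗮ := by
  rw [Submodule.mem_orthogonal']
  intro v hv
  have h0 : adjunction V p v = 0 := hv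
  rw [inner_adjunctionDual, h0]
  rfl

/-- The entries of the Hessian are represented by elements of `L`. -/
theorem IsCore.exists_hessian_eq_inner (h : IsCore g V p f L w) (r s : ι) :
    ∃ k ∈ L, ∀ v : V, hessian p f v.1 r s = inner ℝ k v := by
  refine ⟨riesz ((Matrix.entryLinearMap ℝ ℝ r s).comp (hessianMap V p f)), ?_, fun v => ?_⟩
  · rw [← Submodule.orthogonal_orthogonal L, Submodule.mem_orthogonal']
    intro v hv
    rw [inner_riesz]
    change hessian p f v.1 r s = 0
    rw [h.hessian_eq_zero v hv]
    rfl
  · rw [inner_riesz]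
    rfl

end Core

section Product

variable {E₁ : Type*} [NormedAddCommGroup E₁] [NormedSpace ℝ E₁] [FiniteDimensional ℝ E₁]
  [MeasurableSpace E₁] [BorelSpace E₁]
  {H₁ : Type*} [TopologicalSpace H₁] {I₁ : ModelWithCorners ℝ E₁ H₁} [I₁.Boundaryless]
  {M₁ : Type*} [TopologicalSpace M₁] [ChartedSpace H₁ M₁] [IsManifold I₁ ∞ M₁]
  [T2Space M₁] [SecondCountableTopology M₁] [CompactSpace M₁] [MeasurableSpace M₁] [BorelSpace M₁]
  {E₂ : Type*} [NormedAddCommGroup E₂] [NormedSpace ℝ E₂] [FiniteDimensional ℝ E₂]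
  [MeasurableSpace E₂] [BorelSpace E₂]
  {H₂ : Type*} [TopologicalSpace H₂] {I₂ : ModelWithCorners ℝ E₂ H₂} [I₂.Boundaryless]
  {M₂ : Type*} [TopologicalSpace M₂] [ChartedSpace H₂ M₂] [IsManifold I₂ ∞ M₂]
  [T2Space M₂] [SecondCountableTopology M₂] [CompactSpace M₂] [MeasurableSpace M₂] [BorelSpace M₂]
  {g₁ : RMetric I₁ M₁} {g₂ : RMetric I₂ M₂}
  {V₁ : Submodule ℝ (SmoothFun g₁)} {V₂ : Submodule ℝ (SmoothFun g₂)}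
  [FiniteDimensional ℝ V₁] [FiniteDimensional ℝ V₂]
  {ι₁ : Type*} [Fintype ι₁] [DecidableEq ι₁] {ι₂ : Type*} [Fintype ι₂] [DecidableEq ι₂]
  {p₁ : M₁} {f₁ : ι₁ → TangentSpace I₁ p₁} {L₁ : Submodule ℝ V₁} {w₁ : V₁}
  {p₂ : M₂} {f₂ : ι₂ → TangentSpace I₂ p₂} {L₂ : Submodule ℝ V₂} {w₂ : V₂}

theorem isOrthonormalFrame_prodFrame (h₁ : IsOrthonormalFrame g₁ p₁ f₁)
    (h₂ : IsOrthonormalFrame g₂ p₂ f₂) :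
    IsOrthonormalFrame (prodMetric g₁ g₂) (p₁, p₂) (prodFrame f₁ f₂) := by
  constructor
  · intro r s
    refine (prodInner_apply g₁ g₂ (p₁, p₂) _ _).trans ?_
    have z₁ : ∀ X : E₁, g₁.inner p₁ X 0 = 0 := fun X => map_zero (g₁.inner p₁ X)
    have z₁' : ∀ X : E₁, g₁.inner p₁ 0 X = 0 := fun X => by rw [map_zero]; rfl
    have z₂ : ∀ X : E₂, g₂.inner p₂ X 0 = 0 := fun X => map_zero (g₂.inner p₂ X)
    have z₂' : ∀ X : E₂, g₂.inner p₂ 0 X = 0 := fun X => by rw [map_zero]; rfl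
    rcases r with r | r <;> rcases s with s | s
    · refine (congrArg₂ (· + ·) (h₁.1 r s) (z₂ 0)).trans ?_
      simp
    · refine (congrArg₂ (· + ·) (z₁ (f₁ r)) (z₂' (f₂ s))).trans ?_
      simp
    · refine (congrArg₂ (· + ·) (z₁' (f₁ s)) (z₂ (f₂ r))).trans ?_
      simp
    · refine (congrArg₂ (· + ·) (z₁ 0) (h₂.1 r s)).trans ?_
      simp
  · have e₁ : (⊤ : Submodule ℝ E₁).map (LinearMap.inl ℝ E₁ E₂) ≤
        Submodule.span ℝ (Set.range (prodFrame f₁ f₂) : Set (E₁ × E₂)) := by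
      have : (⊤ : Submodule ℝ E₁) = Submodule.span ℝ (Set.range f₁ : Set E₁) := h₁.2.symm
      rw [this, Submodule.map_span_le]
      rintro _ ⟨r, rfl⟩
      exact Submodule.subset_span ⟨Sum.inl r, rfl⟩
    have e₂ : (⊤ : Submodule ℝ E₂).map (LinearMap.inr ℝ E₁ E₂) ≤
        Submodule.span ℝ (Set.range (prodFrame f₁ f₂) : Set (E₁ × E₂)) := by
      have : (⊤ : Submodule ℝ E₂) = Submodule.span ℝ (Set.range f₂ : Set E₂) := h₂.2.symm
      rw [this, Submodule.map_span_le]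
      rintro _ ⟨r, rfl⟩
      exact Submodule.subset_span ⟨Sum.inr r, rfl⟩
    refine Submodule.eq_top_iff'.2 fun X => ?_
    have hX : X = (((X : E₁ × E₂).1, 0) + (0, (X : E₁ × E₂).2) : E₁ × E₂) := by
      exact Prod.ext (add_zero _).symm (zero_add _).symm
    rw [hX]
    exact Submodule.add_mem (R := ℝ) (M := E₁ × E₂) _
      (e₁ (Submodule.mem_map_of_mem (f := LinearMap.inl ℝ E₁ E₂) Submodule.mem_top))
      (e₂ (Submodule.mem_map_of_mem (f := LinearMap.inr ℝ E₁ E₂) Submodule.mem_top))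

theorem adjunctionDual_prodFrame_inl (r : ι₁) :
    adjunctionDual (tensorSpace V₁ V₂) (p₁, p₂) (prodFrame f₁ f₂ (Sum.inl r)) =
      tmulV V₁ V₂ (adjunctionDual V₁ p₁ (f₁ r)) (evVec V₂ p₂) := by
  refine (adjunctionDual_tensor _ _).trans ?_
  have h : adjunctionDual V₂ p₂ (0 : E₂) = 0 := map_zero (adjunctionDual V₂ p₂)
  change tmulV V₁ V₂ (adjunctionDual V₁ p₁ (f₁ r)) (evVec V₂ p₂) +
    tmulV V₁ V₂ (evVec V₁ p₁) (adjunctionDual V₂ p₂ (0 : E₂)) = _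
  rw [h, map_zero, add_zero]

theorem adjunctionDual_prodFrame_inr (s : ι₂) :
    adjunctionDual (tensorSpace V₁ V₂) (p₁, p₂) (prodFrame f₁ f₂ (Sum.inr s)) =
      tmulV V₁ V₂ (evVec V₁ p₁) (adjunctionDual V₂ p₂ (f₂ s)) := by
  refine (adjunctionDual_tensor _ _).trans ?_
  have h : adjunctionDual V₁ p₁ (0 : E₁) = 0 := map_zero (adjunctionDual V₁ p₁)
  change tmulV V₁ V₂ (adjunctionDual V₁ p₁ (0 : E₁)) (evVec V₂ p₂) +
    tmulV V₁ V₂ (evVec V₁ p₁) (adjunctionDual V₂ p₂ (f₂ s)) = _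
  rw [h, map_zero, LinearMap.zero_apply, zero_add]

theorem diffAt_zero (p : M₁) (v : V₁) : diffAt V₁ p (0 : E₁) v = 0 :=
  map_zero (adjunction V₁ p v)

theorem coordHessian_zero_left (p : M₁) (X : E₁) (v : V₁) : coordHessian V₁ p 0 X v = 0 := by
  change fderiv ℝ (coordDiff V₁ p) (extChartAt I₁ p p) 0 v X = 0
  rw [map_zero]
  rfl

theorem coordHessian_zero_right (p : M₁) (X : E₁) (v : V₁) : coordHessian V₁ p X 0 v = 0 :=
  map_zero (fderiv ℝ (coordDiff V₁ p) (extChartAt I₁ p p) X v)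

/-- The frames are taken in the model spaces so that the pairs `(f, 0)` and `(0, f)` are ordinary
vectors. In a diagonal block only the Christoffel symbols of that factor survive; in a mixed block
none do, and the Leibniz rule leaves a product of first derivatives. -/
theorem hessian_tmulV_coord (f₁ : ι₁ → E₁) (f₂ : ι₂ → E₂) (u : V₁) (v : V₂) :
    hessian (p₁, p₂) (prodFrame (p₁ := p₁) (p₂ := p₂) f₁ f₂) (tmulV V₁ V₂ u v).1 =
      Matrix.fromBlocks (v.1 p₂ • hessian p₁ f₁ u.1)
        (Matrix.of fun r s => diffAt V₁ p₁ (f₁ r) u * diffAt V₂ p₂ (f₂ s) v)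
        (Matrix.of fun s r => diffAt V₁ p₁ (f₁ r) u * diffAt V₂ p₂ (f₂ s) v)
        (u.1 p₁ • hessian p₂ f₂ v.1) := by
  have hd : ∀ X : E₁ × E₂, diffAt (tensorSpace V₁ V₂) (p₁, p₂) X (tmulV V₁ V₂ u v) =
      diffAt V₁ p₁ X.1 u * v.1 p₂ + u.1 p₁ * diffAt V₂ p₂ X.2 v :=
    adjunction_tmulV (p₁, p₂) u v
  have key : ∀ i j, hessian (p₁, p₂) (prodFrame (p₁ := p₁) (p₂ := p₂) f₁ f₂) (tmulV V₁ V₂ u v).1 i j =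
      coordHessian (tensorSpace V₁ V₂) (p₁, p₂) (prodFrame (I₁ := I₁) (I₂ := I₂) (p₁ := p₁) (p₂ := p₂) f₁ f₂ i) (prodFrame (I₁ := I₁) (I₂ := I₂) (p₁ := p₁) (p₂ := p₂) f₁ f₂ j)
        (tmulV V₁ V₂ u v) -
      ((∑ t, christoffel (prodMetric g₁ g₂) (p₁, p₂) (prodFrame (I₁ := I₁) (I₂ := I₂) (p₁ := p₁) (p₂ := p₂) f₁ f₂ i) (prodFrame (I₁ := I₁) (I₂ := I₂) (p₁ := p₁) (p₂ := p₂) f₁ f₂ j)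
        ((f₁ t, 0) : E₁ × E₂) * diffAt (tensorSpace V₁ V₂) (p₁, p₂) ((f₁ t, 0) : E₁ × E₂)
        (tmulV V₁ V₂ u v)) +
      ∑ t, christoffel (prodMetric g₁ g₂) (p₁, p₂) (prodFrame (I₁ := I₁) (I₂ := I₂) (p₁ := p₁) (p₂ := p₂) f₁ f₂ i) (prodFrame (I₁ := I₁) (I₂ := I₂) (p₁ := p₁) (p₂ := p₂) f₁ f₂ j)
        ((0, f₂ t) : E₁ × E₂) * diffAt (tensorSpace V₁ V₂) (p₁, p₂) ((0, f₂ t) : E₁ × E₂)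
        (tmulV V₁ V₂ u v)) := fun i j => by
    refine (hessian_apply _ _ _).trans ?_
    rw [Fintype.sum_sum_type]
    rfl
  ext i j
  rw [key]
  rcases i with r | r <;> rcases j with s | s
  · rw [Matrix.fromBlocks_apply₁₁, Matrix.smul_apply, hessian_apply (p := p₁) (f := f₁) u r s]
    change coordHessian (tensorSpace V₁ V₂) (p₁, p₂) ((f₁ r, 0) : E₁ × E₂) ((f₁ s, 0) : E₁ × E₂)
        (tmulV V₁ V₂ u v) -
      ((∑ t, christoffel (prodMetric g₁ g₂) (p₁, p₂) ((f₁ r, 0) : E₁ × E₂)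
        ((f₁ s, 0) : E₁ × E₂) ((f₁ t, 0) : E₁ × E₂) * _) +
      ∑ t, christoffel (prodMetric g₁ g₂) (p₁, p₂) ((f₁ r, 0) : E₁ × E₂)
        ((f₁ s, 0) : E₁ × E₂) ((0, f₂ t) : E₁ × E₂) * _) = _
    simp only [coordHessian_tmulV, hd, christoffel_prod, christoffel_zero_right,
      christoffel_zero_left, diffAt_zero, coordHessian_zero_left, mul_zero, zero_mul, add_zero,
      Finset.sum_const_zero, smul_eq_mul, mul_sub, Finset.mul_sum]
    congr 1
    · exact mul_comm _ _
    · exact Finset.sum_congr rfl fun t _ => by ring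
  · rw [Matrix.fromBlocks_apply₁₂, Matrix.of_apply]
    change coordHessian (tensorSpace V₁ V₂) (p₁, p₂) ((f₁ r, 0) : E₁ × E₂) ((0, f₂ s) : E₁ × E₂)
        (tmulV V₁ V₂ u v) -
      ((∑ t, christoffel (prodMetric g₁ g₂) (p₁, p₂) ((f₁ r, 0) : E₁ × E₂)
        ((0, f₂ s) : E₁ × E₂) ((f₁ t, 0) : E₁ × E₂) * _) +
      ∑ t, christoffel (prodMetric g₁ g₂) (p₁, p₂) ((f₁ r, 0) : E₁ × E₂)
        ((0, f₂ s) : E₁ × E₂) ((0, f₂ t) : E₁ × E₂) * _) = _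
    simp only [coordHessian_tmulV, christoffel_prod, christoffel_zero_left,
      christoffel_zero_middle, diffAt_zero, coordHessian_zero_left, coordHessian_zero_right,
      mul_zero, zero_mul, add_zero, zero_add, Finset.sum_const_zero, sub_zero]
  · rw [Matrix.fromBlocks_apply₂₁, Matrix.of_apply]
    change coordHessian (tensorSpace V₁ V₂) (p₁, p₂) ((0, f₂ r) : E₁ × E₂) ((f₁ s, 0) : E₁ × E₂)
        (tmulV V₁ V₂ u v) -
      ((∑ t, christoffel (prodMetric g₁ g₂) (p₁, p₂) ((0, f₂ r) : E₁ × E₂)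
        ((f₁ s, 0) : E₁ × E₂) ((f₁ t, 0) : E₁ × E₂) * _) +
      ∑ t, christoffel (prodMetric g₁ g₂) (p₁, p₂) ((0, f₂ r) : E₁ × E₂)
        ((f₁ s, 0) : E₁ × E₂) ((0, f₂ t) : E₁ × E₂) * _) = _
    simp only [coordHessian_tmulV, christoffel_prod, christoffel_zero_left,
      christoffel_zero_middle, diffAt_zero, coordHessian_zero_left, coordHessian_zero_right,
      mul_zero, zero_mul, add_zero, zero_add, Finset.sum_const_zero, sub_zero]
  · rw [Matrix.fromBlocks_apply₂₂, Matrix.smul_apply, hessian_apply (p := p₂) (f := f₂) v r s]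
    change coordHessian (tensorSpace V₁ V₂) (p₁, p₂) ((0, f₂ r) : E₁ × E₂) ((0, f₂ s) : E₁ × E₂)
        (tmulV V₁ V₂ u v) -
      ((∑ t, christoffel (prodMetric g₁ g₂) (p₁, p₂) ((0, f₂ r) : E₁ × E₂)
        ((0, f₂ s) : E₁ × E₂) ((f₁ t, 0) : E₁ × E₂) * _) +
      ∑ t, christoffel (prodMetric g₁ g₂) (p₁, p₂) ((0, f₂ r) : E₁ × E₂)
        ((0, f₂ s) : E₁ × E₂) ((0, f₂ t) : E₁ × E₂) * _) = _
    simp only [coordHessian_tmulV, hd, christoffel_prod, christoffel_zero_right,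
      christoffel_zero_left, diffAt_zero, coordHessian_zero_left, mul_zero, zero_mul, zero_add,
      Finset.sum_const_zero, smul_eq_mul, mul_sub, Finset.mul_sum]
    congr 1
    exact Finset.sum_congr rfl fun t _ => by ring

/-- The Hessian of `u ⊗ v` as a block matrix. -/
theorem hessian_tmulV (u : V₁) (v : V₂) :
    hessian (p₁, p₂) (prodFrame f₁ f₂) (tmulV V₁ V₂ u v).1 =
      Matrix.fromBlocks (v.1 p₂ • hessian p₁ f₁ u.1)
        (Matrix.of fun r s => diffAt V₁ p₁ (f₁ r) u * diffAt V₂ p₂ (f₂ s) v)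
        (Matrix.of fun s r => diffAt V₁ p₁ (f₁ r) u * diffAt V₂ p₂ (f₂ s) v)
        (u.1 p₁ • hessian p₂ f₂ v.1) :=
  hessian_tmulV_coord (E₁ := E₁) (E₂ := E₂) f₁ f₂ u v

theorem tensorSub_mono {W₁ W₁' : Submodule ℝ V₁} {W₂ W₂' : Submodule ℝ V₂} (h₁ : W₁ ≤ W₁')
    (h₂ : W₂ ≤ W₂') : tensorSub W₁ W₂ ≤ tensorSub W₁' W₂' :=
  Submodule.map₂_le_map₂ h₁ h₂

variable (h₁ : IsCore g₁ V₁ p₁ f₁ L₁ w₁) (h₂ : IsCore g₂ V₂ p₂ f₂ L₂ w₂)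
include h₁ h₂

/-- The first summand lies in `L̂₁ ⊗ L̂₂` with `L̂₁ ⊂ K_{p₁}`, so orthogonality already holds in the
first factor. -/
theorem starSpace_isOrtho :
    Submodule.IsOrtho (𝕜 := ℝ) (E := tensorSpace V₁ V₂) (starSpace L₁ w₁ L₂ w₂)
      (tensorSub (critSpace V₁ p₁)ᗮ (critSpace V₂ p₂)ᗮ) :=
  (tensorSub_orthogonal (Submodule.isOrtho_orthogonal_right (critSpace V₁ p₁))
    (hatSpace L₂ w₂) (critSpace V₂ p₂)ᗮ).mono_left
    (inf_le_left.trans (tensorSub_mono h₁.hatSpace_le_critSpace le_rfl))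

omit h₁ h₂ in
theorem tensorSub_hatSpace_le : tensorSub (hatSpace L₁ w₁) (hatSpace L₂ w₂) ≤
    starSpace L₁ w₁ L₂ w₂ ⊔ Submodule.span ℝ {tmulV V₁ V₂ w₁ w₂} := by
  have hw : Submodule.span ℝ {tmulV V₁ V₂ w₁ w₂} ≤
      tensorSub (hatSpace L₁ w₁) (hatSpace L₂ w₂) := by
    rw [Submodule.span_singleton_le_iff_mem]
    exact tmulV_mem_tensorSub (Submodule.mem_sup_right (Submodule.mem_span_singleton_self _))
      (Submodule.mem_sup_right (Submodule.mem_span_singleton_self _))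
  have h := Submodule.sup_orthogonal_inf_of_hasOrthogonalProjection hw
  rw [sup_comm, inf_comm] at h
  exact h.ge

/-- The elements `ev_{p_α}` lie in `L̂_α ⊂ K_{p_α}`, so mixed inner products vanish for (P₁) and
functions in `K_{p_α}ᗮ` vanish at `p_α`, which puts `K_{p₁}ᗮ ⊗ K_{p₂}ᗮ` among the critical
functions. For (P₄), evaluation at the pair is represented by `ev ⊗ ev` in `L̂₁ ⊗ L̂₂`, which is
contained in the sum of `L₁ * L₂` and the span of `w`. -/
theorem IsCore.prod : IsCore (prodMetric g₁ g₂) (tensorSpace V₁ V₂) (p₁, p₂) (prodFrame f₁ f₂)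
    (starSpace L₁ w₁ L₂ w₂ ⊔ tensorSub (critSpace V₁ p₁)ᗮ (critSpace V₂ p₂)ᗮ)
    (tmulV V₁ V₂ w₁ w₂) where
  frame := isOrthonormalFrame_prodFrame h₁.frame h₂.frame
  orthogonal := by
    rintro (r | r) (s | s) hrs
    · rw [adjunctionDual_prodFrame_inl, adjunctionDual_prodFrame_inl, inner_tmulV,
        h₁.orthogonal r s fun h => hrs (congrArg _ h), zero_mul]
    · rw [adjunctionDual_prodFrame_inl, adjunctionDual_prodFrame_inr, inner_tmulV,
        h₁.inner_adjunctionDual_evVec, zero_mul]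
    · rw [adjunctionDual_prodFrame_inl, adjunctionDual_prodFrame_inr, inner_tmulV,
        h₂.inner_adjunctionDual_evVec, mul_zero]
    · rw [adjunctionDual_prodFrame_inr, adjunctionDual_prodFrame_inr, inner_tmulV,
        h₂.orthogonal r s fun h => hrs (congrArg _ h), mul_zero]
  le_critSpace := by
    refine sup_le (inf_le_left.trans (Submodule.map₂_le.2 fun u hu v hv => ?_))
      (Submodule.map₂_le.2 fun u hu v hv => ?_)
    · have hu' : adjunction V₁ p₁ u = 0 := h₁.hatSpace_le_critSpace hu
      have hv' : adjunction V₂ p₂ v = 0 := h₂.hatSpace_le_critSpace hv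
      refine LinearMap.mem_ker.2 (ContinuousLinearMap.ext fun X => ?_)
      refine (adjunction_tmulV (p₁, p₂) u v X).trans ?_
      rw [hu', hv']
      exact (congrArg₂ (· + ·) (zero_mul _) (mul_zero _)).trans (add_zero 0)
    · refine LinearMap.mem_ker.2 (ContinuousLinearMap.ext fun X => ?_)
      refine (adjunction_tmulV (p₁, p₂) u v X).trans ?_
      rw [h₁.apply_eq_zero_of_mem_orthogonal hu, h₂.apply_eq_zero_of_mem_orthogonal hv]
      exact (congrArg₂ (· + ·) (mul_zero _) (zero_mul _)).trans (add_zero 0)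
  hessian_eq_zero := by
    intro z hz
    -- Each Hessian entry is represented by an element of the new `L`. Diagonal blocks use `k ⊗ ev`
    -- or `ev ⊗ k` with `k` in `L_α`, orthogonal to `w₁ ⊗ w₂` because `w_α` is orthogonal to `k`;
    -- mixed blocks use `A^† f_r ⊗ A^† f_s`.
    have key : ∀ i j, ∃ k ∈ starSpace L₁ w₁ L₂ w₂ ⊔
        tensorSub (critSpace V₁ p₁)ᗮ (critSpace V₂ p₂)ᗮ, ∀ u v, inner ℝ k (tmulV V₁ V₂ u v) =
        hessian (p₁, p₂) (prodFrame f₁ f₂) (tmulV V₁ V₂ u v).1 i j := by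
      rintro (r | r) (s | s)
      · obtain ⟨k, hk, hkv⟩ := h₁.exists_hessian_eq_inner r s
        refine ⟨tmulV V₁ V₂ k (evVec V₂ p₂), Submodule.mem_sup_left ⟨tmulV_mem_tensorSub
          (Submodule.mem_sup_left hk) h₂.evVec_mem_hatSpace, ?_⟩, fun u v => ?_⟩
        · rw [SetLike.mem_coe, Submodule.mem_orthogonal_singleton_iff_inner_left, inner_tmulV,
            (Submodule.mem_orthogonal _ _).1 h₁.mem_orthogonal k hk, zero_mul]
        · rw [hessian_tmulV, Matrix.fromBlocks_apply₁₁, Matrix.smul_apply, hkv, inner_tmulV,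
            inner_evVec, smul_eq_mul, mul_comm]
      · refine ⟨tmulV V₁ V₂ (adjunctionDual V₁ p₁ (f₁ r)) (adjunctionDual V₂ p₂ (f₂ s)),
          Submodule.mem_sup_right (tmulV_mem_tensorSub (adjunctionDual_mem_orthogonal _)
            (adjunctionDual_mem_orthogonal _)), fun u v => ?_⟩
        rw [hessian_tmulV, Matrix.fromBlocks_apply₁₂, Matrix.of_apply, inner_tmulV,
          inner_adjunctionDual, inner_adjunctionDual]
        rfl
      · refine ⟨tmulV V₁ V₂ (adjunctionDual V₁ p₁ (f₁ s)) (adjunctionDual V₂ p₂ (f₂ r)),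
          Submodule.mem_sup_right (tmulV_mem_tensorSub (adjunctionDual_mem_orthogonal _)
            (adjunctionDual_mem_orthogonal _)), fun u v => ?_⟩
        rw [hessian_tmulV, Matrix.fromBlocks_apply₂₁, Matrix.of_apply, inner_tmulV,
          inner_adjunctionDual, inner_adjunctionDual]
        rfl
      · obtain ⟨k, hk, hkv⟩ := h₂.exists_hessian_eq_inner r s
        refine ⟨tmulV V₁ V₂ (evVec V₁ p₁) k, Submodule.mem_sup_left ⟨tmulV_mem_tensorSub
          h₁.evVec_mem_hatSpace (Submodule.mem_sup_left hk), ?_⟩, fun u v => ?_⟩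
        · rw [SetLike.mem_coe, Submodule.mem_orthogonal_singleton_iff_inner_left, inner_tmulV,
            (Submodule.mem_orthogonal _ _).1 h₂.mem_orthogonal k hk, mul_zero]
        · rw [hessian_tmulV, Matrix.fromBlocks_apply₂₂, Matrix.smul_apply, hkv, inner_tmulV,
            inner_evVec, smul_eq_mul]
    ext i j
    obtain ⟨k, hk, hkv⟩ := key i j
    have h : innerₛₗ ℝ k = (Matrix.entryLinearMap ℝ ℝ i j).comp
        (hessianMap (tensorSpace V₁ V₂) (p₁, p₂) (prodFrame f₁ f₂)) := tensor_hom_ext hkv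
    have h' := LinearMap.congr_fun h z
    rw [innerₛₗ_apply_apply, (Submodule.mem_orthogonal _ _).1 hz k hk] at h'
    exact h'.symm
  mem_critSpace := by
    have hu' : adjunction V₁ p₁ w₁ = 0 := h₁.mem_critSpace
    have hv' : adjunction V₂ p₂ w₂ = 0 := h₂.mem_critSpace
    refine LinearMap.mem_ker.2 (ContinuousLinearMap.ext fun X => ?_)
    refine (adjunction_tmulV (p₁, p₂) w₁ w₂ X).trans ?_
    rw [hu', hv']
    exact (congrArg₂ (· + ·) (zero_mul _) (mul_zero _)).trans (add_zero 0)
  mem_orthogonal := by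
    rw [← Submodule.inf_orthogonal]
    refine ⟨?_, ?_⟩
    · have h : starSpace L₁ w₁ L₂ w₂ ≤ (Submodule.span ℝ {tmulV V₁ V₂ w₁ w₂})ᗮ := inf_le_right
      exact Submodule.orthogonal_le h
        (Submodule.le_orthogonal_orthogonal _ (Submodule.mem_span_singleton_self _))
    · have h := tensorSub_orthogonal (Submodule.isOrtho_orthogonal_right (critSpace V₁ p₁))
        (critSpace V₂ p₂) (critSpace V₂ p₂)ᗮ
      exact h (tmulV_mem_tensorSub h₁.mem_critSpace h₂.mem_critSpace)
  eval_ne_zero := mul_ne_zero h₁.eval_ne_zero h₂.eval_ne_zero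
  norm_eq_one := by rw [norm_tmulV, h₁.norm_eq_one, h₂.norm_eq_one, one_mul]
  eval_eq_zero := by
    intro v hv
    rw [← inner_evVec, evVec_tensor]
    refine (Submodule.mem_orthogonal _ _).1 hv _ ?_
    have h := tensorSub_hatSpace_le (tmulV_mem_tensorSub h₁.evVec_mem_hatSpace
      h₂.evVec_mem_hatSpace)
    have hle : starSpace L₁ w₁ L₂ w₂ ⊔ Submodule.span ℝ {tmulV V₁ V₂ w₁ w₂} ≤
        hatSpace (starSpace L₁ w₁ L₂ w₂ ⊔ tensorSub (critSpace V₁ p₁)ᗮ (critSpace V₂ p₂)ᗮ)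
          (tmulV V₁ V₂ w₁ w₂) := sup_le_sup_right le_sup_left _
    exact hle h

end Product

/-! ### The Jacobian of the dual adjunction map -/

/-- The Jacobian may be computed in any orthonormal basis. -/
theorem jacobian_eq {U W ι : Type*} [NormedAddCommGroup U] [InnerProductSpace ℝ U]
    [FiniteDimensional ℝ U] [NormedAddCommGroup W] [InnerProductSpace ℝ W] [Fintype ι]
    [DecidableEq ι] (T : U →ₗ[ℝ] W) (b : OrthonormalBasis ι ℝ U) :
    jacobian T = Real.sqrt (Matrix.of fun i j => inner ℝ (T (b i)) (T (b j))).det := by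
  let β : U →L[ℝ] U →L[ℝ] ℝ := LinearMap.toContinuousLinearMap
    (LinearMap.toContinuousLinearMap.toLinearMap ∘ₗ ((innerₗ W).compl₁₂ T T))
  let e : ι ≃ Fin (Module.finrank ℝ U) := b.toBasis.indexEquiv (stdOrthonormalBasis ℝ U).toBasis
  have h1 : (Matrix.of fun i j => inner ℝ (T (stdOrthonormalBasis ℝ U i))
      (T (stdOrthonormalBasis ℝ U j))) = gramMatrix β (stdOrthonormalBasis ℝ U) := rfl
  have h2 : (Matrix.of fun i j => inner ℝ (T (b i)) (T (b j))) =
      gramMatrix β b := rfl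
  have h3 : (b : ι → U) = (b.reindex e) ∘ e := by
    funext i
    simp
  rw [jacobian, h1, h2, h3, det_gramMatrix_comp β e]
  have h4 := sqrt_det_gramMatrix β (stdOrthonormalBasis ℝ U).toBasis (b.reindex e)
  rw [h4]
  have h5 : |(stdOrthonormalBasis ℝ U).toBasis.det (b.reindex e)| = 1 := by
    rcases (stdOrthonormalBasis ℝ U).det_to_matrix_orthonormalBasis_real (b.reindex e) with h | h
    · rw [h, abs_one]
    · rw [h, abs_neg, abs_one]
  rw [h5, one_mul, OrthonormalBasis.coe_toBasis]

section Dual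

variable {E : Type*} [NormedAddCommGroup E] [NormedSpace ℝ E] [FiniteDimensional ℝ E]
  [MeasurableSpace E] [BorelSpace E]
  {H : Type*} [TopologicalSpace H] {I : ModelWithCorners ℝ E H} [I.Boundaryless]
  {M : Type*} [TopologicalSpace M] [ChartedSpace H M] [IsManifold I ∞ M]
  [T2Space M] [CompactSpace M] [MeasurableSpace M] [BorelSpace M]
  {g : RMetric I M} {V : Submodule ℝ (SmoothFun g)} [FiniteDimensional ℝ V]
  {ι : Type*} [Fintype ι] [DecidableEq ι] {p : M} {f : ι → TangentSpace I p}

open Bundle in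
-- (P₁) makes the Gram matrix diagonal in the frame, and the Jacobian does not depend on the
-- orthonormal basis.
theorem jacobianDual_eq_prod (hf : IsOrthonormalFrame g p f)
    (ho : ∀ r s, r ≠ s → inner ℝ (adjunctionDual V p (f r)) (adjunctionDual V p (f s)) = 0) :
    jacobianDual V p = ∏ r, ‖adjunctionDual V p (f r)‖ := by
  let : RiemannianBundle (fun y : M => TangentSpace I y) := ⟨g.toRiemannianMetric⟩
  have : FiniteDimensional ℝ (TangentSpace I p) := inferInstanceAs (FiniteDimensional ℝ E)
  have hon : Orthonormal ℝ f := by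
    rw [orthonormal_iff_ite]
    exact hf.1
  have h := jacobian_eq (adjunctionDual V p) (OrthonormalBasis.mk hon hf.2.ge)
  refine (show jacobianDual V p = jacobian (adjunctionDual V p) from rfl).trans (h.trans ?_)
  have hdiag : (Matrix.of fun r s => inner ℝ (adjunctionDual V p (f r))
      (adjunctionDual V p (f s))) =
      Matrix.diagonal fun r => ‖adjunctionDual V p (f r)‖ ^ 2 := by
    ext r s
    rw [Matrix.of_apply]
    rcases eq_or_ne r s with rfl | hrs
    · rw [Matrix.diagonal_apply_eq, real_inner_self_eq_norm_sq]
    · rw [Matrix.diagonal_apply_ne _ hrs, ho r s hrs]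
  rw [OrthonormalBasis.coe_mk, hdiag, Matrix.det_diagonal, Finset.prod_pow,
    Real.sqrt_sq (Finset.prod_nonneg fun r _ => norm_nonneg _)]

end Dual

section Product

variable {E₁ : Type*} [NormedAddCommGroup E₁] [NormedSpace ℝ E₁] [FiniteDimensional ℝ E₁]
  [MeasurableSpace E₁] [BorelSpace E₁]
  {H₁ : Type*} [TopologicalSpace H₁] {I₁ : ModelWithCorners ℝ E₁ H₁} [I₁.Boundaryless]
  {M₁ : Type*} [TopologicalSpace M₁] [ChartedSpace H₁ M₁] [IsManifold I₁ ∞ M₁]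
  [T2Space M₁] [SecondCountableTopology M₁] [CompactSpace M₁] [MeasurableSpace M₁] [BorelSpace M₁]
  {E₂ : Type*} [NormedAddCommGroup E₂] [NormedSpace ℝ E₂] [FiniteDimensional ℝ E₂]
  [MeasurableSpace E₂] [BorelSpace E₂]
  {H₂ : Type*} [TopologicalSpace H₂] {I₂ : ModelWithCorners ℝ E₂ H₂} [I₂.Boundaryless]
  {M₂ : Type*} [TopologicalSpace M₂] [ChartedSpace H₂ M₂] [IsManifold I₂ ∞ M₂]
  [T2Space M₂] [SecondCountableTopology M₂] [CompactSpace M₂] [MeasurableSpace M₂] [BorelSpace M₂]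
  {g₁ : RMetric I₁ M₁} {g₂ : RMetric I₂ M₂}
  {V₁ : Submodule ℝ (SmoothFun g₁)} {V₂ : Submodule ℝ (SmoothFun g₂)}
  [FiniteDimensional ℝ V₁] [FiniteDimensional ℝ V₂]
  {ι₁ : Type*} [Fintype ι₁] [DecidableEq ι₁] {ι₂ : Type*} [Fintype ι₂] [DecidableEq ι₂]
  {p₁ : M₁} {f₁ : ι₁ → TangentSpace I₁ p₁} {L₁ : Submodule ℝ V₁} {w₁ : V₁}
  {p₂ : M₂} {f₂ : ι₂ → TangentSpace I₂ p₂} {L₂ : Submodule ℝ V₂} {w₂ : V₂}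

theorem norm_evVec_tensor (x : M₁ × M₂) : ‖evVec (tensorSpace V₁ V₂) x‖ =
    ‖evVec V₁ x.1‖ * ‖evVec V₂ x.2‖ := by
  rw [evVec_tensor, norm_tmulV]

/-- The vectors of the product frame are sent to `A^† f_r ⊗ ev` and `ev ⊗ A^† f_s`, so the product
of lengths gains the factor `|ev₂| ^ m₁ |ev₁| ^ m₂`. The stated quotient is this factor, as neither
evaluation vector vanishes. -/
theorem jacobianDual_tensor (h₁ : IsCore g₁ V₁ p₁ f₁ L₁ w₁) (h₂ : IsCore g₂ V₂ p₂ f₂ L₂ w₂) :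
    jacobianDual (tensorSpace V₁ V₂) (p₁, p₂) =
      jacobianDual V₁ p₁ * jacobianDual V₂ p₂ *
        ((‖evVec V₁ p₁‖ * ‖evVec V₂ p₂‖) ^ (Module.finrank ℝ E₁ + Module.finrank ℝ E₂) /
          (‖evVec V₁ p₁‖ ^ Module.finrank ℝ E₁ * ‖evVec V₂ p₂‖ ^ Module.finrank ℝ E₂)) := by
  have h := h₁.prod h₂
  rw [jacobianDual_eq_prod h.frame h.orthogonal, jacobianDual_eq_prod h₁.frame h₁.orthogonal,
    jacobianDual_eq_prod h₂.frame h₂.orthogonal, Fintype.prod_sum_type]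
  simp only [adjunctionDual_prodFrame_inl, adjunctionDual_prodFrame_inr, norm_tmulV,
    Finset.prod_mul_distrib, Finset.prod_const, Finset.card_univ]
  rw [card_eq_finrank_of_frame h₁.frame, card_eq_finrank_of_frame h₂.frame]
  have n₁ : ‖evVec V₁ p₁‖ ≠ 0 := norm_ne_zero_iff.2 h₁.evVec_ne_zero
  have n₂ : ‖evVec V₂ p₂‖ ≠ 0 := norm_ne_zero_iff.2 h₂.evVec_ne_zero
  field_simp
  ring

end Product

/-! ### Products of special triples -/

section Reindex

variable {E : Type*} [NormedAddCommGroup E] [NormedSpace ℝ E] [FiniteDimensional ℝ E]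
  [MeasurableSpace E] [BorelSpace E]
  {H : Type*} [TopologicalSpace H] {I : ModelWithCorners ℝ E H} [I.Boundaryless]
  {M : Type*} [TopologicalSpace M] [ChartedSpace H M] [IsManifold I ∞ M]
  [T2Space M] [CompactSpace M] [MeasurableSpace M] [BorelSpace M]
  {g : RMetric I M} {V : Submodule ℝ (SmoothFun g)} [FiniteDimensional ℝ V]
  {ι : Type*} [Fintype ι] [DecidableEq ι] {κ : Type*} [Fintype κ] [DecidableEq κ]
  {p : M} {f : ι → TangentSpace I p} {L : Submodule ℝ V} {w : V}

theorem hessian_comp (e : κ ≃ ι) (v : SmoothFun g) :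
    hessian p (f ∘ e) v = (hessian p f v).submatrix e e := by
  ext r s
  simp only [hessian, Matrix.of_apply, Matrix.submatrix_apply, Function.comp_apply]
  congr 1
  exact e.sum_comp fun t => (fderiv ℝ (fun y => coordMetric g p y
    (mfderiv I 𝓘(ℝ, E) (extChartAt I p) p (f (e s)))
    (mfderiv I 𝓘(ℝ, E) (extChartAt I p) p (f t))) (extChartAt I p p)
    (mfderiv I 𝓘(ℝ, E) (extChartAt I p) p (f (e r))) +
    fderiv ℝ (fun y => coordMetric g p y
    (mfderiv I 𝓘(ℝ, E) (extChartAt I p) p (f (e r)))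
    (mfderiv I 𝓘(ℝ, E) (extChartAt I p) p (f t))) (extChartAt I p p)
    (mfderiv I 𝓘(ℝ, E) (extChartAt I p) p (f (e s))) -
    fderiv ℝ (fun y => coordMetric g p y
    (mfderiv I 𝓘(ℝ, E) (extChartAt I p) p (f (e r)))
    (mfderiv I 𝓘(ℝ, E) (extChartAt I p) p (f (e s)))) (extChartAt I p p)
    (mfderiv I 𝓘(ℝ, E) (extChartAt I p) p (f t))) / 2 * mvfderiv I v p (f t)

/-- The product frame is indexed by a sum type, whereas `IsSpecial` asks for a frame indexed by
`Fin`. -/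
theorem IsCore.reindex (h : IsCore g V p f L w) (e : κ ≃ ι) : IsCore g V p (f ∘ e) L w where
  frame := by
    refine ⟨fun r s => (h.frame.1 (e r) (e s)).trans ?_, ?_⟩
    · simp only [e.injective.eq_iff]
    · rw [e.surjective.range_comp]
      exact h.frame.2
  orthogonal r s hrs := h.orthogonal (e r) (e s) fun h0 => hrs (e.injective h0)
  le_critSpace := h.le_critSpace
  hessian_eq_zero v hv := by
    rw [hessian_comp, h.hessian_eq_zero v hv]
    rfl
  mem_critSpace := h.mem_critSpace
  mem_orthogonal := h.mem_orthogonal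
  eval_ne_zero := h.eval_ne_zero
  norm_eq_one := h.norm_eq_one
  eval_eq_zero := h.eval_eq_zero

/-- A symmetry carries `w` from `p` to any other point. Such a function at every point is what makes
the tensor space ample. -/
theorem IsHomogeneousTriple.exists_mem_critSpace (hV : IsHomogeneousTriple g V)
    (h : IsCore g V p f L w) (x : M) : ∃ u ∈ critSpace V x, u.1 x ≠ 0 := by
  obtain ⟨φ, T, hφ, -, hT⟩ := hV.exists_symmetry x p
  refine ⟨T w, ?_, ?_⟩
  · have hx : x ∈ critSet (T w).1 := by
      rw [hT.critSet_eq, Set.mem_preimage, hφ]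
      exact h.mem_critSpace
    exact hx
  · rw [hT, hφ]
    exact h.eval_ne_zero

end Reindex

section Product

variable {E₁ : Type*} [NormedAddCommGroup E₁] [NormedSpace ℝ E₁] [FiniteDimensional ℝ E₁]
  [MeasurableSpace E₁] [BorelSpace E₁]
  {H₁ : Type*} [TopologicalSpace H₁] {I₁ : ModelWithCorners ℝ E₁ H₁} [I₁.Boundaryless]
  {M₁ : Type*} [TopologicalSpace M₁] [ChartedSpace H₁ M₁] [IsManifold I₁ ∞ M₁]
  [T2Space M₁] [SecondCountableTopology M₁] [CompactSpace M₁] [MeasurableSpace M₁] [BorelSpace M₁]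
  {E₂ : Type*} [NormedAddCommGroup E₂] [NormedSpace ℝ E₂] [FiniteDimensional ℝ E₂]
  [MeasurableSpace E₂] [BorelSpace E₂]
  {H₂ : Type*} [TopologicalSpace H₂] {I₂ : ModelWithCorners ℝ E₂ H₂} [I₂.Boundaryless]
  {M₂ : Type*} [TopologicalSpace M₂] [ChartedSpace H₂ M₂] [IsManifold I₂ ∞ M₂]
  [T2Space M₂] [SecondCountableTopology M₂] [CompactSpace M₂] [MeasurableSpace M₂] [BorelSpace M₂]
  {g₁ : RMetric I₁ M₁} {g₂ : RMetric I₂ M₂}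
  {V₁ : Submodule ℝ (SmoothFun g₁)} {V₂ : Submodule ℝ (SmoothFun g₂)}

/-- If `u₂` is critical at `x₂`, the differential of `v₁ ⊗ u₂` there is `u₂(x₂) d v₁`, purely in the
first direction, and symmetrically for `u₁ ⊗ v₂`. Dividing by the nonzero values lets the two
components of a covector be prescribed independently. -/
theorem adjunction_tensor_surjective {x : M₁ × M₂}
    (h₁ : Function.Surjective (adjunction V₁ x.1)) (h₂ : Function.Surjective (adjunction V₂ x.2))
    (hu₁ : ∃ u ∈ critSpace V₁ x.1, u.1 x.1 ≠ 0) (hu₂ : ∃ u ∈ critSpace V₂ x.2, u.1 x.2 ≠ 0) :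
    Function.Surjective (adjunction (tensorSpace V₁ V₂) x) := by
  intro ξ
  obtain ⟨u₁, hu₁, hu₁x⟩ := hu₁
  obtain ⟨u₂, hu₂, hu₂x⟩ := hu₂
  have hu₁' : adjunction V₁ x.1 u₁ = 0 := hu₁
  have hu₂' : adjunction V₂ x.2 u₂ = 0 := hu₂
  let ξ' : E₁ × E₂ →L[ℝ] ℝ := ξ
  obtain ⟨v₁, hv₁⟩ := h₁ ((u₂.1 x.2)⁻¹ • ξ'.comp (ContinuousLinearMap.inl ℝ E₁ E₂))
  obtain ⟨v₂, hv₂⟩ := h₂ ((u₁.1 x.1)⁻¹ • ξ'.comp (ContinuousLinearMap.inr ℝ E₁ E₂))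
  refine ⟨tmulV V₁ V₂ v₁ u₂ + tmulV V₁ V₂ u₁ v₂, ContinuousLinearMap.ext fun X => ?_⟩
  have e₁ := adjunction_tmulV x v₁ u₂ X
  have e₂ := adjunction_tmulV x u₁ v₂ X
  rw [hv₁, hu₂'] at e₁
  rw [hv₂, hu₁'] at e₂
  have e₁' : adjunction (tensorSpace V₁ V₂) x (tmulV V₁ V₂ v₁ u₂) X =
      (u₂.1 x.2)⁻¹ * ξ' ((X : E₁ × E₂).1, 0) * u₂.1 x.2 + v₁.1 x.1 * 0 := e₁
  have e₂' : adjunction (tensorSpace V₁ V₂) x (tmulV V₁ V₂ u₁ v₂) X =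
      0 * v₂.1 x.2 + u₁.1 x.1 * ((u₁.1 x.1)⁻¹ * ξ' (0, (X : E₁ × E₂).2)) := e₂
  have e₃ : ξ X = ξ' ((X : E₁ × E₂).1, 0) + ξ' (0, (X : E₁ × E₂).2) := by
    rw [← map_add]
    exact congrArg ξ' (Prod.ext (add_zero _).symm (zero_add _).symm)
  rw [map_add, add_apply, e₁', e₂', e₃]
  field_simp
  ring

/-- The componentwise action of a product of groups on a product. -/
@[reducible] def prodMulAction (G₁ G₂ : Type*) [Group G₁] [Group G₂] (M₁ M₂ : Type*)
    [MulAction G₁ M₁] [MulAction G₂ M₂] : MulAction (G₁ × G₂) (M₁ × M₂) where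
  smul a x := (a.1 • x.1, a.2 • x.2)
  one_smul x := Prod.ext (one_smul G₁ x.1) (one_smul G₂ x.2)
  mul_smul a b x := Prod.ext (mul_smul a.1 b.1 x.1) (mul_smul a.2 b.2 x.2)

attribute [local instance] prodMulAction

theorem prod_pullbackForm {φ₁ : M₁ → M₁} {φ₂ : M₂ → M₂} (x : M₁ × M₂)
    (hφ₁ : MDifferentiableAt I₁ I₁ φ₁ x.1) (hφ₂ : MDifferentiableAt I₂ I₂ φ₂ x.2)
    (X Y : TangentSpace (I₁.prod I₂) x) :
    pullbackForm (prodMetric g₁ g₂) (Prod.map φ₁ φ₂) x X Y =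
      pullbackForm (I := I₁) g₁ φ₁ x.1 X.1 Y.1 + pullbackForm (I := I₂) g₂ φ₂ x.2 X.2 Y.2 := by
  rw [pullbackForm_apply, mfderiv_prodMap hφ₁ hφ₂]
  exact prodInner_apply g₁ g₂ _ _ _

theorem IsHomogeneousUnder.prod {EG₁ : Type*} [NormedAddCommGroup EG₁] [NormedSpace ℝ EG₁]
    {HG₁ : Type*} [TopologicalSpace HG₁] {IG₁ : ModelWithCorners ℝ EG₁ HG₁}
    {G₁ : Type*} [Group G₁] [TopologicalSpace G₁] [ChartedSpace HG₁ G₁] [MulAction G₁ M₁]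
    {EG₂ : Type*} [NormedAddCommGroup EG₂] [NormedSpace ℝ EG₂]
    {HG₂ : Type*} [TopologicalSpace HG₂] {IG₂ : ModelWithCorners ℝ EG₂ HG₂}
    {G₂ : Type*} [Group G₂] [TopologicalSpace G₂] [ChartedSpace HG₂ G₂] [MulAction G₂ M₂]
    (h₁ : IsHomogeneousUnder IG₁ G₁ g₁ V₁) (h₂ : IsHomogeneousUnder IG₂ G₂ g₂ V₂) :
    IsHomogeneousUnder (IG₁.prod IG₂) (G₁ × G₂) (prodMetric g₁ g₂) (tensorSpace V₁ V₂) := by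
  have hs : ContMDiff ((IG₁.prod IG₂).prod (I₁.prod I₂)) (I₁.prod I₂) ∞
      fun q : (G₁ × G₂) × (M₁ × M₂) => q.1 • q.2 :=
    (h₁.smooth.comp ((contMDiff_fst.comp contMDiff_fst).prodMk
      (contMDiff_fst.comp contMDiff_snd))).prodMk
    (h₂.smooth.comp ((contMDiff_snd.comp contMDiff_fst).prodMk
      (contMDiff_snd.comp contMDiff_snd)))
  have hiso : ∀ (a : G₁ × G₂) (x : M₁ × M₂) (X Y : TangentSpace (I₁.prod I₂) x),
      pullbackForm (prodMetric g₁ g₂) (fun y : M₁ × M₂ => a • y) x X Y =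
        (prodMetric g₁ g₂).inner x X Y := by
    intro a x X Y
    have d₁ : MDifferentiableAt I₁ I₁ (fun y : M₁ => a.1 • y) x.1 :=
      ((smulDiffeomorph h₁.smooth a.1).contMDiff x.1).mdifferentiableAt (by simp)
    have d₂ : MDifferentiableAt I₂ I₂ (fun y : M₂ => a.2 • y) x.2 :=
      ((smulDiffeomorph h₂.smooth a.2).contMDiff x.2).mdifferentiableAt (by simp)
    refine (prod_pullbackForm x d₁ d₂ X Y).trans ?_
    refine (congrArg₂ (· + ·) (h₁.isometric a.1 x.1 X.1 Y.1)
      (h₂.isometric a.2 x.2 X.2 Y.2)).trans ?_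
    exact (prodInner_apply g₁ g₂ x X Y).symm
  refine ⟨hs, fun x y => ?_, hiso, fun a v hv => ?_, ?_⟩
  · obtain ⟨a₁, ha₁⟩ := h₁.transitive x.1 y.1
    obtain ⟨a₂, ha₂⟩ := h₂.transitive x.2 y.2
    exact ⟨(a₁, a₂), Prod.ext ha₁ ha₂⟩
  -- The functions whose pullback lies in `V₁ ⊗ V₂` form a subspace, so decomposable functions
  -- suffice.
  · let S : Submodule ℝ (SmoothFun (prodMetric g₁ g₂)) :=
      { carrier := {v | ∃ u ∈ tensorSpace V₁ V₂, ∀ x, u x = v (a • x)}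
        add_mem' := by
          rintro v v' ⟨u, hu, huv⟩ ⟨u', hu', huv'⟩
          exact ⟨u + u', add_mem hu hu', fun x => congrArg₂ (· + ·) (huv x) (huv' x)⟩
        zero_mem' := ⟨0, zero_mem _, fun x => rfl⟩
        smul_mem' := by
          rintro c v ⟨u, hu, huv⟩
          exact ⟨c • u, Submodule.smul_mem _ c hu, fun x => congrArg (c * ·) (huv x)⟩ }
    have hS : tensorSpace V₁ V₂ ≤ S := Submodule.map₂_le.2 fun v₁ hv₁ v₂ hv₂ => by
      obtain ⟨u₁, hu₁, huv₁⟩ := h₁.pullback_mem a.1 v₁ hv₁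
      obtain ⟨u₂, hu₂, huv₂⟩ := h₂.pullback_mem a.2 v₂ hv₂
      exact ⟨tmul g₁ g₂ u₁ u₂, Submodule.apply_mem_map₂ _ hu₁ hu₂,
        fun x => congrArg₂ (· * ·) (huv₁ x.1) (huv₂ x.2)⟩
    exact hS hv
  · intro a v _ v' _ u _ u' _ hu hu'
    -- The inner product is preserved because the acting diffeomorphism is an isometry, hence
    -- preserves the volume in the integral that defines it.
    have hφ : IsIsometric (prodMetric g₁ g₂) (smulDiffeomorph hs a) := hiso a
    have hm := measurePreserving_isometric hφ
    rw [SmoothFun.inner_def, SmoothFun.inner_def, ← hm.integral_comp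
      (smulDiffeomorph hs a).toHomeomorph.measurableEmbedding fun x => v x * v' x]
    refine integral_congr_ae (Filter.Eventually.of_forall fun x => ?_)
    exact congrArg₂ (· * ·) (hu x) (hu' x)

variable [FiniteDimensional ℝ V₁] [FiniteDimensional ℝ V₂]
  {ι₁ : Type*} [Fintype ι₁] [DecidableEq ι₁] {ι₂ : Type*} [Fintype ι₂] [DecidableEq ι₂]
  {p₁ : M₁} {f₁ : ι₁ → TangentSpace I₁ p₁} {L₁ : Submodule ℝ V₁} {w₁ : V₁}
  {p₂ : M₂} {f₂ : ι₂ → TangentSpace I₂ p₂} {L₂ : Submodule ℝ V₂} {w₂ : V₂}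

theorem IsHomogeneousTriple.prod (hV₁ : IsHomogeneousTriple g₁ V₁)
    (hV₂ : IsHomogeneousTriple g₂ V₂) (h₁ : IsCore g₁ V₁ p₁ f₁ L₁ w₁)
    (h₂ : IsCore g₂ V₂ p₂ f₂ L₂ w₂) :
    IsHomogeneousTriple (prodMetric g₁ g₂) (tensorSpace V₁ V₂) := by
  refine ⟨fun x => adjunction_tensor_surjective (hV₁.1 x.1) (hV₂.1 x.2)
    (hV₁.exists_mem_critSpace h₁ x.1) (hV₂.exists_mem_critSpace h₂ x.2), ?_⟩
  obtain ⟨-, EG₁, _, _, _, HG₁, _, IG₁, _, G₁, _, _, _, _, _, _, _, hG₁⟩ := hV₁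
  obtain ⟨-, EG₂, _, _, _, HG₂, _, IG₂, _, G₂, _, _, _, _, _, _, _, hG₂⟩ := hV₂
  exact ⟨EG₁ × EG₂, inferInstance, inferInstance, inferInstance, ModelProd HG₁ HG₂, inferInstance,
    IG₁.prod IG₂, inferInstance, G₁ × G₂, inferInstance, inferInstance, inferInstance,
    inferInstance, inferInstance, inferInstance, prodMulAction G₁ G₂ M₁ M₂, hG₁.prod hG₂⟩

theorem isSpecial_prod (hV₁ : IsHomogeneousTriple g₁ V₁)
    (hV₂ : IsHomogeneousTriple g₂ V₂) (h₁ : IsCore g₁ V₁ p₁ f₁ L₁ w₁)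
    (h₂ : IsCore g₂ V₂ p₂ f₂ L₂ w₂) : IsSpecial (prodMetric g₁ g₂) (tensorSpace V₁ V₂) :=
  ⟨hV₁.prod hV₂ h₁ h₂, _, _, _, _, (h₁.prod h₂).reindex
    (Fintype.equivFinOfCardEq (card_eq_finrank_of_frame (h₁.prod h₂).frame)).symm⟩

end Product

end CritSet

end

theorem proposition4p2
    {E : Type*} [NormedAddCommGroup E] [NormedSpace ℝ E] [FiniteDimensional ℝ E]
    [MeasurableSpace E] [BorelSpace E]
    {H : Type*} [TopologicalSpace H] (I : ModelWithCorners ℝ E H) [I.Boundaryless]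
    {M : Type*} [TopologicalSpace M] [ChartedSpace H M] [IsManifold I ∞ M]
    [T2Space M] [SecondCountableTopology M] [CompactSpace M] [ConnectedSpace M]
    [MeasurableSpace M] [BorelSpace M]
    (g : RMetric I M)
    (V : Submodule ℝ (SmoothFun g)) [FiniteDimensional ℝ V]
    (hV : IsHomogeneousTriple g V)
    {ι : Type*} [Fintype ι] [DecidableEq ι]
    (p : M) (f : ι → TangentSpace I p) (L : Submodule ℝ V) (w : V)
    (hcore : IsCore g V p f L w) :
    -- (a), with `m = dim M` and `ℓ = dim L`
    (0 < Module.finrank ℝ E →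
      expectedCrit g V = ENNReal.ofReal
        ((riemVolume g).real Set.univ *
            Real.Gamma (((Module.finrank ℝ L : ℝ) + Module.finrank ℝ E) / 2) /
          (2 * Real.pi ^ (((Module.finrank ℝ L : ℝ) + Module.finrank ℝ E) / 2) *
            ∏ r, ‖adjunctionDual V p (f r)‖) *
          ∫ v : Metric.sphere (0 : L) 1, |(hessian p f (v : L).1.1).det|
            ∂(sphereArea L))) ∧
    expectedCrit g V = ENNReal.ofReal
      ((riemVolume g).real Set.univ /
        (Real.pi ^ (((Module.finrank ℝ L : ℝ) + Module.finrank ℝ E) / 2) *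
          ∏ r, ‖adjunctionDual V p (f r)‖) *
        ∫ u : L, Real.exp (-‖u‖ ^ 2) * |(hessian p f u.1.1).det|
          ∂(euclVolume L)) ∧
    -- (b)
    ∀ {E₂ : Type*} [NormedAddCommGroup E₂] [NormedSpace ℝ E₂] [FiniteDimensional ℝ E₂]
      [MeasurableSpace E₂] [BorelSpace E₂]
      {H₂ : Type*} [TopologicalSpace H₂] (I₂ : ModelWithCorners ℝ E₂ H₂) [I₂.Boundaryless]
      {M₂ : Type*} [TopologicalSpace M₂] [ChartedSpace H₂ M₂] [IsManifold I₂ ∞ M₂]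
      [T2Space M₂] [SecondCountableTopology M₂] [CompactSpace M₂] [ConnectedSpace M₂]
      [MeasurableSpace M₂] [BorelSpace M₂]
      (g₂ : RMetric I₂ M₂)
      (V₂ : Submodule ℝ (SmoothFun g₂)) [FiniteDimensional ℝ V₂]
      (_ : IsHomogeneousTriple g₂ V₂)
      {ι₂ : Type*} [Fintype ι₂] [DecidableEq ι₂]
      (p₂ : M₂) (f₂ : ι₂ → TangentSpace I₂ p₂) (L₂ : Submodule ℝ V₂) (w₂ : V₂)
      (_ : IsCore g₂ V₂ p₂ f₂ L₂ w₂),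
      IsSpecial (prodMetric g g₂) (tensorSpace V V₂) ∧
      IsCore (prodMetric g g₂) (tensorSpace V V₂) (p, p₂)
        (prodFrame f f₂)
        (starSpace L w L₂ w₂ ⊔
          tensorSub (critSpace V p)ᗮ (critSpace V₂ p₂)ᗮ)
        (tmulV V V₂ w w₂) ∧
      Submodule.IsOrtho (𝕜 := ℝ) (E := tensorSpace V V₂) (starSpace L w L₂ w₂)
        (tensorSub (critSpace V p)ᗮ (critSpace V₂ p₂)ᗮ) ∧
      ‖evVec (tensorSpace V V₂) (p, p₂)‖ =
        ‖evVec V p‖ * ‖evVec V₂ p₂‖ ∧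
      jacobianDual (tensorSpace V V₂) (p, p₂) =
        jacobianDual V p * jacobianDual V₂ p₂ *
          ((‖evVec V p‖ * ‖evVec V₂ p₂‖) ^
              (Module.finrank ℝ E + Module.finrank ℝ E₂) /
            (‖evVec V p‖ ^ Module.finrank ℝ E *
              ‖evVec V₂ p₂‖ ^ Module.finrank ℝ E₂)) := by
  refine ⟨hcore.expectedCrit_eq_sphere hV, hcore.expectedCrit_eq hV, ?_⟩
  intro E₂ _ _ _ _ _ H₂ _ I₂ _ M₂ _ _ _ _ _ _ _ _ _ g₂ V₂ _ hV₂ ι₂ _ _ p₂ f₂ L₂ w₂ hcore₂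
  exact ⟨isSpecial_prod hV hV₂ hcore hcore₂, hcore.prod hcore₂, starSpace_isOrtho hcore hcore₂,
    norm_evVec_tensor (p, p₂), jacobianDual_tensor hcore hcore₂⟩
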